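/- Let $X$ be a K3 surface, that is, a compact simply connected complex surface with a nowhere vanishing holomorphic 2-form $\eta$, and let $f : X \to X$ be a (biholomorphic) automorphism. Let $\delta = \delta(f) \in \mathbb{C}$ be its special eigenvalue, defined by $f^*\eta = \delta\,\eta$, and assume that $\delta$ is conjugate over $\mathbb{Q}$ to a Salem number, i.e. to an algebraic integer $\lambda > 1$ that is conjugate to $\lambda^{-1}$ and whose remaining conjugates lie on the unit circle. (Then $X$ is non-projective with negative definite Picard lattice, and every irreducible curve in $X$ is a $(-2)$-curve, i.e. a smooth rational curve.) For a self-map $g$ of $X$ (here $g=f$ or an iterate $g = f^n$) and a fixed point $p$ of $g$, let $(g_1, g_2)$ be the expression of $g$ in a local chart $z = (z_1, z_2)$ centred at $p$, and put $$\mu_p(g) := \dim_{\mathbb{C}} \mathbb{C}\{z_1,z_2\}/(z_1 - g_1(z),\, z_2 - g_2(z)) \in \mathbb{N}\cup\{\infty\},$$ and, when $\mu_p(g) < \infty$, let $$\nu_p(g) := \operatorname{Res}_p \frac{dz_1 \wedge dz_2}{(z_1 - g_1(z))(z_2 - g_2(z))}$$ be the Grothendieck residue, i.e. $(2\pi i)^{-2}$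 times the integral of this form over the cycle $\{|z_1-g_1(z)| = \varepsilon_1,\ |z_2-g_2(z)| = \varepsilon_2\}$ in a small neighbourhood of $p$, for small $\varepsilon_1,\varepsilon_2>0$, oriented by $d\arg(z_1-g_1)\wedge d\arg(z_2-g_2)\ge 0$. The point $p$ is called an exceptional fixed point of type I of $g$ if $2 \le \mu_p(g) < \infty$ and there is a $g$-invariant smooth rational curve $E \ni p$ with $(d g_E)_p = 1$, where $g_E := g|_E$. If $p$ is an exceptional fixed point of type I of $f$, then for every integer $n \ge 1$ the point $p$ is an exceptional fixed point of type I of $f^n$, and $$\mu_p(f^n) = 2, \qquad \nu_p(f^n) = \frac{1+\delta^n}{(1-\delta^n)^2}.$$ -/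

import Mathlib

open Filter Topology
open scoped Manifold ContDiff

noncomputable section

namespace K3Surface

/-- The model space `ℂ²` of complex surfaces. -/
abbrev C2 : Type := Fin 2 → ℂ

/-! ### K3 surfaces, holomorphic 2-forms, the special eigenvalue -/

section Forms

variable (X : Type*) [TopologicalSpace X] [ChartedSpace C2 X]

/-- A holomorphic 2-form on a complex surface: an alternating `ℂ`-bilinear form on each holomorphic
tangent space, whose coefficient `h` in `h(z) dz₁ ∧ dz₂` is holomorphic in every chart of the atlas.
Here `h(z)` is the value of the form on the two coordinate vector fields `∂/∂z₁, ∂/∂z₂`. -/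
structure HolomorphicTwoForm where
  /-- The value of the form at a point. -/
  toFun : (x : X) → (TangentSpace 𝓘(ℂ, C2) x) [⋀^Fin 2]→L[ℂ] ℂ
  holomorphic : ∀ e ∈ atlas C2 X,
    AnalyticOnNhd ℂ
      (fun z : C2 => toFun (e.symm z)
        (fun i => mfderiv 𝓘(ℂ, C2) 𝓘(ℂ, C2) e.symm z (Pi.single i (1 : ℂ) : C2)))
      e.target

variable {X} in
/-- The form vanishes at no point. -/
def HolomorphicTwoForm.NowhereVanishing (η : HolomorphicTwoForm X) : Prop :=
  ∀ x : X, η.toFun x ≠ 0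

variable {X} in
/-- `f^* η = δ · η`. -/
def HolomorphicTwoForm.PullbackEqSMul (η : HolomorphicTwoForm X) (f : X → X) (δ : ℂ) : Prop :=
  ∀ (x : X) (v : Fin 2 → TangentSpace 𝓘(ℂ, C2) x),
    η.toFun (f x) (fun i => mfderiv 𝓘(ℂ, C2) 𝓘(ℂ, C2) f x (v i)) = δ * η.toFun x v

/-- A K3 surface: a compact simply connected (in particular connected) complex surface that carries
a nowhere vanishing holomorphic 2-form. -/
structure IsK3 : Prop where
  isManifold : IsManifold 𝓘(ℂ, C2) ω X
  t2 : T2Space X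
  compact : CompactSpace X
  simplyConnected : SimplyConnectedSpace X
  exists_form : ∃ η : HolomorphicTwoForm X, η.NowhereVanishing

variable {X} in
/-- `δ` is the special eigenvalue (determinant) of `f`: `f^* η = δ η` for a nowhere vanishing
holomorphic 2-form `η`. -/
def IsSpecialEigenvalue (f : X → X) (δ : ℂ) : Prop :=
  ∃ η : HolomorphicTwoForm X, η.NowhereVanishing ∧ η.PullbackEqSMul f δ

end Forms

/-- A Salem number: an algebraic integer `s > 1` which is conjugate to `s⁻¹` and whose remaining
conjugates lie on the unit circle. -/
def IsSalemNumber (s : ℝ) : Prop :=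
  1 < s ∧ IsIntegral ℤ s ∧ IsConjRoot ℚ (s : ℂ) ((s : ℂ)⁻¹) ∧
    ∀ z : ℂ, IsConjRoot ℚ (s : ℂ) z → z ≠ (s : ℂ) → z ≠ (s : ℂ)⁻¹ → ‖z‖ = 1

/-- `δ` is conjugate (over `ℚ`) to a Salem number. -/
def IsConjToSalem (δ : ℂ) : Prop :=
  ∃ s : ℝ, IsSalemNumber s ∧ IsConjRoot ℚ (s : ℂ) δ

/-! ### The ring `ℂ{z₁, z₂}` and multiplicities -/

/-- Germs of complex functions form a `ℂ`-algebra (with the pointwise scalar multiplication). -/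
instance germAlgebra {α : Type*} (l : Filter α) : Algebra ℂ (Germ l ℂ) :=
  Algebra.ofModule
    (fun r x y => by
      induction x using Germ.inductionOn with | _ x => ?_
      induction y using Germ.inductionOn with | _ y => ?_
      exact congrArg _ (smul_mul_assoc r x y))
    (fun r x y => by
      induction x using Germ.inductionOn with | _ x => ?_
      induction y using Germ.inductionOn with | _ y => ?_
      exact congrArg _ (mul_smul_comm r x y))

/-- The ring `ℂ{z₁, z₂}` of convergent power series, realized as the ring of germs at the origin of
holomorphic functions of two variables. -/
def ConvSeries : Subalgebra ℂ (Germ (𝓝 (0 : C2)) ℂ) where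
  carrier := {φ | ∃ u : C2 → ℂ, AnalyticAt ℂ u 0 ∧ (u : Germ (𝓝 (0 : C2)) ℂ) = φ}
  mul_mem' := by
    rintro _ _ ⟨u, hu, rfl⟩ ⟨v, hv, rfl⟩
    exact ⟨u * v, hu.mul hv, rfl⟩
  add_mem' := by
    rintro _ _ ⟨u, hu, rfl⟩ ⟨v, hv, rfl⟩
    exact ⟨u + v, hu.add hv, rfl⟩
  algebraMap_mem' := by
    intro r
    refine ⟨fun _ => r, analyticAt_const, ?_⟩
    rw [Algebra.algebraMap_eq_smul_one]
    refine Eq.trans ?_ (Germ.coe_smul r (1 : C2 → ℂ))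
    congr 1
    ext
    simp

/-- The ideal of `ℂ{z₁, z₂}` generated by (the germs at the origin of) the components `g₁, g₂`. -/
def germIdeal (g : C2 → C2) : Ideal ConvSeries :=
  Ideal.span {φ | ∃ i : Fin 2, (φ : Germ (𝓝 (0 : C2)) ℂ) = ((fun z => g z i : C2 → ℂ) :)}

/-- The intersection multiplicity `dim_ℂ ℂ{z₁, z₂} / (g₁, g₂)`, possibly infinite. -/
def germMultiplicity (g : C2 → C2) : ℕ∞ :=
  Cardinal.toENat (Module.rank ℂ (ConvSeries ⧸ germIdeal g))

/-! ### Grothendieck residues -/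

/-- The integrand of the integral of `dz₁ ∧ dz₂ / (g₁ g₂)` over the cycle
`Γ_ε = {z ∈ U : |g₁(z)| = ε₁, |g₂(z)| = ε₂}`, in the coordinates `w = g(z)`.

The map `g` sends `Γ_ε` onto the torus `T_ε = {|w₁| = ε₁, |w₂| = ε₂}` with finite fibres, and
`dw₁ ∧ dw₂ = det(Dg) dz₁ ∧ dz₂`. Thus `∫_{Γ_ε} dz₁ ∧ dz₂ / (g₁ g₂)`, where `Γ_ε` is oriented by
`d(arg g₁) ∧ d(arg g₂) ≥ 0`, equals `∫_{T_ε} (∑_{z ∈ U, g(z) = w} 1 / det(Dg)_z) dw₁ ∧ dw₂ / (w₁ w₂)`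
(the points where `det(Dg) = 0` map to a null set of the torus). -/
def residueIntegrand (g : C2 → C2) (U : Set C2) (w : C2) : ℂ :=
  (∑ᶠ z ∈ {z | z ∈ U ∧ g z = w}, ((fderiv ℂ g z).det)⁻¹) / (w 0 * w 1)

/-- `c` is the Grothendieck residue at the origin
`Res₀ dz₁ ∧ dz₂ / (g₁ g₂) = (2πi)⁻² ∫_{Γ_ε} dz₁ ∧ dz₂ / (g₁ g₂)`, for every sufficiently small
neighbourhood `U` of the origin and all `ε₁, ε₂ > 0` sufficiently small with respect to `U`. -/
def HasGrothendieckResidue (g : C2 → C2) (c : ℂ) : Prop :=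
  ∃ r > 0, ∀ U ∈ 𝓝 (0 : C2), U ⊆ Metric.ball 0 r →
    ∃ s > 0, ∀ ε : Fin 2 → ℝ, (∀ i, 0 < ε i ∧ ε i < s) →
      TorusIntegrable (residueIntegrand g U) 0 ε ∧
        ((2 * Real.pi * Complex.I) ^ 2)⁻¹ * torusIntegral (residueIntegrand g U) 0 ε = c

/-! ### Local invariants of fixed points -/

section Local

variable {X : Type*} [TopologicalSpace X] [ChartedSpace C2 X]

/-- The local representation of `f` in the chart at `p`, translated so that `p` corresponds to
the origin. -/
def localRep (f : X → X) (p : X) (z : C2) : C2 :=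
  chartAt C2 p (f ((chartAt C2 p).symm (z + chartAt C2 p p))) - chartAt C2 p p

/-- The multiplicity `μ_p(f) = dim_ℂ ℂ{z} / (z₁ - f₁(z), z₂ - f₂(z))` of a fixed point `p`. -/
def fixedPointMultiplicity (f : X → X) (p : X) : ℕ∞ :=
  germMultiplicity (fun z => z - localRep f p z)

/-- `c` is the holomorphic local index
`ν_p(f) = Res_p dz₁ ∧ dz₂ / ((z₁ - f₁(z)) (z₂ - f₂(z)))` of an isolated fixed point `p`. -/
def HasHolomorphicIndex (f : X → X) (p : X) (c : ℂ) : Prop :=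
  HasGrothendieckResidue (fun z => z - localRep f p z) c

/-! ### Rational curves and exceptional fixed points -/

/-- `φ` is an injective holomorphic immersion of the Riemann sphere `ℂ ∪ {∞}` into `X`, expressed
through the two standard charts `z` and `w = 1/z` of the sphere. As the sphere is compact, such a
map is a holomorphic embedding. -/
structure IsSphereEmbedding (φ : OnePoint ℂ → X) : Prop where
  injective : Function.Injective φ
  holomorphic : ContMDiff 𝓘(ℂ, ℂ) 𝓘(ℂ, C2) ω (fun z : ℂ => φ (z : OnePoint ℂ))
  immersion : ∀ z : ℂ, mfderiv 𝓘(ℂ, ℂ) 𝓘(ℂ, C2) (fun z : ℂ => φ (z : OnePoint ℂ)) z ≠ 0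
  holomorphic_infty : ContMDiff 𝓘(ℂ, ℂ) 𝓘(ℂ, C2) ω
    (fun w : ℂ => φ (if w = 0 then OnePoint.infty else ((w⁻¹ : ℂ) : OnePoint ℂ)))
  immersion_infty : mfderiv 𝓘(ℂ, ℂ) 𝓘(ℂ, C2)
    (fun w : ℂ => φ (if w = 0 then OnePoint.infty else ((w⁻¹ : ℂ) : OnePoint ℂ))) 0 ≠ 0

/-- `E` is a smooth rational curve in `X`. On a K3 surface these are exactly the `(-2)`-curves,
by the adjunction formula. -/
def IsSmoothRationalCurve (E : Set X) : Prop :=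
  ∃ φ : OnePoint ℂ → X, IsSphereEmbedding φ ∧ Set.range φ = E

/-- For a smooth rational curve `E` through the fixed point `p` of `f`, with `f(E) = E`: the map
`f_E = f|_E` has derivative `(d f_E)_p = c`, that is, `(df)_p` acts on the line `T_p E` as
multiplication by `c`. The embedding `φ` of the sphere is chosen with `φ(0) = p`, so that `T_p E` is
spanned by `φ'(0)`. -/
def HasMultiplierAlong (f : X → X) (p : X) (E : Set X) (c : ℂ) : Prop :=
  ∃ φ : OnePoint ℂ → X, IsSphereEmbedding φ ∧ Set.range φ = E ∧ φ ((0 : ℂ) : OnePoint ℂ) = p ∧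
    mfderiv 𝓘(ℂ, C2) 𝓘(ℂ, C2) f (φ ((0 : ℂ) : OnePoint ℂ))
        (mfderiv 𝓘(ℂ, ℂ) 𝓘(ℂ, C2) (fun z : ℂ => φ (z : OnePoint ℂ)) 0 (1 : ℂ)) =
      c • mfderiv 𝓘(ℂ, ℂ) 𝓘(ℂ, C2) (fun z : ℂ => φ (z : OnePoint ℂ)) 0 (1 : ℂ)

/-- `E` is an `f`-invariant smooth rational curve passing through `p`. -/
def IsInvariantCurveThrough (f : X → X) (p : X) (E : Set X) : Prop :=
  IsSmoothRationalCurve E ∧ f '' E = E ∧ p ∈ E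

/-- `p` is an exceptional fixed point of `f`: `2 ≤ μ_p(f) < ∞` and there is an `f`-invariant curve
passing through `p`. -/
def IsExceptionalFixedPoint (f : X → X) (p : X) : Prop :=
  f p = p ∧ 2 ≤ fixedPointMultiplicity f p ∧ fixedPointMultiplicity f p < ⊤ ∧
    ∃ E : Set X, IsInvariantCurveThrough f p E

/-- `p` is an exceptional fixed point of type I: there is an invariant curve `E` through `p` with
`(d f_E)_p = 1`. -/
def IsExceptionalTypeI (f : X → X) (p : X) : Prop :=
  IsExceptionalFixedPoint f p ∧
    ∃ E : Set X, IsInvariantCurveThrough f p E ∧ HasMultiplierAlong f p E 1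

end Local

end K3Surface

end

/-! The curve E is a Riemann sphere, and the automorphism acts on it with a fixed point p of
multiplier one. In the coordinate w = 1/t at infinity this action is a translation w ↦ w - a
(`exists_translation`), that is, t ↦ t/(1 - at) near p. If a were 0, the map would fix E pointwise
and p would have infinite multiplicity (`germMultiplicity_eq_top`). So a ≠ 0, and the n-th iterate
translates by na ≠ 0. It multiplies the area form by δⁿ, and δⁿ ≠ 1 because a root of unity is not
conjugate to a Salem number. It therefore suffices to treat one map with data a ≠ 0 and δ ≠ 1.

Its differential at p has eigenvalue 1 along E and determinant δ, so it is diag(1, δ) in linear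
coordinates. The displacement z - F(z) thus has linear part diag(0, 1 - δ), and along E it starts
with -at². The local algebra is that of a double point, with no higher terms involved
(`germMultiplicity_eq_two`).

For the residue, the second component of the displacement is used as a coordinate. Solving in the
remaining variable turns the torus integral into a one-variable residue at a double pole
(`hasGrothendieckResidue_of_coordinates`), namely the derivative at 0 of E₀'/(m k). Here E₀ is the
first coordinate of the parametrized curve, m is the transverse derivative of the displacement, and
x²k(x) is its first component where the second one vanishes. The one-jet of k follows from the
action on E. The one-jet of m follows from the invariance of the area form (`partial_snd`): the
determinant is stationary along E at p. In the result both a and the curvature term E₀''(0) cancel,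
leaving (1 + δ)/(1 - δ)². -/

noncomputable section

namespace K3Surface

/-! ### Hadamard's lemma and the local ring of convergent power series -/

/-- Hadamard's lemma: an analytic function `f` is `f 0 + A z z` with `A` analytic. -/
theorem exists_analyticAt_eq_add_apply {E : Type*} [NormedAddCommGroup E] [NormedSpace ℂ E]
    -- The `n`-th term of `p.shift` is the term of degree `n + 1` of `p` with its last argument left
    -- free. Its sum therefore takes values in linear forms, and evaluation at `z` restores all
    -- terms of positive degree.
    {f : E → ℂ} (hf : AnalyticAt ℂ f 0) :
    ∃ A : E → E →L[ℂ] ℂ, AnalyticAt ℂ A 0 ∧ ∀ᶠ z in 𝓝 (0 : E), f z = f 0 + A z z := by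
  obtain ⟨p, r, hp⟩ := hf
  have hrad : 0 < p.shift.radius := by
    rw [FormalMultilinearSeries.radius_shift]
    exact hp.r_pos.trans_le hp.r_le
  have hA := p.shift.hasFPowerSeriesOnBall hrad
  refine ⟨p.shift.sum, hA.analyticAt, ?_⟩
  filter_upwards [Metric.eball_mem_nhds (0 : E) hrad, Metric.eball_mem_nhds (0 : E) hp.r_pos]
    with z hz hz'
  have h1 := hp.hasSum hz'
  have h2 := hA.hasSum hz
  rw [zero_add] at h1 h2
  have h3 := h2.mapL (ContinuousLinearMap.apply ℂ ℂ z)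
  have h4 := (hasSum_nat_add_iff' 1).2 h1
  have h5 := h4.unique (a₂ := p.shift.sum z z) (by
    convert h3 using 2 with n
    · simp [FormalMultilinearSeries.shift]
      congr 1
      ext i
      refine Fin.lastCases ?_ (fun j => ?_) i <;> simp
    · rfl)
  have h6 : p 0 (fun _ => z) = f 0 := by
    rw [← hp.coeff_zero (fun _ => z)]
  rw [← h5]
  simp [h6]

/-- The germ at the origin of an analytic function. -/
def ConvSeries.of (u : C2 → ℂ) (hu : AnalyticAt ℂ u 0) : ConvSeries :=
  ⟨(u : Germ (𝓝 (0 : C2)) ℂ), u, hu, rfl⟩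

theorem ConvSeries.exists_eq_of (φ : ConvSeries) : ∃ u hu, φ = ConvSeries.of u hu := by
  obtain ⟨u, hu, h⟩ := φ.2
  exact ⟨u, hu, Subtype.ext h.symm⟩

theorem ConvSeries.of_eq_of {u v : C2 → ℂ} {hu : AnalyticAt ℂ u 0} {hv : AnalyticAt ℂ v 0} :
    ConvSeries.of u hu = ConvSeries.of v hv ↔ u =ᶠ[𝓝 0] v := by
  exact Subtype.ext_iff.trans Germ.coe_eq

theorem ConvSeries.of_add {u v : C2 → ℂ} (hu : AnalyticAt ℂ u 0) (hv : AnalyticAt ℂ v 0) :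
    ConvSeries.of u hu + ConvSeries.of v hv = ConvSeries.of (u + v) (hu.add hv) := rfl

theorem ConvSeries.of_mul {u v : C2 → ℂ} (hu : AnalyticAt ℂ u 0) (hv : AnalyticAt ℂ v 0) :
    ConvSeries.of u hu * ConvSeries.of v hv = ConvSeries.of (u * v) (hu.mul hv) := rfl

theorem ConvSeries.one_eq_of : (1 : ConvSeries) = ConvSeries.of 1 analyticAt_const := rfl

theorem ConvSeries.smul_of (c : ℂ) {u : C2 → ℂ} (hu : AnalyticAt ℂ u 0) :
    c • ConvSeries.of u hu = ConvSeries.of (c • u) (hu.const_smul (c := c)) := rfl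

/-- The value at the origin together with the derivative at the origin in the direction `v`. -/
def ConvSeries.jet (v : C2) : ConvSeries →ₗ[ℂ] ℂ × ℂ where
  -- The choice of a representative is harmless: two representatives agree near the origin, hence
  -- have the same value and derivative there.
  toFun φ := (φ.2.choose 0, fderiv ℂ φ.2.choose 0 v)
  map_add' φ ψ := by
    have hφ := φ.2.choose_spec
    have hψ := ψ.2.choose_spec
    have h : (φ + ψ).2.choose =ᶠ[𝓝 0] φ.2.choose + ψ.2.choose := by
      rw [← Germ.coe_eq, (φ + ψ).2.choose_spec.2, Germ.coe_add, hφ.2, hψ.2]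
      rfl
    rw [h.fderiv_eq, h.eq_of_nhds, fderiv_add hφ.1.differentiableAt hψ.1.differentiableAt]
    rfl
  map_smul' c φ := by
    have hφ := φ.2.choose_spec
    have h : (c • φ).2.choose =ᶠ[𝓝 0] c • φ.2.choose := by
      rw [← Germ.coe_eq, (c • φ).2.choose_spec.2, Germ.coe_smul, hφ.2]
      rfl
    rw [h.fderiv_eq, h.eq_of_nhds, fderiv_const_smul hφ.1.differentiableAt]
    rfl

theorem ConvSeries.jet_of (v : C2) {u : C2 → ℂ} (hu : AnalyticAt ℂ u 0) :
    ConvSeries.jet v (ConvSeries.of u hu) = (u 0, fderiv ℂ u 0 v) := by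
  have h : (ConvSeries.of u hu).2.choose =ᶠ[𝓝 0] u := by
    rw [← Germ.coe_eq, (ConvSeries.of u hu).2.choose_spec.2]
    rfl
  change ((ConvSeries.of u hu).2.choose 0, fderiv ℂ (ConvSeries.of u hu).2.choose 0 v) = _
  rw [h.fderiv_eq, h.eq_of_nhds]

theorem ConvSeries.isUnit_of {u : C2 → ℂ} (hu : AnalyticAt ℂ u 0) (h0 : u 0 ≠ 0) :
    IsUnit (ConvSeries.of u hu) := by
  refine IsUnit.of_mul_eq_one (ConvSeries.of _ (hu.inv h0)) ?_
  rw [ConvSeries.of_mul, ConvSeries.one_eq_of, ConvSeries.of_eq_of]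
  filter_upwards [hu.continuousAt.eventually_ne h0] with z hz
  simp [hz]

theorem analyticAt_coord (L : C2 ≃L[ℂ] C2) (i : Fin 2) (z : C2) :
    AnalyticAt ℂ (fun z : C2 => L z i) z :=
  ((ContinuousLinearMap.proj (R := ℂ) (φ := fun _ : Fin 2 => ℂ) i).comp
    (L : C2 →L[ℂ] C2)).analyticAt z

/-- The germ of the `i`-th component of a linear coordinate system. -/
def coordGerm (L : C2 ≃L[ℂ] C2) (i : Fin 2) : ConvSeries :=
  ConvSeries.of (fun z => L z i) (analyticAt_coord L i 0)

/-- Hadamard's lemma in linear coordinates. -/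
theorem exists_eq_add_coord (L : C2 ≃L[ℂ] C2) {u : C2 → ℂ} (hu : AnalyticAt ℂ u 0) :
    ∃ A B : C2 → ℂ, AnalyticAt ℂ A 0 ∧ AnalyticAt ℂ B 0 ∧
      (∀ᶠ z in 𝓝 0, u z = u 0 + A z * L z 0 + B z * L z 1) ∧
      A 0 = fderiv ℂ u 0 (L.symm ![1, 0]) ∧ B 0 = fderiv ℂ u 0 (L.symm ![0, 1]) := by
  obtain ⟨T, hT, h⟩ := exists_analyticAt_eq_add_apply hu
  have hd : fderiv ℂ u 0 = T 0 := by
    have h1 : HasFDerivAt (fun z : C2 => u 0 + T z z) (T 0) 0 := by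
      have := (hT.differentiableAt.hasFDerivAt.clm_apply (hasFDerivAt_id (𝕜 := ℂ) (0 : C2)))
      have h2 := this.const_add (u 0)
      refine h2.congr_fderiv ?_
      ext v
      simp
    exact (h1.congr_of_eventuallyEq h).fderiv
  refine ⟨fun z => T z (L.symm ![1, 0]), fun z => T z (L.symm ![0, 1]),
    ?_, ?_, ?_, by rw [hd], by rw [hd]⟩
  · exact ((ContinuousLinearMap.apply ℂ ℂ (L.symm ![1, 0])).analyticAt _).comp hT
  · exact ((ContinuousLinearMap.apply ℂ ℂ (L.symm ![0, 1])).analyticAt _).comp hT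
  · filter_upwards [h] with z hz
    have : z = (L z 0) • L.symm ![1, 0] + (L z 1) • L.symm ![0, 1] := by
      apply L.injective
      ext i
      fin_cases i <;> simp
    rw [hz]
    conv_lhs => rw [this]
    simp only [map_add, map_smul, smul_eq_mul]
    rw [← this]
    ring

/-- Hadamard's lemma shows that two linear coordinates generate the maximal ideal of the local ring.
-/
theorem mem_span_coordGerm (L : C2 ≃L[ℂ] C2) {u : C2 → ℂ} (hu : AnalyticAt ℂ u 0) (h0 : u 0 = 0) :
    ConvSeries.of u hu ∈ Ideal.span {coordGerm L 0, coordGerm L 1} := by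
  obtain ⟨A, B, hA, hB, h, -⟩ := exists_eq_add_coord L hu
  rw [Ideal.mem_span_pair]
  refine ⟨ConvSeries.of A hA, ConvSeries.of B hB, ?_⟩
  rw [coordGerm, coordGerm, ConvSeries.of_mul, ConvSeries.of_mul, ConvSeries.of_add,
    ConvSeries.of_eq_of]
  filter_upwards [h] with z hz
  simp [hz, h0]

/-- This makes Nakayama's lemma available. A germ of the form 1 + xψ, with x a coordinate, has value
1 at the origin and is a unit. -/
theorem span_coordGerm_le_jacobson (L : C2 ≃L[ℂ] C2) :
    Ideal.span {coordGerm L 0, coordGerm L 1} ≤ Ideal.jacobson ⊥ := by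
  rw [Ideal.span_le]
  rintro φ hφ
  rw [SetLike.mem_coe, Ideal.mem_jacobson_bot]
  intro ψ
  obtain ⟨v, hv, rfl⟩ := ConvSeries.exists_eq_of ψ
  have : ∃ i, φ = coordGerm L i := by
    rcases hφ with rfl | rfl
    exacts [⟨0, rfl⟩, ⟨1, rfl⟩]
  obtain ⟨i, rfl⟩ := this
  rw [coordGerm, ConvSeries.of_mul, ConvSeries.one_eq_of, ConvSeries.of_add]
  exact ConvSeries.isUnit_of _ (by simp)

/-- A linear change of coordinates in the target replaces the generators by constant linear
combinations of them. -/
theorem of_comp_mem_germIdeal {g : C2 → C2} (hg : AnalyticAt ℂ g 0) (L : C2 ≃L[ℂ] C2) (i : Fin 2)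
    (h : AnalyticAt ℂ (fun z => L (g z) i) 0) :
    ConvSeries.of (fun z => L (g z) i) h ∈ germIdeal g := by
  have hgi : ∀ j, AnalyticAt ℂ (fun z => g z j) 0 := fun j =>
    ((ContinuousLinearMap.proj (R := ℂ) (φ := fun _ : Fin 2 => ℂ) j).analyticAt _).comp hg
  have hmem : ∀ j, ConvSeries.of _ (hgi j) ∈ germIdeal g := fun j =>
    Ideal.subset_span ⟨j, rfl⟩
  have : ConvSeries.of (fun z => L (g z) i) h
      = (L (Pi.single 0 1) i) • ConvSeries.of _ (hgi 0)
        + (L (Pi.single 1 1) i) • ConvSeries.of _ (hgi 1) := by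
    rw [ConvSeries.smul_of, ConvSeries.smul_of, ConvSeries.of_add, ConvSeries.of_eq_of]
    refine Eventually.of_forall fun z => ?_
    have hz : g z = (g z 0) • Pi.single 0 1 + (g z 1) • Pi.single 1 1 := by
      ext j
      fin_cases j <;> simp
    change L (g z) i = _
    rw [hz]
    simp [mul_comm]
  rw [this, Algebra.smul_def, Algebra.smul_def]
  exact add_mem (Ideal.mul_mem_left _ _ (hmem 0)) (Ideal.mul_mem_left _ _ (hmem 1))

/-- For a direction in the kernel of the differential, the generators have zero value and zero
derivative. By the Leibniz rule this property passes to the ideal they generate. -/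
theorem mem_ker_jet_of_mem_germIdeal {g : C2 → C2} (hg : AnalyticAt ℂ g 0) (h0 : g 0 = 0) {v : C2}
    (hv : fderiv ℂ g 0 v = 0) {φ : ConvSeries} (hφ : φ ∈ germIdeal g) :
    ConvSeries.jet v φ = 0 := by
  have hgi : ∀ j, AnalyticAt ℂ (fun z => g z j) 0 := fun j =>
    ((ContinuousLinearMap.proj (R := ℂ) (φ := fun _ : Fin 2 => ℂ) j).analyticAt _).comp hg
  induction hφ using Submodule.span_induction with
  | mem φ h =>
    obtain ⟨j, hj⟩ := h
    have : φ = ConvSeries.of _ (hgi j) := Subtype.ext hj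
    rw [this, ConvSeries.jet_of]
    have h1 : HasFDerivAt (fun z => g z j) _ 0 :=
      hasFDerivAt_pi'.1 hg.differentiableAt.hasFDerivAt j
    rw [h1.fderiv]
    simp [h0, hv]
  | zero => simp
  | add φ ψ _ _ h1 h2 => rw [map_add, h1, h2, add_zero]
  | smul a φ _ h =>
    obtain ⟨u, hu, rfl⟩ := ConvSeries.exists_eq_of φ
    obtain ⟨w, hw, rfl⟩ := ConvSeries.exists_eq_of a
    rw [ConvSeries.jet_of, Prod.mk_eq_zero] at h
    rw [smul_eq_mul, ConvSeries.of_mul, ConvSeries.jet_of,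
      fderiv_mul hw.differentiableAt hu.differentiableAt]
    simp [h.1, h.2]

/-- The converse inclusion, by Nakayama. Let x, y be the coordinates, M the maximal ideal and I the
ideal of `g`. The second component is κy plus terms in M², so y ∈ I + M². The first component has no
linear part and its x²-coefficient is c, so x² ∈ I + M³. Hence M² ⊆ I + M³, which forces M² ⊆ I and
then y ∈ I. A germ with vanishing jet lies in M² + (y). -/
theorem mem_germIdeal_of_jet_eq_zero {g : C2 → C2} (hg : AnalyticAt ℂ g 0) (h0 : g 0 = 0)
    (L : C2 ≃L[ℂ] C2) {κ : ℂ} (hκ : κ ≠ 0)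
    (hD : ∀ v, L (fderiv ℂ g 0 (L.symm v)) = ![0, κ * v 1])
    {e : ℂ → C2} (he : Tendsto e (𝓝[≠] 0) (𝓝 0)) {c : ℂ} (hc : c ≠ 0)
    (hge : Tendsto (fun t => L (g (e t)) 0 / t ^ 2) (𝓝[≠] 0) (𝓝 c))
    (he0 : Tendsto (fun t => L (e t) 0 / t) (𝓝[≠] 0) (𝓝 1))
    (he1 : Tendsto (fun t => L (e t) 1 / t) (𝓝[≠] 0) (𝓝 0))
    {φ : ConvSeries} (hφ : ConvSeries.jet (L.symm ![1, 0]) φ = 0) : φ ∈ germIdeal g := by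
  have hgi : ∀ j, AnalyticAt ℂ (fun z => L (g z) j) 0 := fun j =>
    (analyticAt_coord L j _).comp hg
  have hgd : ∀ (j : Fin 2) v, fderiv ℂ (fun z => L (g z) j) 0 v = L (fderiv ℂ g 0 v) j := by
    intro j v
    have h1 := ((ContinuousLinearMap.proj (R := ℂ) (φ := fun _ : Fin 2 => ℂ) j).comp
      (L : C2 →L[ℂ] C2)).hasFDerivAt.comp (0 : C2) hg.differentiableAt.hasFDerivAt
    have h2 : HasFDerivAt (fun z => L (g z) j) _ 0 := h1
    rw [h2.fderiv]
    rfl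
  set x := coordGerm L 0 with hx
  set y := coordGerm L 1 with hy
  set M := Ideal.span {x, y} with hM
  set I := germIdeal g with hI
  have hxM : x ∈ M := Ideal.subset_span (by simp)
  have hyM : y ∈ M := Ideal.subset_span (by simp)
  have hunit : ∀ z : ℂ, z ≠ 0 → IsUnit (algebraMap ℂ ConvSeries z) := fun z hz =>
    (IsUnit.mk0 z hz).map _
  have hyIM : y ∈ I ⊔ M ^ 2 := by
    obtain ⟨A, B, hA, hB, h, hA0, hB0⟩ := exists_eq_add_coord L (hgi 1)
    rw [hgd, hD] at hA0 hB0
    have hB' : AnalyticAt ℂ (fun z => B z - κ) 0 := hB.sub analyticAt_const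
    have h1 : ConvSeries.of A hA ∈ M := mem_span_coordGerm L hA (by simpa using hA0)
    have h2 : ConvSeries.of _ hB' ∈ M := mem_span_coordGerm L hB' (by simp [hB0])
    have h3 : ConvSeries.of _ (hgi 1) ∈ I := of_comp_mem_germIdeal hg L 1 (hgi 1)
    have h4 : algebraMap ℂ ConvSeries κ * y = ConvSeries.of _ (hgi 1)
        - (ConvSeries.of A hA * x + ConvSeries.of _ hB' * y) := by
      rw [eq_sub_iff_add_eq, ← Algebra.smul_def, hx, hy, coordGerm, coordGerm,
        ConvSeries.of_mul, ConvSeries.of_mul, ConvSeries.smul_of, ConvSeries.of_add,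
        ConvSeries.of_add, ConvSeries.of_eq_of]
      filter_upwards [h] with z hz
      simp [hz, h0]
      ring
    rw [← Ideal.unit_mul_mem_iff_mem (I ⊔ M ^ 2) (hunit κ hκ)]
    rw [h4]
    refine sub_mem (Ideal.mem_sup_left h3) (Ideal.mem_sup_right ?_)
    rw [pow_two]
    exact add_mem (Ideal.mul_mem_mul h1 hxM) (Ideal.mul_mem_mul h2 hyM)
  have hmul : ∀ z ∈ M, z * y ∈ I ⊔ M * M ^ 2 := by
    intro z hz
    obtain ⟨a, ha, b, hb, hab⟩ := Submodule.mem_sup.1 hyIM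
    rw [← hab, mul_add]
    exact add_mem (Ideal.mem_sup_left (Ideal.mul_mem_left _ _ ha))
      (Ideal.mem_sup_right (Ideal.mul_mem_mul hz hb))
  have hxx : x * x ∈ I ⊔ M * M ^ 2 := by
    obtain ⟨A, B, hA, hB, h, hA0, hB0⟩ := exists_eq_add_coord L (hgi 0)
    rw [hgd, hD] at hA0 hB0
    obtain ⟨A', B', hA', hB', h', -⟩ := exists_eq_add_coord L hA
    obtain ⟨A'', B'', hA'', hB'', h'', -⟩ := exists_eq_add_coord L hB
    simp only [Matrix.cons_val_zero] at hA0 hB0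
    -- The x²-coefficient is read off along the curve `e`: after division by t², every monomial
    -- containing y tends to 0, because y/t → 0 and x/t → 1.
    have hc' : A' 0 = c := by
      have hlim : Tendsto (fun t => A' (e t) * (L (e t) 0 / t) ^ 2
          + (B' (e t) + A'' (e t)) * ((L (e t) 0 / t) * (L (e t) 1 / t))
          + B'' (e t) * (L (e t) 1 / t) ^ 2) (𝓝[≠] 0)
          (𝓝 (A' 0 * 1 ^ 2 + (B' 0 + A'' 0) * (1 * 0) + B'' 0 * 0 ^ 2)) :=
        (((hA'.continuousAt.tendsto.comp he).mul (he0.pow 2)).add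
          (((hB'.continuousAt.tendsto.comp he).add (hA''.continuousAt.tendsto.comp he)).mul
            (he0.mul he1))).add ((hB''.continuousAt.tendsto.comp he).mul (he1.pow 2))
      have := tendsto_nhds_unique (hlim.congr' ?_) hge
      · simpa using this
      · filter_upwards [he.eventually h, he.eventually h', he.eventually h'',
          self_mem_nhdsWithin] with t h1 h2 h3 (ht : t ≠ 0)
        rw [h1, h2, h3, hA0, hB0, h0]
        simp
        field_simp
        ring
    have h1 : ConvSeries.of A' hA' * (x * x) = ConvSeries.of _ (hgi 0)
        - ((ConvSeries.of B' hB' + ConvSeries.of A'' hA'') * x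
          + ConvSeries.of B'' hB'' * y) * y := by
      rw [eq_sub_iff_add_eq, hx, hy, coordGerm, coordGerm]
      simp only [ConvSeries.of_mul, ConvSeries.of_add]
      rw [ConvSeries.of_eq_of]
      filter_upwards [h, h', h''] with z h1 h2 h3
      simp [h1, h2, h3, hA0, hB0, h0]
      ring
    rw [← Ideal.unit_mul_mem_iff_mem (I ⊔ M * M ^ 2)
      (ConvSeries.isUnit_of hA' (hc'.trans_ne hc))]
    rw [h1]
    refine sub_mem (Ideal.mem_sup_left (of_comp_mem_germIdeal hg L 0 (hgi 0))) (hmul _ ?_)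
    exact add_mem (Ideal.mul_mem_left _ _ hxM) (Ideal.mul_mem_left _ _ hyM)
  -- Nakayama's lemma for the finitely generated module M², which is contained in I + M · M².
  have hMI : M ^ 2 ≤ I := by
    refine Submodule.le_of_le_smul_of_le_jacobson_bot (I := M) ?_
      (span_coordGerm_le_jacobson L) ?_
    · rw [hM]
      exact Submodule.FG.pow (Submodule.fg_span (Set.toFinite _)) 2
    · rw [smul_eq_mul]
      have hM2 : M ^ 2 = Ideal.span {x * x, x * y, y * x, y * y} := by
        rw [pow_two, hM, Ideal.span_pair_mul_span_pair]
      rw [show M ^ 2 ≤ I ⊔ M * M ^ 2 ↔ Ideal.span {x * x, x * y, y * x, y * y} ≤ I ⊔ M * M ^ 2 by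
        rw [hM2], Ideal.span_le]
      rintro z (rfl | rfl | rfl | rfl)
      · exact hxx
      · exact hmul _ hxM
      · rw [mul_comm y x]; exact hmul _ hxM
      · exact hmul _ hyM
  have hyI : y ∈ I := by
    rwa [sup_eq_left.2 hMI] at hyIM
  obtain ⟨u, hu, rfl⟩ := ConvSeries.exists_eq_of φ
  rw [ConvSeries.jet_of, Prod.mk_eq_zero] at hφ
  obtain ⟨A, B, hA, hB, h, hA0, -⟩ := exists_eq_add_coord L hu
  have h1 : ConvSeries.of u hu = ConvSeries.of A hA * x + ConvSeries.of B hB * y := by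
    rw [hx, hy, coordGerm, coordGerm]
    simp only [ConvSeries.of_mul, ConvSeries.of_add]
    rw [ConvSeries.of_eq_of]
    filter_upwards [h] with z h1
    simp [h1, hφ.1]
  rw [h1]
  refine add_mem (hMI ?_) (Ideal.mul_mem_left _ _ hyI)
  rw [pow_two]
  exact Ideal.mul_mem_mul (mem_span_coordGerm L hA (hA0.trans hφ.2)) hxM

/-- A germ of a map with a one-dimensional kernel whose second-order jet along the kernel is
non-degenerate has multiplicity two. -/
theorem germMultiplicity_eq_two {g : C2 → C2} (hg : AnalyticAt ℂ g 0) (h0 : g 0 = 0)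
    (L : C2 ≃L[ℂ] C2) {κ : ℂ} (hκ : κ ≠ 0)
    (hD : ∀ v, L (fderiv ℂ g 0 (L.symm v)) = ![0, κ * v 1])
    {e : ℂ → C2} (he : Tendsto e (𝓝[≠] 0) (𝓝 0)) {c : ℂ} (hc : c ≠ 0)
    (hge : Tendsto (fun t => L (g (e t)) 0 / t ^ 2) (𝓝[≠] 0) (𝓝 c))
    (he0 : Tendsto (fun t => L (e t) 0 / t) (𝓝[≠] 0) (𝓝 1))
    (he1 : Tendsto (fun t => L (e t) 1 / t) (𝓝[≠] 0) (𝓝 0)) :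
    germMultiplicity g = 2 := by
  set J := ConvSeries.jet (L.symm ![1, 0]) with hJ
  -- The ideal is exactly the kernel of the jet map, whose image ℂ × ℂ has dimension two.
  have hker : (germIdeal g).restrictScalars ℂ = J.ker := by
    ext φ
    rw [Submodule.restrictScalars_mem, LinearMap.mem_ker]
    refine ⟨fun h => mem_ker_jet_of_mem_germIdeal hg h0 ?_ h, fun h =>
      mem_germIdeal_of_jet_eq_zero hg h0 L hκ hD he hc hge he0 he1 h⟩
    apply L.injective
    rw [hD, map_zero]
    ext i
    fin_cases i <;> simp
  have hsurj : Function.Surjective J := by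
    rintro ⟨a, b⟩
    refine ⟨a • 1 + b • coordGerm L 0, ?_⟩
    have h1 : HasFDerivAt (fun z : C2 => L z 0)
        ((ContinuousLinearMap.proj (R := ℂ) (φ := fun _ : Fin 2 => ℂ) 0).comp
          (L : C2 →L[ℂ] C2)) 0 :=
      ((ContinuousLinearMap.proj (R := ℂ) (φ := fun _ : Fin 2 => ℂ) 0).comp
          (L : C2 →L[ℂ] C2)).hasFDerivAt
    rw [map_add, map_smul, map_smul, hJ, ConvSeries.one_eq_of, coordGerm, ConvSeries.jet_of,
      ConvSeries.jet_of, h1.fderiv]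
    ext <;> simp
  have e1 : (ConvSeries ⧸ germIdeal g) ≃ₗ[ℂ] ℂ × ℂ :=
    (Submodule.Quotient.restrictScalarsEquiv ℂ (germIdeal g)).symm ≪≫ₗ
      Submodule.quotEquivOfEq _ _ hker ≪≫ₗ J.quotKerEquivOfSurjective hsurj
  rw [germMultiplicity, e1.rank_eq, ← Module.finrank_eq_rank]
  simp

/-- A map that vanishes along an immersed curve has infinite multiplicity. -/
theorem germMultiplicity_eq_top {g : C2 → C2} {e : ℂ → C2} (he : Tendsto e (𝓝 0) (𝓝 0))
    (hge : ∀ᶠ t in 𝓝 0, g (e t) = 0) {i : Fin 2} (hi : ∀ c, ∀ᶠ t in 𝓝[≠] 0, e t i ≠ c) :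
    germMultiplicity g = ⊤ := by
  have hvan : ∀ φ ∈ germIdeal g, ∀ u : C2 → ℂ, (u : Germ (𝓝 (0 : C2)) ℂ) = φ →
      ∀ᶠ t in 𝓝 0, u (e t) = 0 := by
    intro φ hφ
    induction hφ using Submodule.span_induction with
    | mem φ h =>
      intro u hu
      obtain ⟨j, hj⟩ := h
      rw [hj, Germ.coe_eq] at hu
      filter_upwards [he.eventually hu, hge] with t h1 h2
      rw [h1, h2]
      rfl
    | zero =>
      intro u hu
      exact he.eventually (Germ.coe_eq.1 hu)
    | add φ ψ _ _ h1 h2 =>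
      intro u hu
      obtain ⟨v, hv, rfl⟩ := ConvSeries.exists_eq_of φ
      obtain ⟨w, hw, rfl⟩ := ConvSeries.exists_eq_of ψ
      have huv : u =ᶠ[𝓝 0] v + w := Germ.coe_eq.1 hu
      filter_upwards [he.eventually huv, h1 v rfl, h2 w rfl] with t h3 h4 h5
      simp [h3, h4, h5]
    | smul a φ _ h =>
      intro u hu
      obtain ⟨v, hv, rfl⟩ := ConvSeries.exists_eq_of φ
      obtain ⟨w, hw, rfl⟩ := ConvSeries.exists_eq_of a
      have huv : u =ᶠ[𝓝 0] w * v := Germ.coe_eq.1 hu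
      filter_upwards [he.eventually huv, h v rfl] with t h3 h4
      simp [h3, h4]
  let x : ConvSeries := coordGerm (ContinuousLinearEquiv.refl ℂ C2) i
  -- The polynomials in one coordinate embed into the quotient. A polynomial in the ideal would
  -- vanish along `e`, whereas its i-th coordinate avoids each of the finitely many roots for small
  -- t ≠ 0.
  let F : Polynomial ℂ →ₐ[ℂ] (ConvSeries ⧸ germIdeal g) :=
    Polynomial.aeval (Ideal.Quotient.mk (germIdeal g) x)
  have hx : ∀ P : Polynomial ℂ, ((Polynomial.aeval x P : ConvSeries) : Germ (𝓝 (0 : C2)) ℂ)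
      = ((fun z : C2 => P.eval (z i) : C2 → ℂ) :) := by
    intro P
    induction P using Polynomial.induction_on' with
    | add P Q hP hQ =>
      rw [map_add, AddMemClass.coe_add, hP, hQ, ← Germ.coe_add]
      congr 1
      ext z
      simp
    | monomial n a =>
      rw [Polynomial.aeval_monomial, ← Algebra.smul_def]
      have : ((x ^ n : ConvSeries) : Germ (𝓝 (0 : C2)) ℂ)
        = ((fun z : C2 => z i ^ n : C2 → ℂ) :) := rfl
      rw [SetLike.val_smul, this, ← Germ.coe_smul]
      congr 1
      ext z
      simp
  have hinj : Function.Injective F := by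
    rw [injective_iff_map_eq_zero]
    intro P hP
    have h1 : Ideal.Quotient.mk (germIdeal g) (Polynomial.aeval x P) = 0 := by
      rw [← hP]
      exact (Polynomial.aeval_algHom_apply (Ideal.Quotient.mkₐ ℂ (germIdeal g)) x P).symm
    rw [Ideal.Quotient.eq_zero_iff_mem] at h1
    have h2 := hvan _ h1 _ (hx P).symm
    by_contra hP0
    have h3 : ∀ᶠ t in 𝓝[≠] (0 : ℂ), ∀ c ∈ P.roots.toFinset, e t i ≠ c :=
      (eventually_all_finset _).2 fun c _ => hi c
    obtain ⟨t, h4, h5⟩ := (h3.and (h2.filter_mono nhdsWithin_le_nhds)).exists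
    exact h4 _ (by simp [hP0, h5]) rfl
  rw [germMultiplicity, Cardinal.toENat_eq_top]
  calc Cardinal.aleph0 = Module.rank ℂ (Polynomial ℂ) := by
        rw [← (Polynomial.basisMonomials ℂ).mk_eq_rank'', Cardinal.mk_nat]
    _ ≤ _ := LinearMap.rank_le_of_injective F.toLinearMap hinj

/-! ### Contour integrals -/

/-- The residue theorem for a quotient of holomorphic functions with simple poles. -/
theorem circleIntegral_div_eq_sum {V : Set ℂ} (hV : IsOpen V) {ρ : ℝ} (hρ : 0 < ρ)
    (hρV : Metric.closedBall 0 ρ ⊆ V) (Z : Finset ℂ) :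
    ∀ {q φ : ℂ → ℂ}, DifferentiableOn ℂ q V → DifferentiableOn ℂ φ V →
      (∀ x ∈ Metric.closedBall 0 ρ, q x = 0 ↔ x ∈ Z) → (∀ z ∈ Z, z ∈ Metric.ball (0 : ℂ) ρ) →
      (∀ z ∈ Z, deriv q z ≠ 0) →
      ∮ x in C(0, ρ), φ x / q x = 2 * Real.pi * Complex.I * ∑ z ∈ Z, φ z / deriv q z := by
  induction Z using Finset.induction_on with
  | empty =>
    intro q φ hq hφ hZ _ _
    simp only [Finset.notMem_empty, iff_false] at hZ
    simp only [Finset.sum_empty, mul_zero]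
    have hd : ∀ z ∈ Metric.closedBall (0 : ℂ) ρ, DifferentiableAt ℂ (fun x => φ x / q x) z :=
      fun z hz => ((hφ.differentiableAt (hV.mem_nhds (hρV hz))).div
        (hq.differentiableAt (hV.mem_nhds (hρV hz))) (hZ z hz))
    exact Complex.circleIntegral_eq_zero_of_differentiable_on_off_countable hρ.le
      Set.countable_empty (fun z hz => (hd z hz).continuousAt.continuousWithinAt)
      (fun z hz => hd z (Metric.ball_subset_closedBall hz.1))
  | insert a Z ha ih =>
    intro q φ hq hφ hZ hball hsimple
    have haV : V ∈ 𝓝 a := hV.mem_nhds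
      (hρV (Metric.ball_subset_closedBall (hball a (Finset.mem_insert_self _ _))))
    have haB : a ∈ Metric.ball (0 : ℂ) ρ := hball a (Finset.mem_insert_self _ _)
    have hqa : q a = 0 := (hZ a (Metric.ball_subset_closedBall haB)).2 (Finset.mem_insert_self _ _)
    set q1 := dslope q a with hq1
    have hq1a : q1 a = deriv q a := dslope_same _ _
    have hq1ne : q1 a ≠ 0 := hq1a ▸ hsimple a (Finset.mem_insert_self _ _)
    have hq1d : DifferentiableOn ℂ q1 V := (Complex.differentiableOn_dslope haV).2 hq
    have hqq1 : ∀ x, q x = (x - a) * q1 x := fun x => by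
      have := sub_smul_dslope q a x
      rw [hqa, sub_zero, smul_eq_mul] at this
      exact this.symm
    set ψ : ℂ → ℂ := fun x => φ x - φ a / q1 a * q1 x with hψ
    have hψa : ψ a = 0 := by simp [hψ, hq1ne]
    have hψd : DifferentiableOn ℂ ψ V := hφ.sub (hq1d.const_mul _)
    set φ1 := dslope ψ a with hφ1
    have hφ1d : DifferentiableOn ℂ φ1 V := (Complex.differentiableOn_dslope haV).2 hψd
    have hψφ1 : ∀ x, ψ x = (x - a) * φ1 x := fun x => by
      have := sub_smul_dslope ψ a x
      rw [hψa, sub_zero, smul_eq_mul] at this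
      exact this.symm
    have hq1Z : ∀ x ∈ Metric.closedBall 0 ρ, q1 x = 0 ↔ x ∈ Z := by
      intro x hx
      by_cases hxa : x = a
      · subst hxa
        simp [hq1ne, ha]
      · have := hZ x hx
        rw [hqq1, mul_eq_zero, sub_eq_zero, Finset.mem_insert] at this
        simpa [hxa] using this
    have hZa : ∀ z ∈ Z, z - a ≠ 0 := fun z hz h => ha (sub_eq_zero.1 h ▸ hz)
    have hderiv : ∀ z ∈ Z, deriv q z = (z - a) * deriv q1 z := by
      intro z hz
      have hzB := Metric.ball_subset_closedBall (hball z (Finset.mem_insert_of_mem hz))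
      have h1 : DifferentiableAt ℂ q1 z := hq1d.differentiableAt (hV.mem_nhds (hρV hzB))
      have h2 : q = fun x => (x - a) * q1 x := funext hqq1
      have h3 := ((hasDerivAt_id z).sub_const a).mul h1.hasDerivAt
      have h4 := h3.deriv
      rw [(hq1Z z hzB).2 hz] at h4
      rw [h2]
      refine Eq.trans ?_ (h4.trans (by simp))
      rfl
    have key := ih hq1d hφ1d hq1Z (fun z hz => hball z (Finset.mem_insert_of_mem hz))
      (fun z hz h => hsimple z (Finset.mem_insert_of_mem hz) (by rw [hderiv z hz, h, mul_zero]))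
    have hne : ∀ x ∈ Metric.sphere (0 : ℂ) ρ, x - a ≠ 0 ∧ q1 x ≠ 0 := by
      intro x hx
      have hxn : x ∉ insert a Z := fun h => by
        have h1 := hball x h
        rw [Metric.mem_ball] at h1
        rw [Metric.mem_sphere] at hx
        exact h1.ne hx
      have := mt (hZ x (Metric.sphere_subset_closedBall hx)).1 hxn
      rw [hqq1] at this
      exact mul_ne_zero_iff.1 this
    have hsplit : Set.EqOn (fun x => φ x / q x)
        (fun x => φ a / q1 a * (x - a)⁻¹ + φ1 x / q1 x) (Metric.sphere 0 ρ) := by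
      intro x hx
      obtain ⟨h1, h2⟩ := hne x hx
      have h3 : φ x = (x - a) * φ1 x + φ a / q1 a * q1 x := by
        rw [← hψφ1, hψ]
        ring
      simp only [hqq1, h3]
      field_simp
      ring
    have hcont : ∀ {F : ℂ → ℂ}, DifferentiableOn ℂ F V → ContinuousOn F (Metric.sphere 0 ρ) :=
      fun hF => hF.continuousOn.mono (Metric.sphere_subset_closedBall.trans hρV)
    have hi1 : CircleIntegrable (fun x => φ a / q1 a * (x - a)⁻¹) 0 ρ :=
      ContinuousOn.circleIntegrable hρ.le (ContinuousOn.mul continuousOn_const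
        (ContinuousOn.inv₀ (by fun_prop) fun x hx => (hne x hx).1))
    have hi2 : CircleIntegrable (fun x => φ1 x / q1 x) 0 ρ :=
      ContinuousOn.circleIntegrable hρ.le ((hcont hφ1d).div (hcont hq1d) fun x hx => (hne x hx).2)
    rw [circleIntegral.integral_congr hρ.le hsplit, circleIntegral.integral_add hi1 hi2, key,
      circleIntegral.integral_const_mul, circleIntegral.integral_sub_inv_of_mem_ball haB,
      Finset.sum_insert ha, mul_add, hq1a]
    congr 1
    · ring
    · congr 1
      refine Finset.sum_congr rfl fun z hz => ?_
      have h1 : φ z = (z - a) * φ1 z := by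
        have hz0 := (hq1Z z (Metric.ball_subset_closedBall
          (hball z (Finset.mem_insert_of_mem hz)))).2 hz
        rw [← hψφ1]
        simp [hψ, hz0]
      rw [h1, hderiv z hz, mul_div_mul_left _ _ (hZa z hz)]

/-- The residue theorem for a quotient of holomorphic functions with simple poles: the number of
poles is not specified. -/
theorem circleIntegral_div_eq_finsum {V : Set ℂ} (hV : IsOpen V) {ρ : ℝ} (hρ : 0 < ρ)
    (hρV : Metric.closedBall 0 ρ ⊆ V) {q φ : ℂ → ℂ} (hq : DifferentiableOn ℂ q V)
    (hφ : DifferentiableOn ℂ φ V) (hsphere : ∀ x ∈ Metric.sphere (0 : ℂ) ρ, q x ≠ 0)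
    (hsimple : ∀ x ∈ Metric.ball (0 : ℂ) ρ, q x = 0 → deriv q x ≠ 0) :
    ∮ x in C(0, ρ), φ x / q x = 2 * Real.pi * Complex.I *
      ∑ᶠ x ∈ {x | x ∈ Metric.ball (0 : ℂ) ρ ∧ q x = 0}, φ x / deriv q x := by
  have hclosed : IsClosed {x | x ∈ Metric.closedBall (0 : ℂ) ρ ∧ q x = 0} :=
    (hq.continuousOn.mono hρV).preimage_isClosed_of_isClosed Metric.isClosed_closedBall
      isClosed_singleton
  have heq : {x | x ∈ Metric.closedBall (0 : ℂ) ρ ∧ q x = 0} =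
      {x | x ∈ Metric.ball (0 : ℂ) ρ ∧ q x = 0} := by
    ext x
    simp only [Set.mem_ofPred_eq]
    refine ⟨fun h => ⟨?_, h.2⟩, fun h => ⟨Metric.ball_subset_closedBall h.1, h.2⟩⟩
    rcases (Metric.mem_closedBall.1 h.1).lt_or_eq with h1 | h1
    · exact h1
    · exact absurd h.2 (hsphere x h1)
  -- The zeros in the closed disc form a compact set, which is discrete because they are simple.
  have hfin : {x | x ∈ Metric.ball (0 : ℂ) ρ ∧ q x = 0}.Finite := by
    rw [← heq]
    refine ((isCompact_closedBall (0 : ℂ) ρ).of_isClosed_subset hclosed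
      fun x hx => hx.1).finite ?_
    rw [heq]
    refine IsDiscrete.of_nhdsWithin ?_
    rintro x ⟨hx, hx0⟩
    have hd := (hq.differentiableAt (hV.mem_nhds
      (hρV (Metric.ball_subset_closedBall hx)))).hasDerivAt
    have hev : ∀ᶠ y in 𝓝[≠] x, q y ≠ 0 := hd.eventually_ne (hsimple x hx hx0)
    rw [Filter.le_pure_iff, mem_nhdsWithin_iff_eventually]
    filter_upwards [eventually_nhdsWithin_iff.1 hev] with y hy hy'
    by_contra hne
    exact hy hne hy'.2
  have hmem : ∀ x, x ∈ hfin.toFinset ↔ x ∈ Metric.ball (0 : ℂ) ρ ∧ q x = 0 := fun x => by simp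
  rw [circleIntegral_div_eq_sum hV hρ hρV hfin.toFinset hq hφ (fun x hx => ?_)
    (fun z hz => ((hmem z).1 hz).1)
    (fun z hz => hsimple z ((hmem z).1 hz).1 ((hmem z).1 hz).2)]
  · rw [finsum_mem_eq_finite_toFinset_sum _ hfin]
  · rw [hmem]
    have := Set.ext_iff.1 heq x
    simp only [Set.mem_ofPred_eq] at this
    rw [← this]
    simp [hx]

/-- Fubini's theorem for circle integrals of continuous functions. -/
theorem circleIntegral_swap {F : ℂ → ℂ → ℂ} {a b : ℝ} (ha : 0 ≤ a) (hb : 0 ≤ b)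
    (hF : ContinuousOn (Function.uncurry F) (Metric.sphere 0 a ×ˢ Metric.sphere 0 b)) :
    ∮ x in C(0, a), ∮ y in C(0, b), F x y = ∮ y in C(0, b), ∮ x in C(0, a), F x y := by
  have hcont : Continuous fun p : ℝ × ℝ => F (circleMap 0 a p.1) (circleMap 0 b p.2) :=
    hF.comp_continuous (f := fun p : ℝ × ℝ => (circleMap 0 a p.1, circleMap 0 b p.2))
      (((continuous_circleMap 0 a).comp continuous_fst).prodMk
        ((continuous_circleMap 0 b).comp continuous_snd))
      fun p => ⟨circleMap_mem_sphere 0 ha p.1, circleMap_mem_sphere 0 hb p.2⟩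
  simp only [circleIntegral, ← intervalIntegral.integral_smul]
  rw [MeasureTheory.intervalIntegral_intervalIntegral_swap]
  · refine intervalIntegral.integral_congr fun θ _ => intervalIntegral.integral_congr fun τ _ => ?_
    exact smul_comm _ _ _
  · have h : Continuous (Function.uncurry fun x y : ℝ => deriv (circleMap 0 a) x •
        deriv (circleMap 0 b) y • F (circleMap 0 a x) (circleMap 0 b y)) := by
      simp only [deriv_circleMap, smul_eq_mul]
      refine Continuous.mul ?_ (Continuous.mul ?_ hcont)
      · exact ((continuous_circleMap 0 a).comp continuous_fst).mul continuous_const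
      · exact ((continuous_circleMap 0 b).comp continuous_snd).mul continuous_const
    refine (h.continuousOn.integrableOn_compact
      (isCompact_uIcc.prod isCompact_uIcc)).mono_set
      (Set.prod_mono Set.uIoc_subset_uIcc Set.uIoc_subset_uIcc)

/-- Cauchy's formula for a contour integral with a holomorphic parameter. -/
theorem circleIntegral_parametric_div {N : ℂ → ℂ → ℂ} {ρ s b : ℝ} (hρ : 0 < ρ) (hb : 0 < b)
    (hbs : b < s)
    (hN : ContinuousOn (Function.uncurry N) (Metric.sphere 0 ρ ×ˢ Metric.ball 0 s))
    (hd : ∀ x ∈ Metric.sphere (0 : ℂ) ρ, DifferentiableOn ℂ (N x) (Metric.ball 0 s)) :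
    ∮ y in C(0, b), (∮ x in C(0, ρ), N x y) / y =
      2 * Real.pi * Complex.I * ∮ x in C(0, ρ), N x 0 := by
  have h1 : ∀ y, (∮ x in C(0, ρ), N x y) / y = ∮ x in C(0, ρ), y⁻¹ * N x y := fun y => by
    rw [circleIntegral.integral_const_mul, div_eq_inv_mul]
  simp only [h1]
  rw [circleIntegral_swap hb.le hρ.le, ← circleIntegral.integral_const_mul]
  · refine circleIntegral.integral_congr hρ.le fun x hx => ?_
    have := ((hd x hx).mono (Metric.closedBall_subset_ball hbs)).circleIntegral_sub_inv_smul
      (Metric.mem_ball_self hb)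
    simpa using this
  · refine ContinuousOn.mul ?_ ?_
    · exact ContinuousOn.inv₀ continuousOn_fst fun p hp h => by
        have := hp.1
        rw [h, Metric.mem_sphere, dist_self] at this
        exact hb.ne this
    · exact hN.comp (continuousOn_snd.prodMk continuousOn_fst) fun p hp =>
        ⟨hp.2, Metric.closedBall_subset_ball hbs (Metric.sphere_subset_closedBall hp.1)⟩

theorem torusMap_mem_ball {s : ℝ} {ε : Fin 2 → ℝ} (hε : ∀ i, 0 < ε i ∧ ε i < s) (θ : Fin 2 → ℝ) :
    torusMap 0 ε θ ∈ Metric.ball (0 : C2) s := by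
  rw [mem_ball_zero_iff, pi_norm_lt_iff ((hε 0).1.trans (hε 0).2)]
  intro i
  simpa [torusMap, abs_of_pos (hε i).1, Complex.norm_exp_ofReal_mul_I] using (hε i).2

theorem torusMap_ne_zero {s : ℝ} {ε : Fin 2 → ℝ} (hε : ∀ i, 0 < ε i ∧ ε i < s) (θ : Fin 2 → ℝ)
    (i : Fin 2) : torusMap 0 ε θ i ≠ 0 := by
  simp [torusMap, (hε i).1.ne']

/-- Cauchy's formula on a two-dimensional torus, for a function given by a contour integral with
holomorphic parameters. -/
theorem torusIntegral_parametric {N : ℂ → C2 → ℂ} {ρ s : ℝ} (hρ : 0 < ρ)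
    (hN : ContinuousOn (Function.uncurry N) (Metric.sphere 0 ρ ×ˢ Metric.ball 0 s))
    (hd : ∀ x ∈ Metric.sphere (0 : ℂ) ρ, DifferentiableOn ℂ (N x) (Metric.ball 0 s))
    {ε : Fin 2 → ℝ} (hε : ∀ i, 0 < ε i ∧ ε i < s) :
    TorusIntegrable (fun w => (∮ x in C(0, ρ), N x w) / (w 0 * w 1)) 0 ε ∧
      torusIntegral (fun w => (∮ x in C(0, ρ), N x w) / (w 0 * w 1)) 0 ε =
        (2 * Real.pi * Complex.I) ^ 2 * ∮ x in C(0, ρ), N x 0 := by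
  have hint : TorusIntegrable (fun w => (∮ x in C(0, ρ), N x w) / (w 0 * w 1)) 0 ε := by
    have htorus : Continuous (torusMap (0 : C2) ε) := by
      unfold torusMap
      fun_prop
    refine (Continuous.integrableOn_Icc (Continuous.div ?_ ?_ ?_))
    · simp only [circleIntegral]
      refine intervalIntegral.continuous_parametric_intervalIntegral_of_continuous ?_
        continuous_const
      simp only [deriv_circleMap, smul_eq_mul]
      refine Continuous.mul ?_ ?_
      · exact ((continuous_circleMap 0 ρ).comp continuous_snd).mul continuous_const
      · exact hN.comp_continuous (f := fun p : (Fin 2 → ℝ) × ℝ =>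
          (circleMap 0 ρ p.2, torusMap 0 ε p.1))
          (((continuous_circleMap 0 ρ).comp continuous_snd).prodMk
            (htorus.comp continuous_fst))
          fun p => ⟨circleMap_mem_sphere 0 hρ.le p.2, torusMap_mem_ball hε p.1⟩
    · exact ((continuous_apply 0).comp htorus).mul ((continuous_apply 1).comp htorus)
    · exact fun θ => mul_ne_zero (torusMap_ne_zero hε θ 0) (torusMap_ne_zero hε θ 1)
  refine ⟨hint, ?_⟩
  have hball : ∀ {x y : ℂ}, x ∈ Metric.ball (0 : ℂ) s → y ∈ Metric.ball (0 : ℂ) s →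
      (Fin.cons x (fun _ => y) : C2) ∈ Metric.ball (0 : C2) s := by
    intro x y hx hy
    rw [mem_ball_zero_iff] at hx hy ⊢
    rw [pi_norm_lt_iff ((norm_nonneg x).trans_lt hx)]
    intro i
    refine Fin.cases ?_ (fun j => ?_) i
    exacts [hx, hy]
  have hs : 0 < s := (hε 0).1.trans (hε 0).2
  have hc : Continuous fun p : ℂ × ℂ => (Fin.cons p.1 (fun _ => p.2) : C2) := by
    refine continuous_pi fun i => ?_
    refine Fin.cases ?_ (fun j => ?_) i
    exacts [continuous_fst, continuous_snd]
  have hdif : Differentiable ℂ fun p : ℂ × ℂ => (Fin.cons p.1 (fun _ => p.2) : C2) := by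
    refine differentiable_pi.2 fun i => ?_
    refine Fin.cases ?_ (fun j => ?_) i
    exacts [differentiable_fst, differentiable_snd]
  have h0 : (Fin.cons 0 (fun _ => 0) : C2) = 0 := by
    ext i
    refine Fin.cases ?_ (fun j => ?_) i <;> rfl
  rw [torusIntegral_succ hint]
  -- Cauchy's formula is used twice: here for the second variable with the first fixed, and then for
  -- the first variable with the second set to 0.
  have hinner : ∀ x ∈ Metric.sphere (0 : ℂ) (ε 0),
      torusIntegral (fun y : Fin 1 → ℂ => (∮ t in C(0, ρ), N t (Fin.cons x y : C2)) /
        ((Fin.cons x y : C2) 0 * (Fin.cons x y : C2) 1)) ((0 : C2) ∘ Fin.succ) (ε ∘ Fin.succ) =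
      2 * Real.pi * Complex.I * ((∮ t in C(0, ρ), N t (Fin.cons x (fun _ => 0))) / x) := by
    intro x hx
    have hxs : x ∈ Metric.ball (0 : ℂ) s :=
      Metric.closedBall_subset_ball (hε 0).2 (Metric.sphere_subset_closedBall hx)
    rw [torusIntegral_dim1]
    have h1 := circleIntegral_parametric_div (N := fun t y => N t (Fin.cons x (fun _ => y)))
      hρ (hε 1).1 (hε 1).2
      (hN.comp (t := Metric.sphere 0 ρ ×ˢ Metric.ball 0 s)
        (f := fun p : ℂ × ℂ => (p.1, (Fin.cons x (fun _ => p.2) : C2)))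
        (continuous_fst.prodMk (hc.comp (continuous_const.prodMk continuous_snd))).continuousOn
        fun p hp => ⟨hp.1, hball hxs hp.2⟩)
      (fun t ht => (hd t ht).comp
        (hdif.comp ((differentiable_const x).prodMk differentiable_id)).differentiableOn
        fun y hy => hball hxs hy)
    rw [← mul_div_assoc, ← h1, div_eq_inv_mul, ← circleIntegral.integral_const_mul]
    refine circleIntegral.integral_congr (hε 1).1.le fun y _ => ?_
    simp only [Fin.cons_zero]
    change _ / (x * y) = _
    rw [mul_comm x y, ← div_div, div_eq_inv_mul _ x]
  rw [Pi.zero_apply, circleIntegral.integral_congr (hε 0).1.le hinner, circleIntegral.integral_const_mul]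
  have h2 := circleIntegral_parametric_div (N := fun t x => N t (Fin.cons x (fun _ => 0)))
      hρ (hε 0).1 (hε 0).2
      (hN.comp (t := Metric.sphere 0 ρ ×ˢ Metric.ball 0 s)
        (f := fun p : ℂ × ℂ => (p.1, (Fin.cons p.2 (fun _ => 0) : C2)))
        (continuous_fst.prodMk (hc.comp (continuous_snd.prodMk continuous_const))).continuousOn
        fun p hp => ⟨hp.1, hball hp.2 (Metric.mem_ball_self hs)⟩)
      (fun t ht => (hd t ht).comp
        (hdif.comp (differentiable_id.prodMk (differentiable_const (0 : ℂ)))).differentiableOn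
        fun y hy => hball hy (Metric.mem_ball_self hs))
  rw [h0] at h2
  change _ * (∮ x in C(0, ε 0), _) = _
  rw [h2]
  ring

/-- A compact set which is a graph over one coordinate is a null set on every torus. -/
theorem ae_torusMap_notMem {B : Set C2} (hB : IsClosed B) (j : Fin 2)
    (hj : ∀ w ∈ B, ∀ w' ∈ B, w j = w' j → w = w') {ε : Fin 2 → ℝ} (hε : ∀ i, 0 < ε i) :
    ∀ᵐ θ : Fin 2 → ℝ, torusMap 0 ε θ ∉ B := by
  have htorus : Continuous (torusMap (0 : C2) ε) := by
    unfold torusMap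
    fun_prop
  set e := MeasurableEquiv.piFinSuccAbove (fun _ : Fin 2 => ℝ) j
  have he : MeasureTheory.MeasurePreserving e :=
    MeasureTheory.volume_preserving_piFinSuccAbove (fun _ : Fin 2 => ℝ) j
  set S : Set (Fin 2 → ℝ) := torusMap 0 ε ⁻¹' B with hS
  have hSm : MeasurableSet S := (hB.preimage htorus).measurableSet
  have hS' : MeasurableSet (e.symm ⁻¹' S) := e.symm.measurable hSm
  rw [MeasureTheory.ae_iff]
  simp only [not_not]
  change MeasureTheory.volume S = 0
  rw [← he.symm.measure_preimage hSm.nullMeasurableSet]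
  change (MeasureTheory.Measure.prod _ _) (e.symm ⁻¹' S) = 0
  -- Fubini with the j-th angle held fixed. All points of B in such a slice have the same j-th
  -- coordinate, hence coincide, so the other angle ranges over a fibre of `circleMap`, which is
  -- countable.
  rw [MeasureTheory.Measure.measure_prod_null hS']
  refine Eventually.of_forall fun a => ?_
  refine Set.Countable.measure_zero ?_ _
  by_cases hne : (Prod.mk a ⁻¹' (e.symm ⁻¹' S)).Nonempty
  · obtain ⟨y₀, hy₀⟩ := hne
    set k := j.succAbove 0
    have hval : ∀ y : Fin 1 → ℝ, torusMap 0 ε (e.symm (a, y)) j = circleMap 0 (ε j) a ∧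
        torusMap 0 ε (e.symm (a, y)) k = circleMap 0 (ε k) (y 0) := by
      intro y
      have h1 : e.symm (a, y) j = a := Fin.insertNth_apply_same (α := fun _ => ℝ) j a y
      have h2 : e.symm (a, y) k = y 0 := 
        Fin.insertNth_apply_succAbove (α := fun _ => ℝ) j a y 0
      simp [torusMap, circleMap, h1, h2]
    have hc : (circleMap 0 (ε k) ⁻¹' {circleMap 0 (ε k) (y₀ 0)}).Countable :=
      (Set.countable_singleton _).preimage_circleMap 0 (hε k).ne'
    refine (hc.preimage_of_injOn (f := fun y : Fin 1 → ℝ => y 0) ?_).mono ?_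
    · intro y _ y' _ h
      ext i
      rw [Subsingleton.elim i 0]
      exact h
    · intro y hy
      have := hj _ hy _ hy₀ ((hval y).1.trans (hval y₀).1.symm)
      have h3 := congrFun this k
      rw [(hval y).2, (hval y₀).2] at h3
      exact h3
  · rw [Set.not_nonempty_iff_eq_empty.1 hne]
    exact Set.countable_empty

/-! ### Grothendieck residues in adapted coordinates -/

theorem analyticAt_vec {E : Type*} [NormedAddCommGroup E] [NormedSpace ℂ E] {f g : E → ℂ} {z : E}
    (hf : AnalyticAt ℂ f z) (hg : AnalyticAt ℂ g z) : AnalyticAt ℂ (fun z => (![f z, g z] : C2)) z := by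
  refine AnalyticAt.pi fun i => ?_
  fin_cases i
  exacts [hf, hg]

theorem analyticAt_apply (i : Fin 2) (z : C2) : AnalyticAt ℂ (fun z : C2 => z i) z :=
  (ContinuousLinearMap.proj (R := ℂ) (φ := fun _ : Fin 2 => ℂ) i).analyticAt z

theorem norm_vec_le {x y : ℂ} {r : ℝ} (hx : ‖x‖ ≤ r) (hy : ‖y‖ ≤ r) : ‖(![x, y] : C2)‖ ≤ r := by
  rw [pi_norm_le_iff_of_nonneg ((norm_nonneg x).trans hx)]
  intro i
  fin_cases i
  exacts [hx, hy]

theorem det_eq_of_C2 (A : C2 →L[ℂ] C2) :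
    A.det = A ![1, 0] 0 * A ![0, 1] 1 - A ![0, 1] 0 * A ![1, 0] 1 := by
  have h0 : (Pi.single 0 1 : C2) = ![1, 0] := by ext i; fin_cases i <;> simp
  have h1 : (Pi.single 1 1 : C2) = ![0, 1] := by ext i; fin_cases i <;> simp
  rw [ContinuousLinearMap.det, ← LinearMap.det_toMatrix', Matrix.det_fin_two]
  simp [LinearMap.toMatrix'_apply, h0, h1]

theorem det_comp_C2 (A B : C2 →L[ℂ] C2) : (A.comp B).det = A.det * B.det :=
  LinearMap.det_comp _ _

theorem analyticAt_fderiv_apply {E F : Type*} [NormedAddCommGroup E] [NormedSpace ℂ E]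
    [NormedAddCommGroup F] [NormedSpace ℂ F] [CompleteSpace F] {f : E → F} {z : E}
    (hf : AnalyticAt ℂ f z) (v : E) : AnalyticAt ℂ (fun z => fderiv ℂ f z v) z :=
  ((ContinuousLinearMap.apply ℂ F v).analyticAt _).comp hf.fderiv

theorem analyticAt_coord_comp {E : Type*} [NormedAddCommGroup E] [NormedSpace ℂ E]
    (L : C2 ≃L[ℂ] C2) (i : Fin 2) {f : E → C2} {z : E} (hf : AnalyticAt ℂ f z) :
    AnalyticAt ℂ (fun z => L (f z) i) z :=
  (analyticAt_coord L i (f z)).comp hf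

theorem analyticAt_fderiv_det {f : C2 → C2} {z : C2} (hf : AnalyticAt ℂ f z) :
    AnalyticAt ℂ (fun z => (fderiv ℂ f z).det) z := by
  have h : ∀ v i, AnalyticAt ℂ (fun z => fderiv ℂ f z v i) z := fun v i =>
    (analyticAt_apply i _).comp (analyticAt_fderiv_apply hf v)
  simp only [det_eq_of_C2]
  exact ((h _ _).mul (h _ _)).sub ((h _ _).mul (h _ _))

/-- The inverse function theorem for analytic maps of `ℂ²`. -/
theorem exists_openPartialHomeomorph {K : C2 → C2} (hK : AnalyticAt ℂ K 0)
    (hdet : (fderiv ℂ K 0).det ≠ 0) :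
    ∃ κ : OpenPartialHomeomorph C2 C2, (κ : C2 → C2) = K ∧ 0 ∈ κ.source ∧
      AnalyticAt ℂ κ.symm (K 0) := by
  let A := (fderiv ℂ K 0).toContinuousLinearEquivOfDetNeZero hdet
  have hA : HasStrictFDerivAt K (A : C2 →L[ℂ] C2) 0 := by
    have h : (A : C2 →L[ℂ] C2) = fderiv ℂ K 0 :=
      ContinuousLinearMap.coe_toContinuousLinearEquivOfDetNeZero _ hdet
    rw [h]
    exact hK.hasStrictFDerivAt
  refine ⟨hA.toOpenPartialHomeomorph K, hA.toOpenPartialHomeomorph_coe,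
    hA.mem_toOpenPartialHomeomorph_source, ?_⟩
  have h := (hA.toOpenPartialHomeomorph K).analyticAt_symm' (i := A)
    hA.mem_toOpenPartialHomeomorph_source
    (by rw [hA.toOpenPartialHomeomorph_coe]; exact hK)
    (by rw [hA.toOpenPartialHomeomorph_coe]; exact hA.hasFDerivAt.fderiv)
  rwa [hA.toOpenPartialHomeomorph_coe] at h

/-- The Jacobian of `g` in coordinates `ζ` in which `L ∘ g` is `(H(ζ), ζ₁)`. -/
theorem eventually_det_fderiv {g : C2 → C2} (hg : AnalyticAt ℂ g 0) (L : C2 ≃L[ℂ] C2)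
    {κ : OpenPartialHomeomorph C2 C2} (h0 : 0 ∈ κ.source) (hκ0 : κ 0 = 0)
    (hκ : AnalyticAt ℂ κ 0) (hκs : AnalyticAt ℂ κ.symm 0)
    {H : C2 → ℂ} (hH : AnalyticAt ℂ H 0)
    (hgH : ∀ᶠ ζ in 𝓝 0, L (g (κ.symm ζ)) = ![H ζ, ζ 1]) :
    ∀ᶠ ζ in 𝓝 0, ((fderiv ℂ g (κ.symm ζ)).det)⁻¹ =
      ((L : C2 →L[ℂ] C2).det * (fderiv ℂ κ.symm ζ).det) / fderiv ℂ H ζ ![1, 0] := by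
  have hs0 : κ.symm 0 = 0 := by
    conv_lhs => rw [← hκ0]
    exact κ.left_inv h0
  have ht0 : (0 : C2) ∈ κ.target := hκ0 ▸ κ.map_source h0
  have hcont : Tendsto κ.symm (𝓝 0) (𝓝 0) := by
    have := hκs.continuousAt.tendsto
    rwa [hs0] at this
  filter_upwards [hgH.eventually_nhds, hH.eventually_analyticAt, hκs.eventually_analyticAt,
    hcont.eventually hg.eventually_analyticAt, hcont.eventually hκ.eventually_analyticAt,
    κ.open_target.mem_nhds ht0] with ζ h1 h2 h3 h4 h5 h6
  have hL : (L : C2 →L[ℂ] C2).det ≠ 0 :=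
    (LinearEquiv.isUnit_det' L.toLinearEquiv).ne_zero
  have hid : (fderiv ℂ κ (κ.symm ζ)).comp (fderiv ℂ κ.symm ζ) = ContinuousLinearMap.id ℂ C2 := by
    have := h5.differentiableAt.hasFDerivAt.comp ζ h3.differentiableAt.hasFDerivAt
    refine (this.congr_of_eventuallyEq ?_).unique (hasFDerivAt_id ζ)
    filter_upwards [κ.open_target.mem_nhds h6] with ξ hξ
    exact (κ.right_inv hξ).symm
  have hdet : (fderiv ℂ κ.symm ζ).det ≠ 0 := by
    intro h
    have h7 := congrArg ContinuousLinearMap.det hid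
    rw [det_comp_C2, h, mul_zero] at h7
    simp [ContinuousLinearMap.det] at h7
  have hcomp := (L : C2 →L[ℂ] C2).hasFDerivAt.comp ζ
    (h4.differentiableAt.hasFDerivAt.comp ζ h3.differentiableAt.hasFDerivAt)
  have hvec : HasFDerivAt (fun ζ : C2 => (![H ζ, ζ 1] : C2))
      (ContinuousLinearMap.pi ![fderiv ℂ H ζ,
        ContinuousLinearMap.proj (R := ℂ) (φ := fun _ : Fin 2 => ℂ) 1]) ζ := by
    rw [hasFDerivAt_pi']
    intro i
    fin_cases i
    · exact h2.differentiableAt.hasFDerivAt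
    · exact (ContinuousLinearMap.proj (R := ℂ) (φ := fun _ : Fin 2 => ℂ) 1).hasFDerivAt
  -- The Jacobian matrix of (H(ζ), ζ₁) has second row (0, 1), so its determinant is ∂H/∂ζ₀. Where
  -- this vanishes, both sides of the goal are 0 by the convention on division by zero.
  have heq := (hcomp.congr_of_eventuallyEq (h1.mono fun ξ hξ => hξ.symm)).unique hvec
  have hdeteq := congrArg ContinuousLinearMap.det heq
  rw [det_comp_C2, det_comp_C2, det_eq_of_C2 (ContinuousLinearMap.pi _)] at hdeteq
  simp at hdeteq
  rw [← hdeteq, ← mul_assoc, mul_right_comm, div_mul_cancel_left₀ (mul_ne_zero hL hdet)]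

/-- The critical points of `(H(ζ), ζ₁)` have distinct values of a suitable linear coordinate, if
`H` has a non-degenerate critical point along the first axis. -/
theorem exists_injOn_critical (L : C2 ≃L[ℂ] C2) {H : C2 → ℂ} (hH : AnalyticAt ℂ H 0)
    {k : ℂ → ℂ} (hk : AnalyticAt ℂ k 0) (hk0 : k 0 ≠ 0)
    (hHk : ∀ᶠ x in 𝓝 0, H ![x, 0] = x ^ 2 * k x) :
    ∃ j : Fin 2, ∃ V ∈ 𝓝 (0 : C2), Set.InjOn
      (fun ζ : C2 => (![fderiv ℂ H ζ ![1, 0], L.symm ![H ζ, ζ 1] j] : C2)) V := by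
  have hline : ∀ x : ℂ, HasDerivAt (fun x : ℂ => (![x, 0] : C2)) ![1, 0] x := by
    intro x
    rw [hasDerivAt_pi]
    intro i
    fin_cases i
    · exact hasDerivAt_id x
    · exact hasDerivAt_const x (0 : ℂ)
  have hline0 : (![0, 0] : C2) = 0 := by ext i; fin_cases i <;> rfl
  have hlt : Tendsto (fun x : ℂ => (![x, 0] : C2)) (𝓝 0) (𝓝 0) := by
    have := (hline 0).continuousAt.tendsto
    rwa [hline0] at this
  have hPx : ∀ᶠ x in 𝓝 0, fderiv ℂ H ![x, 0] ![1, 0] = 2 * x * k x + x ^ 2 * deriv k x := by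
    filter_upwards [hHk.eventually_nhds, hlt.eventually hH.eventually_analyticAt,
      hk.eventually_analyticAt] with x h1 h2 h3
    have h4 := h2.differentiableAt.hasFDerivAt.comp_hasDerivAt x (hline x)
    have h5 := ((hasDerivAt_pow 2 x).mul h3.differentiableAt.hasDerivAt)
    have h6 := (h4.congr_of_eventuallyEq (h1.mono fun y hy => hy.symm)).unique h5
    rw [h6]
    simp
  have hP : AnalyticAt ℂ (fun ζ => fderiv ℂ H ζ ![1, 0]) 0 :=
    analyticAt_fderiv_apply hH _
  have hP0 : fderiv ℂ H 0 ![1, 0] = 0 := by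
    have := hPx.self_of_nhds
    rw [hline0] at this
    simpa using this
  have hP1 : fderiv ℂ (fun ζ => fderiv ℂ H ζ ![1, 0]) 0 ![1, 0] = 2 * k 0 := by
    have h4 := (hline0.symm ▸ hP.differentiableAt.hasFDerivAt :
      HasFDerivAt (fun ζ => fderiv ℂ H ζ ![1, 0]) (fderiv ℂ (fun ζ => fderiv ℂ H ζ ![1, 0]) 0)
        ![0, 0]).comp_hasDerivAt (0 : ℂ) (hline 0)
    have h5 : HasDerivAt (fun x : ℂ => 2 * x * k x + x ^ 2 * deriv k x) (2 * k 0) 0 := by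
      have := (((hasDerivAt_id (0 : ℂ)).const_mul 2).mul hk.differentiableAt.hasDerivAt).add
        ((hasDerivAt_pow 2 (0 : ℂ)).mul hk.deriv.differentiableAt.hasDerivAt)
      refine this.congr_deriv ?_
      simp
    exact (h4.congr_of_eventuallyEq (hPx.mono fun y hy => hy.symm)).unique h5
  have hvec : HasFDerivAt (fun ζ : C2 => (![H ζ, ζ 1] : C2))
      (ContinuousLinearMap.pi ![fderiv ℂ H 0,
        ContinuousLinearMap.proj (R := ℂ) (φ := fun _ : Fin 2 => ℂ) 1]) 0 := by
    rw [hasFDerivAt_pi']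
    intro i
    fin_cases i
    · exact hH.differentiableAt.hasFDerivAt
    · exact (ContinuousLinearMap.proj (R := ℂ) (φ := fun _ : Fin 2 => ℂ) 1).hasFDerivAt
  -- The vector u is the derivative at the origin of ζ ↦ L⁻¹(H(ζ), ζ₁) in the direction ζ₁. A
  -- coordinate j with u j ≠ 0 separates the critical values.
  set u : C2 := L.symm ![fderiv ℂ H 0 ![0, 1], 1] with hu
  have hu0 : u ≠ 0 := by
    intro h
    have := congrArg L h
    rw [hu, L.apply_symm_apply, map_zero] at this
    simpa using congrFun this 1
  obtain ⟨j, hj⟩ : ∃ j, u j ≠ 0 := by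
    by_contra! h
    exact hu0 (funext h)
  refine ⟨j, ?_⟩
  have hLv := (L.symm : C2 →L[ℂ] C2).hasFDerivAt.comp (0 : C2) hvec
  have hLj := (ContinuousLinearMap.proj (R := ℂ) (φ := fun _ : Fin 2 => ℂ) j).hasFDerivAt.comp
    (0 : C2) hLv
  set M : C2 → C2 := fun ζ => ![fderiv ℂ H ζ ![1, 0], L.symm ![H ζ, ζ 1] j] with hM
  have hMan : AnalyticAt ℂ M 0 :=
    analyticAt_vec hP ((analyticAt_coord L.symm j _).comp
      (analyticAt_vec hH (analyticAt_apply 1 0)))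
  have hMd : ∀ v, fderiv ℂ M 0 v = ![fderiv ℂ (fun ζ => fderiv ℂ H ζ ![1, 0]) 0 v,
      L.symm ![fderiv ℂ H 0 v, v 1] j] := by
    intro v
    have h1 : HasFDerivAt M (ContinuousLinearMap.pi
      ![fderiv ℂ (fun ζ => fderiv ℂ H ζ ![1, 0]) 0,
        (ContinuousLinearMap.proj (R := ℂ) (φ := fun _ : Fin 2 => ℂ) j).comp
          ((L.symm : C2 →L[ℂ] C2).comp (ContinuousLinearMap.pi ![fderiv ℂ H 0,
            ContinuousLinearMap.proj (R := ℂ) (φ := fun _ : Fin 2 => ℂ) 1]))]) 0 := by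
      rw [hasFDerivAt_pi']
      intro i
      fin_cases i
      · exact hP.differentiableAt.hasFDerivAt
      · exact hLj
    rw [h1.fderiv]
    ext i
    fin_cases i
    · rfl
    · have h2 : (ContinuousLinearMap.pi ![fderiv ℂ H 0,
          ContinuousLinearMap.proj (R := ℂ) (φ := fun _ : Fin 2 => ℂ) 1]) v =
          ![fderiv ℂ H 0 v, v 1] := by
        ext i
        fin_cases i <;> rfl
      exact congrArg (fun t => L.symm t j) h2
  -- Since ∂H/∂ζ₀ vanishes at the origin, the Jacobian matrix of M is triangular with diagonal
  -- entries 2 k(0) and u j. Hence M is injective near 0, and among points with ∂H/∂ζ₀ = 0 its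
  -- second entry alone distinguishes them.
  have hdet : (fderiv ℂ M 0).det ≠ 0 := by
    rw [det_eq_of_C2]
    simp only [hMd, hP0, hP1]
    simp [hline0, ← hu, hj, hk0]
  obtain ⟨κ, hκ, h0, -⟩ := exists_openPartialHomeomorph hMan hdet
  exact ⟨κ.source, κ.open_source.mem_nhds h0, hκ ▸ κ.injOn⟩

/-- Write L w = (a, b). The solutions of g = w correspond to the zeros x of H(x, b) - a in a disc.
The residue theorem turns the sum of the inverse Jacobians into a contour integral of W/(H - a) over
a fixed circle, and this is holomorphic in w. Cauchy's formula on the torus then evaluates it at w =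
0, where the integrand W(x, 0)/(x² k(x)) has at most a double pole at the origin. The argument needs
simple zeros. It fails only for critical values w, which form a null set on each torus by
`exists_injOn_critical` and `ae_torusMap_notMem`. -/
theorem hasGrothendieckResidue_of_coordinates {g : C2 → C2} (hg : AnalyticAt ℂ g 0)
    (L : C2 ≃L[ℂ] C2)
    {κ : OpenPartialHomeomorph C2 C2} (h0 : 0 ∈ κ.source) (hκ0 : κ 0 = 0)
    (hκ : AnalyticAt ℂ κ 0) (hκs : AnalyticAt ℂ κ.symm 0)
    {H : C2 → ℂ} (hH : AnalyticAt ℂ H 0)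
    (hgH : ∀ᶠ ζ in 𝓝 0, L (g (κ.symm ζ)) = ![H ζ, ζ 1])
    {k : ℂ → ℂ} (hk : AnalyticAt ℂ k 0) (hk0 : k 0 ≠ 0)
    (hHk : ∀ᶠ x in 𝓝 0, H ![x, 0] = x ^ 2 * k x) :
    HasGrothendieckResidue g ((L : C2 →L[ℂ] C2).det *
      deriv (fun x => (fderiv ℂ κ.symm ![x, 0]).det / k x) 0) := by
  have hs0 : κ.symm 0 = 0 := by
    conv_lhs => rw [← hκ0]
    exact κ.left_inv h0
  have ht0 : (0 : C2) ∈ κ.target := hκ0 ▸ κ.map_source h0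
  obtain ⟨j, V, hV, hinj⟩ := exists_injOn_critical L hH hk hk0 hHk
  set W : C2 → ℂ := fun ζ => (L : C2 →L[ℂ] C2).det * (fderiv ℂ κ.symm ζ).det with hWdef
  have hW : AnalyticAt ℂ W 0 := analyticAt_const.mul (analyticAt_fderiv_det hκs)
  have hdet := eventually_det_fderiv hg L h0 hκ0 hκ hκs hH hgH
  -- a radius on which everything is controlled
  obtain ⟨R, hR, hball⟩ : ∃ R > 0, ∀ ζ ∈ Metric.closedBall (0 : C2) R,
      AnalyticAt ℂ H ζ ∧ AnalyticAt ℂ W ζ ∧ ζ ∈ κ.target ∧ ζ ∈ V ∧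
      L (g (κ.symm ζ)) = ![H ζ, ζ 1] ∧
      ((fderiv ℂ g (κ.symm ζ)).det)⁻¹ = W ζ / fderiv ℂ H ζ ![1, 0] := by
    refine Metric.nhds_basis_closedBall.eventually_iff.1 ?_
    filter_upwards [hH.eventually_analyticAt, hW.eventually_analyticAt,
      κ.open_target.mem_nhds ht0, hV, hgH, hdet] with ζ h1 h2 h3 h4 h5 h6
    exact ⟨h1, h2, h3, h4, h5, h6⟩
  obtain ⟨R', hR', hball'⟩ : ∃ R' > 0, ∀ x ∈ Metric.closedBall (0 : ℂ) R',
      AnalyticAt ℂ k x ∧ k x ≠ 0 ∧ H ![x, 0] = x ^ 2 * k x := by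
    refine Metric.nhds_basis_closedBall.eventually_iff.1 ?_
    filter_upwards [hk.eventually_analyticAt, hk.continuousAt.eventually_ne hk0, hHk]
      with x h1 h2 h3
    exact ⟨h1, h2, h3⟩
  wlog hRR : R ≤ R' generalizing R
  · exact this R' hR' (fun ζ hζ => hball ζ (Metric.closedBall_subset_closedBall
      (le_of_not_ge hRR) hζ)) le_rfl
  replace hball' : ∀ x ∈ Metric.closedBall (0 : ℂ) R,
      AnalyticAt ℂ k x ∧ k x ≠ 0 ∧ H ![x, 0] = x ^ 2 * k x := fun x hx =>
    hball' x (Metric.closedBall_subset_closedBall hRR hx)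
  have hP : ∀ ζ ∈ Metric.closedBall (0 : C2) R,
      ContinuousAt (fun ζ => fderiv ℂ H ζ ![1, 0]) ζ := fun ζ hζ =>
    (analyticAt_fderiv_apply (hball ζ hζ).1 _).continuousAt
  -- the set of critical values
  set B : Set C2 := (fun ζ : C2 => L.symm ![H ζ, ζ 1]) ''
    {ζ | ζ ∈ Metric.closedBall (0 : C2) R ∧ fderiv ℂ H ζ ![1, 0] = 0} with hB
  have hBclosed : IsClosed B := by
    refine IsCompact.isClosed (IsCompact.image_of_continuousOn ?_ ?_)
    · refine (isCompact_closedBall (0 : C2) R).of_isClosed_subset ?_ fun ζ hζ => hζ.1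
      exact ContinuousOn.preimage_isClosed_of_isClosed
        (fun ζ hζ => (hP ζ hζ).continuousWithinAt) Metric.isClosed_closedBall
        (isClosed_singleton (x := (0 : ℂ)))
    · intro ζ hζ
      exact (L.symm.continuous.continuousAt.comp (analyticAt_vec (hball ζ hζ.1).1
        (analyticAt_apply 1 ζ)).continuousAt).continuousWithinAt
  have hBj : ∀ w ∈ B, ∀ w' ∈ B, w j = w' j → w = w' := by
    rintro _ ⟨ζ, ⟨hζ, hζ0⟩, rfl⟩ _ ⟨ξ, ⟨hξ, hξ0⟩, rfl⟩ h
    have : ζ = ξ := hinj (hball ζ hζ).2.2.2.1 (hball ξ hξ).2.2.2.1 (by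
      simp only [hζ0, hξ0]
      exact congrArg (fun t : ℂ => (![0, t] : C2)) h)
    rw [this]
  have hκcont : Tendsto κ (𝓝 0) (𝓝 0) := by
    have := hκ.continuousAt.tendsto
    rwa [hκ0] at this
  obtain ⟨r, hr, hrball⟩ : ∃ r > 0, ∀ z ∈ Metric.ball (0 : C2) r,
      z ∈ κ.source ∧ κ z ∈ Metric.ball (0 : C2) R := by
    refine Metric.nhds_basis_ball.eventually_iff.1 ?_
    filter_upwards [κ.open_source.mem_nhds h0, hκcont.eventually (Metric.ball_mem_nhds 0 hR)]
      with z h1 h2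
    exact ⟨h1, h2⟩
  refine ⟨r, hr, fun U hU hUr => ?_⟩
  have hscont : Tendsto κ.symm (𝓝 0) (𝓝 0) := by
    have := hκs.continuousAt.tendsto
    rwa [hs0] at this
  obtain ⟨ρ', hρ', hρU'⟩ : ∃ ρ > 0, ∀ ζ ∈ Metric.closedBall (0 : C2) ρ, κ.symm ζ ∈ U :=
    Metric.nhds_basis_closedBall.eventually_iff.1 (hscont.eventually hU)
  obtain ⟨ρ, hρ, hρR, hρU⟩ : ∃ ρ > 0, ρ < R ∧ ∀ ζ ∈ Metric.closedBall (0 : C2) ρ, κ.symm ζ ∈ U :=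
    ⟨min ρ' (R / 2), lt_min hρ' (half_pos hR), (min_le_right _ _).trans_lt (half_lt_self hR),
      fun ζ hζ => hρU' ζ (Metric.closedBall_subset_closedBall (min_le_left _ _) hζ)⟩
  -- The image of U under κ is only known to lie between the polydiscs of radii ρ and R. On the
  -- annulus ρ ≤ |x| ≤ R the function x²k(x) has no zero, and compactness extends this to small w.
  -- So no solution lies in the region where U is undetermined.
  have hann : ∀ᶠ w : C2 in 𝓝 0, ∀ x ∈ Metric.closedBall (0 : ℂ) R \ Metric.ball 0 ρ,
      H ![x, L w 1] - L w 0 ≠ 0 := by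
    refine IsCompact.eventually_forall_of_forall_eventually
      ((isCompact_closedBall (0 : ℂ) R).diff Metric.isOpen_ball) fun x hx => ?_
    have hx0 : x ≠ 0 := fun h => hx.2 (h ▸ Metric.mem_ball_self hρ)
    have hmem : (![x, 0] : C2) ∈ Metric.closedBall (0 : C2) R := by
      rw [mem_closedBall_zero_iff]
      exact norm_vec_le (mem_closedBall_zero_iff.1 hx.1) (by simpa using hR.le)
    have hc : ContinuousAt (fun p : C2 × ℂ => H ![p.2, L p.1 1] - L p.1 0) (0, x) := by
      refine ContinuousAt.sub (ContinuousAt.comp (g := H)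
        (f := fun p : C2 × ℂ => (![p.2, L p.1 1] : C2)) ?_ ?_) ?_
      · simpa using (hball _ hmem).1.continuousAt
      · exact (analyticAt_vec (analyticAt_snd (𝕜 := ℂ) (p := ((0 : C2), x)))
          (analyticAt_coord_comp L 1 analyticAt_fst)).continuousAt
      · exact (analyticAt_coord_comp L 0 (analyticAt_fst (𝕜 := ℂ)
          (p := ((0 : C2), x)))).continuousAt
    refine hc.eventually_ne ?_
    simp [(hball' x hx.1).2.2, hx0, (hball' x hx.1).2.1]
  have hsmall : ∀ᶠ w : C2 in 𝓝 0, ‖L w 1‖ < ρ := by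
    have : Tendsto (fun w : C2 => ‖L w 1‖) (𝓝 0) (𝓝 0) := by
      have := (analyticAt_coord L 1 0).continuousAt.norm.tendsto
      simpa using this
    exact this.eventually_lt_const hρ
  obtain ⟨s, hs, hsball⟩ : ∃ s > 0, ∀ w ∈ Metric.ball (0 : C2) s,
      (∀ x ∈ Metric.closedBall (0 : ℂ) R \ Metric.ball 0 ρ, H ![x, L w 1] - L w 0 ≠ 0) ∧
        ‖L w 1‖ < ρ :=
    Metric.nhds_basis_ball.eventually_iff.1 (hann.and hsmall)
  refine ⟨s, hs, fun ε hε => ?_⟩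
  set N : ℂ → C2 → ℂ := fun x w => W ![x, L w 1] / (H ![x, L w 1] - L w 0) with hN
  have hmemR : ∀ {w : C2}, w ∈ Metric.ball (0 : C2) s → ∀ {x : ℂ}, ‖x‖ ≤ R →
      (![x, L w 1] : C2) ∈ Metric.closedBall (0 : C2) R := by
    intro w hw x hx
    rw [mem_closedBall_zero_iff]
    exact norm_vec_le hx ((hsball w hw).2.le.trans hρR.le)
  have hNan : ∀ x ∈ Metric.sphere (0 : ℂ) ρ, ∀ w ∈ Metric.ball (0 : C2) s,
      AnalyticAt ℂ (Function.uncurry N) (x, w) := by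
    intro x hx w hw
    have hxR : ‖x‖ ≤ R := (mem_sphere_zero_iff_norm.1 hx).trans_le hρR.le
    have hvec : AnalyticAt ℂ (fun p : ℂ × C2 => (![p.1, L p.2 1] : C2)) (x, w) :=
      analyticAt_vec analyticAt_fst (analyticAt_coord_comp L 1 analyticAt_snd)
    have hb := hball _ (hmemR hw hxR)
    refine AnalyticAt.div (AnalyticAt.fun_comp_of_eq hb.2.1 hvec rfl)
      ((AnalyticAt.fun_comp_of_eq hb.1 hvec rfl).sub
        (analyticAt_coord_comp L 0 analyticAt_snd)) ?_
    refine (hsball w hw).1 x ⟨mem_closedBall_zero_iff.2 hxR, ?_⟩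
    rw [mem_ball_zero_iff, mem_sphere_zero_iff_norm.1 hx]
    exact lt_irrefl _
  obtain ⟨hTint, hTval⟩ := torusIntegral_parametric (N := N) (s := s) hρ
    (fun p hp => (hNan p.1 hp.1 p.2 hp.2).continuousAt.continuousWithinAt)
    (fun x hx w hw => ((hNan x hx w hw).differentiableAt.comp w
      ((differentiableAt_const x).prodMk differentiableAt_id)).differentiableWithinAt) hε
  have hV' : ∀ {b : ℂ}, ‖b‖ < ρ → ∀ x ∈ Metric.ball (0 : ℂ) R,
      (![x, b] : C2) ∈ Metric.closedBall (0 : C2) R := by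
    intro b hb x hx
    rw [mem_closedBall_zero_iff]
    exact norm_vec_le (mem_ball_zero_iff.1 hx).le (hb.le.trans hρR.le)
  -- away from the critical values the integrand is a contour integral
  have hgen : ∀ w ∈ Metric.ball (0 : C2) s, w ∉ B →
      residueIntegrand g U w =
        (2 * Real.pi * Complex.I)⁻¹ * ((∮ x in C(0, ρ), N x w) / (w 0 * w 1)) := by
    intro w hw hwB
    set a := L w 0 with ha
    set b := L w 1 with hb
    have hbρ : ‖b‖ < ρ := (hsball w hw).2
    have hLw : L w = ![a, b] := by ext i; fin_cases i <;> rfl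
    have hlin : ∀ x : ℂ, HasDerivAt (fun x : ℂ => (![x, b] : C2)) ![1, 0] x := by
      intro x
      rw [hasDerivAt_pi]
      intro i
      fin_cases i
      · exact hasDerivAt_id x
      · exact hasDerivAt_const x b
    have hqd : ∀ x ∈ Metric.ball (0 : ℂ) R,
        HasDerivAt (fun x => H ![x, b] - a) (fderiv ℂ H ![x, b] ![1, 0]) x := fun x hx =>
      ((hball _ (hV' hbρ x hx)).1.differentiableAt.hasFDerivAt.comp_hasDerivAt x
        (hlin x)).sub_const a
    have hres := circleIntegral_div_eq_finsum Metric.isOpen_ball hρ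
      (Metric.closedBall_subset_ball hρR) (q := fun x => H ![x, b] - a)
      (φ := fun x => W ![x, b])
      (fun x hx => (hqd x hx).differentiableAt.differentiableWithinAt)
      (fun x hx => (DifferentiableAt.fun_comp' (g := W) x
        (hball _ (hV' hbρ x hx)).2.1.differentiableAt
        (hlin x).differentiableAt).differentiableWithinAt)
      (fun x hx => (hsball w hw).1 x ⟨mem_closedBall_zero_iff.2
        ((mem_sphere_zero_iff_norm.1 hx).trans_le hρR.le), fun h => by
          rw [mem_ball_zero_iff, mem_sphere_zero_iff_norm.1 hx] at h
          exact lt_irrefl _ h⟩)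
      (fun x hx hq => by
        have hxR := Metric.ball_subset_ball hρR.le hx
        rw [(hqd x hxR).deriv]
        intro hcrit
        refine hwB ⟨![x, b], ⟨hV' hbρ x hxR, hcrit⟩, ?_⟩
        apply L.injective
        simp only [L.apply_symm_apply]
        rw [sub_eq_zero.1 hq, hLw]
        rfl)
    -- Surjectivity uses both radii: a solution in U has its x-coordinate in the R-disc, and the
    -- annulus estimate moves it into the ρ-disc.
    have hbij : Set.BijOn (fun x : ℂ => κ.symm ![x, b])
        {x | x ∈ Metric.ball (0 : ℂ) ρ ∧ H ![x, b] - a = 0} {z | z ∈ U ∧ g z = w} := by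
      refine ⟨?_, ?_, ?_⟩
      · rintro x ⟨hx, hq⟩
        have hxR := Metric.ball_subset_ball hρR.le hx
        refine ⟨hρU _ ?_, ?_⟩
        · rw [mem_closedBall_zero_iff]
          exact norm_vec_le (mem_ball_zero_iff.1 hx).le hbρ.le
        · apply L.injective
          rw [(hball _ (hV' hbρ x hxR)).2.2.2.2.1, sub_eq_zero.1 hq, hLw]
          rfl
      · rintro x ⟨hx, -⟩ y ⟨hy, -⟩ hxy
        have hxR := Metric.ball_subset_ball hρR.le hx
        have hyR := Metric.ball_subset_ball hρR.le hy
        have := κ.symm.injOn (hball _ (hV' hbρ x hxR)).2.2.1 (hball _ (hV' hbρ y hyR)).2.2.1 hxy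
        exact congrFun this 0
      · rintro z ⟨hzU, hgz⟩
        obtain ⟨hzs, hzR⟩ := hrball z (hUr hzU)
        have hb1 := hball _ (Metric.ball_subset_closedBall hzR)
        have h1 := hb1.2.2.2.2.1
        rw [κ.left_inv hzs, hgz, hLw] at h1
        have h2 : a = H (κ z) := congrFun h1 0
        have h3 : b = κ z 1 := congrFun h1 1
        have h4 : (![κ z 0, b] : C2) = κ z := by
          ext i
          fin_cases i
          · rfl
          · exact h3
        have h5 : H ![κ z 0, b] - a = 0 := by rw [h4, h2, sub_self]
        refine ⟨κ z 0, ⟨?_, h5⟩, ?_⟩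
        · by_contra hnot
          refine (hsball w hw).1 (κ z 0) ⟨?_, hnot⟩ h5
          rw [mem_closedBall_zero_iff]
          exact (norm_le_pi_norm (κ z) 0).trans (mem_ball_zero_iff.1 hzR).le
        · simp only [h4]
          exact κ.left_inv hzs
    have hsum := finsum_mem_eq_of_bijOn (f := fun x => W ![x, b] / deriv (fun x => H ![x, b] - a) x)
      (g := fun z => ((fderiv ℂ g z).det)⁻¹) _ hbij (fun x hx => by
        have hxR := Metric.ball_subset_ball hρR.le hx.1
        rw [(hqd x hxR).deriv, (hball _ (hV' hbρ x hxR)).2.2.2.2.2])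
    rw [hsum] at hres
    rw [residueIntegrand, hN]
    simp only [← ha, ← hb]
    rw [hres, mul_div_assoc, inv_mul_cancel_left₀ Complex.two_pi_I_ne_zero]
  have hae : ∀ᵐ θ : Fin 2 → ℝ, residueIntegrand g U (torusMap 0 ε θ) =
      (2 * Real.pi * Complex.I)⁻¹ *
        ((∮ x in C(0, ρ), N x (torusMap 0 ε θ)) / (torusMap 0 ε θ 0 * torusMap 0 ε θ 1)) := by
    filter_upwards [ae_torusMap_notMem hBclosed j hBj fun i => (hε i).1] with θ hθ
    exact hgen _ (torusMap_mem_ball hε θ) hθ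
  refine ⟨?_, ?_⟩
  · refine MeasureTheory.Integrable.congr (hTint.const_mul (2 * Real.pi * Complex.I)⁻¹) ?_
    filter_upwards [MeasureTheory.ae_restrict_of_ae hae] with θ hθ
    exact hθ.symm
  · have h1 : torusIntegral (residueIntegrand g U) 0 ε = (2 * Real.pi * Complex.I)⁻¹ *
        torusIntegral (fun w => (∮ x in C(0, ρ), N x w) / (w 0 * w 1)) 0 ε := by
      rw [← torusIntegral_const_mul]
      refine MeasureTheory.setIntegral_congr_ae measurableSet_Icc ?_
      filter_upwards [hae] with θ hθ _
      rw [hθ]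
    have h2 : ∮ x in C(0, ρ), N x 0 = 2 * Real.pi * Complex.I *
        deriv (fun x => W ![x, 0] / k x) 0 := by
      have hd : DifferentiableOn ℂ (fun x => W ![x, 0] / k x) (Metric.ball 0 R) := by
        intro x hx
        have hv : AnalyticAt ℂ (fun x : ℂ => (![x, 0] : C2)) x :=
          analyticAt_vec analyticAt_id analyticAt_const
        have hb' := hball' x (Metric.ball_subset_closedBall hx)
        have hb := hball _ (hV' (b := 0) (by simpa using hρ) x hx)
        exact ((AnalyticAt.fun_comp_of_eq hb.2.1 hv rfl).div hb'.1 hb'.2.1).differentiableAt.differentiableWithinAt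
      have h3 := Complex.two_pi_I_inv_smul_circleIntegral_sub_sq_inv_smul_of_differentiable
        Metric.isOpen_ball (Metric.closedBall_subset_ball hρR) hd (Metric.mem_ball_self hρ)
      rw [← h3, smul_eq_mul, mul_inv_cancel_left₀ Complex.two_pi_I_ne_zero]
      refine circleIntegral.integral_congr hρ.le fun x hx => ?_
      have hb' := hball' x (Metric.closedBall_subset_closedBall hρR.le
        (Metric.sphere_subset_closedBall hx))
      simp only [hN, map_zero, Pi.zero_apply, sub_zero, hb'.2.2, smul_eq_mul]
      rw [div_mul_eq_div_div_swap, div_eq_inv_mul _ (x ^ 2)]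
    have h3 : deriv (fun x => W ![x, 0] / k x) 0 = (L : C2 →L[ℂ] C2).det *
        deriv (fun x => (fderiv ℂ κ.symm ![x, 0]).det / k x) 0 := by
      rw [← deriv_const_mul_field]
      congr 1
      ext x
      rw [hWdef]
      ring
    rw [h1, hTval, h2, h3]
    have := Complex.two_pi_I_ne_zero
    field_simp

/-! ### Jets of analytic functions of one variable -/

theorem exists_eq_add_mul {f : ℂ → ℂ} (hf : AnalyticAt ℂ f 0) :
    ∃ g : ℂ → ℂ, AnalyticAt ℂ g 0 ∧ (∀ᶠ x in 𝓝 0, f x = f 0 + x * g x) ∧ g 0 = deriv f 0 := by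
  obtain ⟨A, hA, h⟩ := exists_analyticAt_eq_add_apply hf
  have hg : AnalyticAt ℂ (fun x => A x 1) 0 :=
    ((ContinuousLinearMap.apply ℂ ℂ (1 : ℂ)).analyticAt _).comp hA
  have h' : ∀ᶠ x in 𝓝 0, f x = f 0 + x * A x 1 := by
    filter_upwards [h] with x hx
    rw [hx, ← smul_eq_mul, ← map_smul, smul_eq_mul, mul_one]
  refine ⟨_, hg, h', ?_⟩
  have h1 : HasDerivAt (fun x => f 0 + x * A x 1) (1 * A 0 1 + 0 * deriv (fun x => A x 1) 0) 0 :=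
    ((hasDerivAt_id (0 : ℂ)).mul hg.differentiableAt.hasDerivAt).const_add _
  rw [(h1.congr_of_eventuallyEq h').deriv]
  ring

/-- One factor x is split off at a time: the growth bound forces the current quotient to vanish at
0. -/
theorem exists_eq_pow_mul_of_isBigO {f : ℂ → ℂ} (hf : AnalyticAt ℂ f 0) {n : ℕ}
    (h : f =O[𝓝 0] fun x => x ^ n) :
    ∃ g : ℂ → ℂ, AnalyticAt ℂ g 0 ∧ ∀ᶠ x in 𝓝 0, f x = x ^ n * g x := by
  induction n with
  | zero => exact ⟨f, hf, by simp⟩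
  | succ n ih =>
    have h1 : (fun x : ℂ => x ^ (n + 1)) =O[𝓝 0] fun x => x ^ n := by
      simp only [pow_succ]
      simpa using (Asymptotics.isBigO_refl (fun x : ℂ => x ^ n) (𝓝 0)).mul
        ((tendsto_id (x := 𝓝 (0 : ℂ))).isBigO_one ℂ)
    obtain ⟨g, hg, hfg⟩ := ih (h.trans h1)
    obtain ⟨k, hk, hgk, -⟩ := exists_eq_add_mul hg
    have hg0 : g 0 = 0 := by
      have h2 : Tendsto g (𝓝[≠] 0) (𝓝 0) := by
        obtain ⟨C, hC⟩ := h.bound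
        have h3 : Tendsto (fun x : ℂ => C * ‖x‖) (𝓝[≠] 0) (𝓝 0) := by
          have : Continuous fun x : ℂ => C * ‖x‖ := by fun_prop
          simpa using this.continuousWithinAt (s := {0}ᶜ) (x := 0) |>.tendsto
        refine squeeze_zero_norm' ?_ h3
        filter_upwards [hC.filter_mono nhdsWithin_le_nhds, hfg.filter_mono nhdsWithin_le_nhds,
          self_mem_nhdsWithin] with x h4 h5 (h6 : x ≠ 0)
        rw [h5, norm_mul, norm_pow, norm_pow, pow_succ] at h4
        have h7 : 0 < ‖x‖ ^ n := pow_pos (norm_pos_iff.2 h6) n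
        nlinarith
      exact tendsto_nhds_unique (hg.continuousAt.tendsto.mono_left nhdsWithin_le_nhds) h2
    refine ⟨k, hk, ?_⟩
    filter_upwards [hfg, hgk] with x h2 h3
    rw [h2, h3, hg0]
    ring

/-- Converts a third-order expansion into the one-jet of f/x², which is all that a residue at a
double pole sees. -/
theorem exists_eq_sq_mul_of_isLittleO {f : ℂ → ℂ} (hf : AnalyticAt ℂ f 0) {α β : ℂ}
    (h : (fun x => f x - (α * x ^ 2 + β * x ^ 3)) =o[𝓝 0] fun x => x ^ 3) :
    ∃ k : ℂ → ℂ, AnalyticAt ℂ k 0 ∧ (∀ᶠ x in 𝓝 0, f x = x ^ 2 * k x) ∧ k 0 = α ∧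
      deriv k 0 = β := by
  obtain ⟨g, hg, hfg⟩ := exists_eq_pow_mul_of_isBigO
    (hf.sub (by fun_prop : AnalyticAt ℂ (fun x : ℂ => α * x ^ 2 + β * x ^ 3) 0)) h.isBigO
  have hg0 : g 0 = 0 := by
    have h1 := h.tendsto_div_nhds_zero.mono_left (nhdsWithin_le_nhds (s := {(0 : ℂ)}ᶜ))
    refine tendsto_nhds_unique (hg.continuousAt.tendsto.mono_left nhdsWithin_le_nhds)
      (h1.congr' ?_)
    filter_upwards [hfg.filter_mono nhdsWithin_le_nhds, self_mem_nhdsWithin] with x h2 (h3 : x ≠ 0)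
    simp only [Pi.sub_apply] at h2
    rw [h2]
    field_simp
  refine ⟨fun x => α + β * x + x * g x, by fun_prop, ?_, by simp, ?_⟩
  · filter_upwards [hfg] with x h2
    simp only [Pi.sub_apply] at h2
    linear_combination h2
  · have h1 : HasDerivAt (fun x => α + β * x + x * g x)
        (β * 1 + (1 * g 0 + 0 * deriv g 0)) 0 :=
      (((hasDerivAt_id (0 : ℂ)).const_mul β).const_add α).add
        ((hasDerivAt_id (0 : ℂ)).mul hg.differentiableAt.hasDerivAt)
    rw [h1.deriv, hg0]
    ring

/-! ### The parabolic Möbius transformation `t / (1 - a t)` -/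

theorem hasDerivAt_parabolic (a : ℂ) {t : ℂ} (ht : 1 - a * t ≠ 0) :
    HasDerivAt (fun t => t / (1 - a * t)) (1 / (1 - a * t) ^ 2) t := by
  have := (hasDerivAt_id t).div (((hasDerivAt_id t).const_mul a).const_sub 1) ht
  refine this.congr_deriv ?_
  simp [mul_comm t a]

theorem eventually_one_sub_mul_ne_zero (a : ℂ) : ∀ᶠ t : ℂ in 𝓝 0, 1 - a * t ≠ 0 := by
  have : ContinuousAt (fun t : ℂ => 1 - a * t) 0 := by fun_prop
  exact this.eventually_ne (by simp)

theorem analyticAt_parabolic (a : ℂ) : AnalyticAt ℂ (fun t : ℂ => t / (1 - a * t)) 0 :=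
  analyticAt_id.div (by fun_prop) (by simp)

theorem tendsto_parabolic (a : ℂ) : Tendsto (fun t : ℂ => t / (1 - a * t)) (𝓝 0) (𝓝 0) := by
  simpa using (analyticAt_parabolic a).continuousAt.tendsto

/-- The third-order expansion of `E(t) - E(t / (1 - a t))` for `E(t) = t + b t² + ⋯`. -/
theorem sub_parabolic_isLittleO {E : ℂ → ℂ} (hE : AnalyticAt ℂ E 0) (h0 : E 0 = 0)
    (h1 : deriv E 0 = 1) (a : ℂ) :
    (fun x => E x - E (x / (1 - a * x)) -
      (-a * x ^ 2 + -(a ^ 2 + a * deriv (deriv E) 0) * x ^ 3)) =o[𝓝 0] fun x => x ^ 3 := by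
  obtain ⟨g, hg, hEg, hg0⟩ := exists_eq_add_mul hE
  obtain ⟨k, hk, hgk, hk0⟩ := exists_eq_add_mul hg
  obtain ⟨c, hc, hkc, -⟩ := exists_eq_add_mul hk
  rw [h0] at hEg
  rw [hg0, h1] at hgk
  have hb : deriv (deriv E) 0 = 2 * k 0 := by
    have h2 : ∀ᶠ x in 𝓝 0, deriv E x = g x + x * deriv g x := by
      filter_upwards [hEg.eventually_nhds, hg.eventually_analyticAt] with x h3 h4
      have h5 : HasDerivAt (fun x => 0 + x * g x) (1 * g x + x * deriv g x) x :=
        ((hasDerivAt_id x).mul h4.differentiableAt.hasDerivAt).const_add _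
      rw [(h5.congr_of_eventuallyEq h3).deriv]
      ring
    have h3 : HasDerivAt (fun x => g x + x * deriv g x)
        (deriv g 0 + (1 * deriv g 0 + 0 * deriv (deriv g) 0)) 0 :=
      hg.differentiableAt.hasDerivAt.add
        ((hasDerivAt_id (0 : ℂ)).mul hg.deriv.differentiableAt.hasDerivAt)
    rw [(h3.congr_of_eventuallyEq h2).deriv, hk0]
    ring
  set b := k 0 with hbdef
  set s : ℂ → ℂ := fun x => x / (1 - a * x) with hs
  -- The explicit remainder divided by x³, for E(x) = x + bx² + c(x)x³. It is continuous and
  -- vanishes at 0, which gives the little-o.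
  set Q : ℂ → ℂ := fun x => -a ^ 3 * x / (1 - a * x) +
    b * (2 * a - (2 * a - a ^ 2 * x) / (1 - a * x) ^ 2) + c x - c (s x) / (1 - a * x) ^ 3 with hQ
  have hexp : ∀ᶠ x in 𝓝 0, E x = x + b * x ^ 2 + c x * x ^ 3 := by
    filter_upwards [hEg, hgk, hkc] with x h3 h4 h5
    rw [h3, h4, h5]
    ring
  have hQeq : ∀ᶠ x in 𝓝 0, E x - E (s x) -
      (-a * x ^ 2 + -(a ^ 2 + a * deriv (deriv E) 0) * x ^ 3) = x ^ 3 * Q x := by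
    filter_upwards [hexp, (tendsto_parabolic a).eventually hexp,
      eventually_one_sub_mul_ne_zero a] with x h3 h4 h5
    rw [h3, h4, hb, hQ]
    simp only [hs]
    generalize c (x / (1 - a * x)) = C
    generalize hD : 1 - a * x = D at h5 ⊢
    field_simp
    rw [← hD]
    ring
  have hQ0 : Tendsto Q (𝓝 0) (𝓝 0) := by
    have hcs : ContinuousAt (fun x => c (s x)) 0 :=
      ContinuousAt.comp_of_eq hc.continuousAt (analyticAt_parabolic a).continuousAt (by simp [hs])
    have hcc := hc.continuousAt
    have hd1 : ContinuousAt (fun x : ℂ => 1 - a * x) 0 := by fun_prop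
    have : ContinuousAt Q 0 := by
      refine ((((ContinuousAt.div (by fun_prop) hd1 (by simp)).add
        (continuousAt_const.mul (continuousAt_const.sub (ContinuousAt.div (by fun_prop)
          (hd1.pow 2) (by simp))))).add hcc).sub (hcs.div (hd1.pow 3) (by simp)))
    have h3 := this.tendsto
    simpa [hQ, hs] using h3
  rw [Asymptotics.isLittleO_congr hQeq EventuallyEq.rfl]
  simpa using (Asymptotics.isBigO_refl (fun x : ℂ => x ^ 3) (𝓝 0)).mul_isLittleO
    ((Asymptotics.isLittleO_one_iff ℂ).2 hQ0)

/-- Here E starts in degree two, and x/(1 - ax) differs from x by O(x²), so the difference gains one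
order. -/
theorem sub_parabolic_isBigO {E : ℂ → ℂ} (hE : AnalyticAt ℂ E 0) (h0 : E 0 = 0)
    (h1 : deriv E 0 = 0) (a : ℂ) :
    (fun x => E x - E (x / (1 - a * x))) =O[𝓝 0] fun x => x ^ 3 := by
  obtain ⟨g, hg, hEg, hg0⟩ := exists_eq_add_mul hE
  obtain ⟨k, hk, hgk, -⟩ := exists_eq_add_mul hg
  rw [h0] at hEg
  rw [hg0, h1] at hgk
  set s : ℂ → ℂ := fun x => x / (1 - a * x) with hs
  have hQ : AnalyticAt ℂ (fun x => k x - k (s x) / (1 - a * x) ^ 2) 0 :=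
    hk.sub ((AnalyticAt.fun_comp_of_eq hk (analyticAt_parabolic a) (by simp)).div
      (by fun_prop) (by simp))
  obtain ⟨m, hm, hQm, -⟩ := exists_eq_add_mul hQ
  have hexp : ∀ᶠ x in 𝓝 0, E x = k x * x ^ 2 := by
    filter_upwards [hEg, hgk] with x h3 h4
    rw [h3, h4]
    ring
  have heq : ∀ᶠ x in 𝓝 0, E x - E (s x) = x ^ 3 * m x := by
    filter_upwards [hexp, (tendsto_parabolic a).eventually hexp,
      eventually_one_sub_mul_ne_zero a, hQm] with x h3 h4 h5 h6
    have h7 : k x - k (s x) / (1 - a * x) ^ 2 = x * m x := by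
      rw [h6]
      simp [hs]
    rw [h3, h4, show x ^ 3 * m x = x ^ 2 * (x * m x) by ring, ← h7]
    simp only [hs]
    generalize k (x / (1 - a * x)) = C
    field_simp
  rw [Asymptotics.isBigO_congr heq EventuallyEq.rfl]
  simpa using (Asymptotics.isBigO_refl (fun x : ℂ => x ^ 3) (𝓝 0)).mul
    (hm.continuousAt.tendsto.isBigO_one ℂ)

/-! ### Parabolic germs in normal form -/

/-- A germ `F` with linear part `diag(1, δ)`, an invariant curve `(E₀, E₁)` tangent to the first
axis on which it acts as `t ↦ t / (1 - a t)`, and an area form `h dz₀ ∧ dz₁` multiplied by `δ`. -/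
structure IsParabolicNormalForm (F : C2 → C2) (E₀ E₁ : ℂ → ℂ) (h : C2 → ℂ) (a δ : ℂ) : Prop where
  analyticAt : AnalyticAt ℂ F 0
  map_zero : F 0 = 0
  fderiv_zero : ∀ v, fderiv ℂ F 0 v = ![v 0, δ * v 1]
  analyticAt_fst : AnalyticAt ℂ E₀ 0
  analyticAt_snd : AnalyticAt ℂ E₁ 0
  fst_zero : E₀ 0 = 0
  snd_zero : E₁ 0 = 0
  deriv_fst : deriv E₀ 0 = 1
  deriv_snd : deriv E₁ 0 = 0
  semiconj : ∀ᶠ t in 𝓝 0, F ![E₀ t, E₁ t] = ![E₀ (t / (1 - a * t)), E₁ (t / (1 - a * t))]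
  analyticAt_density : AnalyticAt ℂ h 0
  density_ne_zero : h 0 ≠ 0
  density_map : ∀ᶠ z in 𝓝 0, h (F z) * (fderiv ℂ F z).det = δ * h z

theorem hasDerivAt_vec {f g : ℂ → ℂ} {f' g' x : ℂ} (hf : HasDerivAt f f' x)
    (hg : HasDerivAt g g' x) : HasDerivAt (fun x => (![f x, g x] : C2)) ![f', g'] x := by
  rw [hasDerivAt_pi]
  intro i
  fin_cases i
  exacts [hf, hg]

theorem vec_zero_zero : (![0, 0] : C2) = 0 := by
  ext i
  fin_cases i <;> rfl

namespace IsParabolicNormalForm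

variable {F : C2 → C2} {E₀ E₁ : ℂ → ℂ} {h : C2 → ℂ} {a δ : ℂ}

theorem curve_zero (H : IsParabolicNormalForm F E₀ E₁ h a δ) : (![E₀ 0, E₁ 0] : C2) = 0 := by
  rw [H.fst_zero, H.snd_zero, vec_zero_zero]

theorem analyticAt_curve (H : IsParabolicNormalForm F E₀ E₁ h a δ) :
    AnalyticAt ℂ (fun t => (![E₀ t, E₁ t] : C2)) 0 :=
  analyticAt_vec H.analyticAt_fst H.analyticAt_snd

theorem tendsto_curve (H : IsParabolicNormalForm F E₀ E₁ h a δ) :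
    Tendsto (fun t => (![E₀ t, E₁ t] : C2)) (𝓝 0) (𝓝 0) := by
  have := H.analyticAt_curve.continuousAt.tendsto
  rwa [H.curve_zero] at this

theorem hasDerivAt_curve (H : IsParabolicNormalForm F E₀ E₁ h a δ) :
    HasDerivAt (fun t => (![E₀ t, E₁ t] : C2)) ![1, 0] 0 := by
  have := hasDerivAt_vec H.analyticAt_fst.differentiableAt.hasDerivAt
    H.analyticAt_snd.differentiableAt.hasDerivAt
  rwa [H.deriv_fst, H.deriv_snd] at this

theorem analyticAt_partial (H : IsParabolicNormalForm F E₀ E₁ h a δ) (v : C2) (i : Fin 2) :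
    AnalyticAt ℂ (fun z => fderiv ℂ F z v i) 0 :=
  (analyticAt_apply i _).comp (analyticAt_fderiv_apply H.analyticAt v)

/-- Derivative of a function along a curve tangent to the first axis. -/
theorem hasDerivAt_comp_of_tangent {f : C2 → ℂ} (hf : AnalyticAt ℂ f 0) {γ : ℂ → C2}
    (hγ : HasDerivAt γ ![1, 0] 0) (hγ0 : γ 0 = 0) :
    HasDerivAt (fun t => f (γ t)) (fderiv ℂ f 0 ![1, 0]) 0 :=
  HasFDerivAt.comp_hasDerivAt (l := f) (0 : ℂ) (by
    rw [hγ0]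
    exact hf.differentiableAt.hasFDerivAt) hγ

/-- The first component of the semiconjugacy is differentiated in t, and then once more at t = 0.
The terms with E₀'' cancel, and the one with E₁'' drops out because the linear part of F is
diagonal. What remains is 2a, the second derivative of t/(1 - at). -/
theorem partial_fst (H : IsParabolicNormalForm F E₀ E₁ h a δ) :
    fderiv ℂ (fun z => fderiv ℂ F z ![1, 0] 0) 0 ![1, 0] = 2 * a := by
  have hder : ∀ᶠ t in 𝓝 0, fderiv ℂ F ![E₀ t, E₁ t] ![1, 0] 0 * deriv E₀ t +
      fderiv ℂ F ![E₀ t, E₁ t] ![0, 1] 0 * deriv E₁ t =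
      deriv E₀ (t / (1 - a * t)) * (1 / (1 - a * t) ^ 2) := by
    filter_upwards [H.semiconj.eventually_nhds, H.analyticAt_fst.eventually_analyticAt,
      H.analyticAt_snd.eventually_analyticAt, H.tendsto_curve.eventually
        H.analyticAt.eventually_analyticAt, (tendsto_parabolic a).eventually
        H.analyticAt_fst.eventually_analyticAt,
      eventually_one_sub_mul_ne_zero a] with t h1 h2 h3 h4 h5 h6
    have h7 : HasDerivAt (fun t => F ![E₀ t, E₁ t] 0)
        ((fderiv ℂ F ![E₀ t, E₁ t] ![deriv E₀ t, deriv E₁ t]) 0) t :=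
      (hasDerivAt_pi.1 (h4.differentiableAt.hasFDerivAt.comp_hasDerivAt t
        (hasDerivAt_vec h2.differentiableAt.hasDerivAt h3.differentiableAt.hasDerivAt))) 0
    have h8 : HasDerivAt (fun t => E₀ (t / (1 - a * t))) _ t :=
      h5.differentiableAt.hasDerivAt.comp t (hasDerivAt_parabolic a h6)
    have h9 := (h7.congr_of_eventuallyEq (h1.mono fun y hy => by
      simp only [hy]
      rfl)).unique h8
    rw [← h9]
    have h10 : (![deriv E₀ t, deriv E₁ t] : C2) =
        deriv E₀ t • ![1, 0] + deriv E₁ t • ![0, 1] := by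
      ext i
      fin_cases i <;> simp
    rw [h10, map_add, map_smul, map_smul]
    simp [mul_comm]
  have hc := H.hasDerivAt_curve
  have h1 := (hasDerivAt_comp_of_tangent (H.analyticAt_partial ![1, 0] 0) hc H.curve_zero).mul
    H.analyticAt_fst.deriv.differentiableAt.hasDerivAt
  have h2 := (hasDerivAt_comp_of_tangent (H.analyticAt_partial ![0, 1] 0) hc H.curve_zero).mul
    H.analyticAt_snd.deriv.differentiableAt.hasDerivAt
  have h3 : HasDerivAt (fun t => deriv E₀ (t / (1 - a * t)))
      (deriv (deriv E₀) 0 * (1 / (1 - a * 0) ^ 2)) 0 :=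
    HasDerivAt.comp (h₂ := deriv E₀) 0 (by
      simpa using H.analyticAt_fst.deriv.differentiableAt.hasDerivAt)
      (hasDerivAt_parabolic a (by simp))
  have h4 : HasDerivAt (fun t : ℂ => 1 / (1 - a * t) ^ 2) (2 * a) 0 := by
    have h5 : HasDerivAt (fun t : ℂ => (1 - a * t) ^ 2) (-(2 * a)) 0 := by
      have := ((((hasDerivAt_id (0 : ℂ)).const_mul a).const_sub 1).pow 2)
      refine this.congr_deriv ?_
      simp
    have := (hasDerivAt_const (0 : ℂ) (1 : ℂ)).div h5 (by simp)
    refine this.congr_deriv ?_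
    simp
  have h5 := ((h1.add h2).congr_of_eventuallyEq (hder.mono fun t ht => ht.symm)).unique
    (h3.mul h4)
  simp only [H.curve_zero, H.fderiv_zero, H.deriv_fst, H.deriv_snd] at h5
  simp [H.deriv_fst] at h5
  linear_combination h5

/-- The area form controls the transverse derivative. Since t/(1 - at) is tangent to the identity,
differentiating h(F) det DF = δh along the curve at 0 eliminates the derivative of h, so det DF is
stationary there. The off-diagonal entries of DF vanish at 0, so the product of the diagonal ones
has derivative zero. By `partial_fst` the first of them has derivative 2a. -/
theorem partial_snd (H : IsParabolicNormalForm F E₀ E₁ h a δ) :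
    fderiv ℂ (fun z => fderiv ℂ F z ![0, 1] 1) 0 ![1, 0] = -(2 * a * δ) := by
  have hc := H.hasDerivAt_curve
  have hcomp := fun v i => hasDerivAt_comp_of_tangent (H.analyticAt_partial v i) hc H.curve_zero
  have hD := ((hcomp ![1, 0] 0).mul (hcomp ![0, 1] 1)).sub
    ((hcomp ![0, 1] 0).mul (hcomp ![1, 0] 1))
  have hφ := hasDerivAt_comp_of_tangent H.analyticAt_density hc H.curve_zero
  have hφs : HasDerivAt (fun t => h ![E₀ (t / (1 - a * t)), E₁ (t / (1 - a * t))])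
      (fderiv ℂ h 0 ![1, 0] * (1 / (1 - a * 0) ^ 2)) 0 :=
    HasDerivAt.comp (h₂ := fun t => h ![E₀ t, E₁ t]) 0 (by simpa using hφ)
      (hasDerivAt_parabolic a (by simp))
  have hev : ∀ᶠ t in 𝓝 0, δ * h ![E₀ t, E₁ t] =
      h ![E₀ (t / (1 - a * t)), E₁ (t / (1 - a * t))] * (fderiv ℂ F ![E₀ t, E₁ t]).det := by
    filter_upwards [H.semiconj, H.tendsto_curve.eventually H.density_map] with t h1 h2
    rw [← h2, h1]
  simp only [det_eq_of_C2] at hev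
  have h5 := ((hφs.mul hD).congr_of_eventuallyEq hev).unique (hφ.const_mul δ)
  simp only [Pi.mul_apply, Pi.sub_apply, H.curve_zero, H.fderiv_zero, H.partial_fst] at h5
  simp [H.fst_zero, H.snd_zero, vec_zero_zero] at h5
  have h6 : h 0 * (fderiv ℂ (fun z => fderiv ℂ F z ![0, 1] 1) 0 ![1, 0] + 2 * a * δ) = 0 := by
    linear_combination h5
  have h7 := (mul_eq_zero.1 h6).resolve_left H.density_ne_zero
  linear_combination h7

end IsParabolicNormalForm

/-- Coordinates in which the curve `(E₀, E₁)` is the first axis. -/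
def straighten (E₀ E₁ : ℂ → ℂ) (ζ : C2) : C2 := ![E₀ (ζ 0), E₁ (ζ 0) + ζ 1]

theorem analyticAt_straighten {E₀ E₁ : ℂ → ℂ} {ζ : C2} (h₀ : AnalyticAt ℂ E₀ (ζ 0))
    (h₁ : AnalyticAt ℂ E₁ (ζ 0)) : AnalyticAt ℂ (straighten E₀ E₁) ζ :=
  analyticAt_vec (AnalyticAt.fun_comp_of_eq h₀ (analyticAt_apply 0 ζ) rfl)
    ((AnalyticAt.fun_comp_of_eq h₁ (analyticAt_apply 0 ζ) rfl).add (analyticAt_apply 1 ζ))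

theorem fderiv_straighten {E₀ E₁ : ℂ → ℂ} {ζ : C2} (h₀ : AnalyticAt ℂ E₀ (ζ 0))
    (h₁ : AnalyticAt ℂ E₁ (ζ 0)) (v : C2) :
    fderiv ℂ (straighten E₀ E₁) ζ v = ![deriv E₀ (ζ 0) * v 0, deriv E₁ (ζ 0) * v 0 + v 1] := by
  have hp : ∀ i, HasFDerivAt (fun ζ : C2 => ζ i)
      (ContinuousLinearMap.proj (R := ℂ) (φ := fun _ : Fin 2 => ℂ) i) ζ := fun i =>
    (ContinuousLinearMap.proj (R := ℂ) (φ := fun _ : Fin 2 => ℂ) i).hasFDerivAt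
  have hd := (analyticAt_straighten h₀ h₁).differentiableAt.hasFDerivAt
  rw [hasFDerivAt_pi'] at hd
  have e0 := (hd 0).unique (h₀.differentiableAt.hasDerivAt.comp_hasFDerivAt ζ (hp 0))
  have e1 := (hd 1).unique ((h₁.differentiableAt.hasDerivAt.comp_hasFDerivAt ζ (hp 0)).add (hp 1))
  ext i
  fin_cases i
  · simpa using congrArg (fun T => T v) e0
  · simpa using congrArg (fun T => T v) e1

theorem fderiv_sub_self {F : C2 → C2} {z : C2} (hF : AnalyticAt ℂ F z) (v : C2) :
    fderiv ℂ (fun z => z - F z) z v = v - fderiv ℂ F z v := by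
  have : HasFDerivAt (fun z => z - F z) (ContinuousLinearMap.id ℂ C2 - fderiv ℂ F z) z :=
    (hasFDerivAt_id z).sub hF.differentiableAt.hasFDerivAt
  rw [this.fderiv]
  rfl

namespace IsParabolicNormalForm

variable {F : C2 → C2} {E₀ E₁ : ℂ → ℂ} {h : C2 → ℂ} {a δ : ℂ}

theorem analyticAt_displacement (H : IsParabolicNormalForm F E₀ E₁ h a δ) :
    AnalyticAt ℂ (fun z => z - F z) 0 :=
  analyticAt_id.sub H.analyticAt

theorem displacement_fst_isLittleO (H : IsParabolicNormalForm F E₀ E₁ h a δ) :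
    (fun x => (![E₀ x, E₁ x] - F ![E₀ x, E₁ x]) 0 -
      (-a * x ^ 2 + -(a ^ 2 + a * deriv (deriv E₀) 0) * x ^ 3)) =o[𝓝 0] fun x => x ^ 3 := by
  refine (sub_parabolic_isLittleO H.analyticAt_fst H.fst_zero H.deriv_fst a).congr' ?_
    EventuallyEq.rfl
  filter_upwards [H.semiconj] with x hx
  rw [hx]
  rfl

theorem displacement_snd_isBigO (H : IsParabolicNormalForm F E₀ E₁ h a δ) :
    (fun x => (![E₀ x, E₁ x] - F ![E₀ x, E₁ x]) 1) =O[𝓝 0] fun x => x ^ 3 := by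
  refine (sub_parabolic_isBigO H.analyticAt_snd H.snd_zero H.deriv_snd a).congr' ?_
    EventuallyEq.rfl
  filter_upwards [H.semiconj] with x hx
  rw [hx]
  rfl

theorem multiplicity_eq_two (H : IsParabolicNormalForm F E₀ E₁ h a δ) (ha : a ≠ 0) (hδ : δ ≠ 1)
    {g : C2 → C2} (hg : AnalyticAt ℂ g 0) (L : C2 ≃L[ℂ] C2)
    (hLg : ∀ z, L (g (L.symm z)) = z - F z) : germMultiplicity g = 2 := by
  have hg0 : g 0 = 0 := by
    apply L.injective
    have := hLg 0
    rw [_root_.map_zero, H.map_zero] at this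
    simpa using this
  have hne : ∀ᶠ t : ℂ in 𝓝[≠] 0, t ≠ 0 := self_mem_nhdsWithin
  have hslope : ∀ {E : ℂ → ℂ} {c : ℂ}, HasDerivAt E c 0 → E 0 = 0 →
      Tendsto (fun t => E t / t) (𝓝[≠] 0) (𝓝 c) := by
    intro E c hE hE0
    have := hasDerivAt_iff_tendsto_slope.1 hE
    refine this.congr fun t => ?_
    rw [slope_def_field, hE0, sub_zero, sub_zero]
  -- κ = 1 - δ is the transverse eigenvalue of the displacement, and c = -a is its leading
  -- coefficient along the invariant curve.
  refine germMultiplicity_eq_two (κ := 1 - δ) (c := -a) hg hg0 L (sub_ne_zero.2 hδ.symm) ?_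
    (e := fun t => L.symm ![E₀ t, E₁ t]) ?_ (neg_ne_zero.2 ha) ?_ ?_ ?_
  · intro v
    have h1 := (L : C2 →L[ℂ] C2).hasFDerivAt.comp (0 : C2)
      (HasFDerivAt.comp (g := g) (0 : C2) (by
        rw [ContinuousLinearEquiv.coe_coe, _root_.map_zero]
        exact hg.differentiableAt.hasFDerivAt) (L.symm : C2 →L[ℂ] C2).hasFDerivAt)
    have h2 : (L : C2 → C2) ∘ (g ∘ (L.symm : C2 → C2)) = fun z => z - F z := funext hLg
    have h3 := h1.fderiv
    simp only [ContinuousLinearEquiv.coe_coe, h2] at h3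
    have h4 := fderiv_sub_self H.analyticAt v
    rw [h3, H.fderiv_zero] at h4
    refine Eq.trans h4 ?_
    ext i
    fin_cases i
    · simp
    · simp
      ring
  · have := (L.symm.continuous.tendsto 0).comp H.tendsto_curve
    rw [_root_.map_zero] at this
    exact this.mono_left nhdsWithin_le_nhds
  · have h1 := H.displacement_fst_isLittleO
    have h2 : Tendsto (fun t => ((![E₀ t, E₁ t] - F ![E₀ t, E₁ t]) 0 -
      (-a * t ^ 2 + -(a ^ 2 + a * deriv (deriv E₀) 0) * t ^ 3)) / t ^ 3 * t +
      (-a + -(a ^ 2 + a * deriv (deriv E₀) 0) * t)) (𝓝[≠] 0) (𝓝 (0 * 0 + (-a + -(a ^ 2 + a * deriv (deriv E₀) 0) * 0))) := by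
      have h3 : Tendsto (fun t : ℂ => t) (𝓝[≠] 0) (𝓝 0) := nhdsWithin_le_nhds
      exact ((h1.tendsto_div_nhds_zero.mono_left nhdsWithin_le_nhds).mul h3).add
        (tendsto_const_nhds.add (tendsto_const_nhds.mul h3))
    rw [mul_zero, mul_zero, zero_add, add_zero] at h2
    refine h2.congr' ?_
    filter_upwards [hne] with t ht
    rw [hLg]
    field_simp
    ring
  · simp only [L.apply_symm_apply]
    refine hslope ?_ H.fst_zero
    simpa [H.deriv_fst] using H.analyticAt_fst.differentiableAt.hasDerivAt
  · simp only [L.apply_symm_apply]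
    refine hslope ?_ H.snd_zero
    simpa [H.deriv_snd] using H.analyticAt_snd.differentiableAt.hasDerivAt

/-- A point of the curve `z₁ - F₁ = 0` differs from the invariant curve by terms of third order. -/
theorem isBigO_of_displacement_eq_zero (H : IsParabolicNormalForm F E₀ E₁ h a δ) (hδ : δ ≠ 1)
    {y : ℂ → ℂ} (hy : Tendsto y (𝓝 0) (𝓝 0))
    (hy0 : ∀ᶠ x in 𝓝 0, (![E₀ x, E₁ x + y x] - F ![E₀ x, E₁ x + y x]) 1 = 0) :
    y =O[𝓝 0] (fun x => x ^ 3) ∧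
      (fun x => (![E₀ x, E₁ x + y x] - F ![E₀ x, E₁ x + y x]) 0 -
        (-a * x ^ 2 + -(a ^ 2 + a * deriv (deriv E₀) 0) * x ^ 3)) =o[𝓝 0] fun x => x ^ 3 := by
  have hγ : Tendsto (fun x => (![E₀ x, E₁ x + y x] : C2)) (𝓝 0) (𝓝 0) := by
    rw [tendsto_pi_nhds]
    intro i
    fin_cases i
    · simpa [H.fst_zero] using H.analyticAt_fst.continuousAt.tendsto
    · have := H.analyticAt_snd.continuousAt.tendsto.add hy
      simpa [H.snd_zero] using this
  have hs := (H.analyticAt_displacement.hasStrictFDerivAt.isLittleO).comp_tendsto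
    (hγ.prodMk_nhds H.tendsto_curve)
  -- Strict differentiability with derivative diag(0, 1 - δ): moving vertically by y changes the
  -- first component of the displacement by o(y), and the second by (1 - δ)y + o(y).
  have hyo : ∀ i : Fin 2, (fun x => (![E₀ x, E₁ x + y x] - F ![E₀ x, E₁ x + y x]) i -
      (![E₀ x, E₁ x] - F ![E₀ x, E₁ x]) i - (![0, (1 - δ) * y x] : C2) i) =o[𝓝 0] y := by
    intro i
    have h1 := (Asymptotics.isLittleO_pi.1 hs) i
    have hdiff : ∀ x, (![E₀ x, E₁ x + y x] : C2) - ![E₀ x, E₁ x] = ![0, y x] := by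
      intro x
      ext i
      fin_cases i <;> simp
    refine (h1.congr_left fun x => ?_).trans_isBigO (Asymptotics.IsBigO.of_bound 1 ?_)
    · simp only [Function.comp_apply, hdiff, fderiv_sub_self H.analyticAt, H.fderiv_zero,
        Pi.sub_apply]
      congr 1
      fin_cases i
      · simp
      · simp
        ring
    · refine Eventually.of_forall fun x => ?_
      simp only [Function.comp_apply, hdiff, one_mul]
      exact norm_vec_le (by simp) le_rfl
  have hδ' : 0 < ‖1 - δ‖ := norm_pos_iff.2 (sub_ne_zero.2 hδ.symm)
  -- On the invariant curve the second component is O(x³), and on the displaced curve it is 0. Hence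
  -- (1 - δ)y + o(y) = O(x³), with 1 - δ invertible.
  have hybig : y =O[𝓝 0] fun x => x ^ 3 := by
    refine Asymptotics.IsBigO.trans (Asymptotics.IsBigO.of_bound (2 / ‖1 - δ‖) ?_)
      H.displacement_snd_isBigO
    filter_upwards [(hyo 1).def (half_pos hδ'), hy0] with x h1 h2
    rw [h2] at h1
    simp only [Matrix.cons_val_one, Matrix.cons_val_zero] at h1
    set d := (![E₀ x, E₁ x] - F ![E₀ x, E₁ x]) 1 with hd
    have h3 : ‖(1 - δ) * y x‖ ≤ ‖0 - d - (1 - δ) * y x‖ + ‖d‖ := by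
      have := norm_add_le (0 - d - (1 - δ) * y x) d
      rw [show 0 - d - (1 - δ) * y x + d = -((1 - δ) * y x) by ring, norm_neg] at this
      exact this
    rw [norm_mul] at h3
    rw [div_mul_eq_mul_div, le_div_iff₀ hδ']
    linarith
  refine ⟨hybig, ?_⟩
  refine (((hyo 0).trans_isBigO hybig).add H.displacement_fst_isLittleO).congr_left fun x => ?_
  simp
  ring

/-- The Grothendieck residue at a parabolic fixed point. -/
theorem hasGrothendieckResidue (H : IsParabolicNormalForm F E₀ E₁ h a δ) (ha : a ≠ 0) (hδ : δ ≠ 1)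
    {g : C2 → C2} (hg : AnalyticAt ℂ g 0) (L : C2 ≃L[ℂ] C2)
    (hLg : ∀ z, L (g (L.symm z)) = z - F z) :
    HasGrothendieckResidue g ((1 + δ) / (1 - δ) ^ 2) := by
  have hδ' : 1 - δ ≠ 0 := sub_ne_zero.2 hδ.symm
  have hL : (L : C2 →L[ℂ] C2).det ≠ 0 := (LinearEquiv.isUnit_det' L.toLinearEquiv).ne_zero
  have hLs : (L.symm : C2 →L[ℂ] C2).det = ((L : C2 →L[ℂ] C2).det)⁻¹ := by
    refine eq_inv_of_mul_eq_one_left ?_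
    rw [← det_comp_C2, ContinuousLinearEquiv.coe_symm_comp_coe]
    simp [ContinuousLinearMap.det]
  set G : C2 → C2 := fun z => z - F z with hG
  have hGan : AnalyticAt ℂ G 0 := H.analyticAt_displacement
  set Φ := straighten E₀ E₁ with hΦ
  have hΦan : AnalyticAt ℂ Φ 0 := analyticAt_straighten H.analyticAt_fst H.analyticAt_snd
  have hΦ0 : Φ 0 = 0 := by
    rw [hΦ, straighten]
    simp [H.fst_zero, H.snd_zero, vec_zero_zero]
  have hΦt : Tendsto Φ (𝓝 0) (𝓝 0) := by
    have := hΦan.continuousAt.tendsto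
    rwa [hΦ0] at this
  set m : C2 → ℂ := fun z => 1 - fderiv ℂ F z ![0, 1] 1 with hm
  have hman : AnalyticAt ℂ m 0 := analyticAt_const.sub (H.analyticAt_partial _ _)
  have hm0 : m 0 = 1 - δ := by simp [hm, H.fderiv_zero]
  -- the straightening chart
  set Θ : C2 → C2 := fun ζ => L.symm (Φ ζ) with hΘ
  have hΘan : AnalyticAt ℂ Θ 0 := ((L.symm : C2 →L[ℂ] C2).analyticAt _).comp hΦan
  have hΘ0 : Θ 0 = 0 := by simp [hΘ, hΦ0]
  have happ0 : Tendsto (fun ζ : C2 => ζ 0) (𝓝 0) (𝓝 0) := (continuous_apply 0).tendsto (0 : C2)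
  have hΘdet : ∀ᶠ ζ in 𝓝 0, (fderiv ℂ Θ ζ).det = ((L : C2 →L[ℂ] C2).det)⁻¹ * deriv E₀ (ζ 0) := by
    filter_upwards [happ0.eventually H.analyticAt_fst.eventually_analyticAt,
      happ0.eventually H.analyticAt_snd.eventually_analyticAt] with ζ h1 h2
    have h3 := (L.symm : C2 →L[ℂ] C2).hasFDerivAt.comp ζ
      (analyticAt_straighten h1 h2).differentiableAt.hasFDerivAt
    have h4 : fderiv ℂ Θ ζ = _ := h3.fderiv
    rw [h4, det_comp_C2, hLs, det_eq_of_C2 (fderiv ℂ _ _)]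
    simp only [fderiv_straighten h1 h2]
    simp
  -- the chart whose second coordinate is the second component of the displacement
  set K : C2 → C2 := fun ζ => ![ζ 0, G (Φ ζ) 1] with hK
  have hKan : AnalyticAt ℂ K 0 :=
    analyticAt_vec (analyticAt_apply 0 0) ((analyticAt_apply 1 _).comp
      (AnalyticAt.fun_comp_of_eq hGan hΦan hΦ0))
  have hK0 : K 0 = 0 := by
    simp [hK, hΦ0, hG, H.map_zero, vec_zero_zero]
  have hKdet : ∀ᶠ ζ in 𝓝 0, AnalyticAt ℂ K ζ ∧ (fderiv ℂ K ζ).det = m (Φ ζ) := by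
    filter_upwards [happ0.eventually H.analyticAt_fst.eventually_analyticAt,
      happ0.eventually H.analyticAt_snd.eventually_analyticAt,
      hΦt.eventually H.analyticAt.eventually_analyticAt,
      hKan.eventually_analyticAt] with ζ h1 h2 h3 h4
    refine ⟨h4, ?_⟩
    have h5 : HasFDerivAt G (fderiv ℂ G (Φ ζ)) (Φ ζ) :=
      (analyticAt_id.sub h3).differentiableAt.hasFDerivAt
    have h6 := h5.comp ζ (analyticAt_straighten h1 h2).differentiableAt.hasFDerivAt
    have hd := h4.differentiableAt.hasFDerivAt
    rw [hasFDerivAt_pi'] at hd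
    have e0 : ∀ v, fderiv ℂ K ζ v 0 = v 0 := fun v => congrArg (fun T => T v) ((hd 0).unique
      (ContinuousLinearMap.proj (R := ℂ) (φ := fun _ : Fin 2 => ℂ) 0).hasFDerivAt)
    have e1 : ∀ v, fderiv ℂ K ζ v 1 = fderiv ℂ G (Φ ζ) (fderiv ℂ Φ ζ v) 1 := fun v =>
      congrArg (fun T => T v) ((hd 1).unique (hasFDerivAt_pi'.1 h6 1))
    rw [det_eq_of_C2, e0, e0, e1, e1, hG, fderiv_sub_self h3, hΦ, fderiv_straighten h1 h2]
    simp [hm]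
  obtain ⟨κ₁, hκ₁, hs₁, hκ₁an⟩ := exists_openPartialHomeomorph hΘan (by
    rw [hΘdet.self_of_nhds]
    simpa [H.deriv_fst] using hL)
  obtain ⟨κ₂, hκ₂, hs₂, hκ₂an⟩ := exists_openPartialHomeomorph hKan (by
    rw [hKdet.self_of_nhds.2, hΦ0, hm0]
    exact hδ')
  rw [hΘ0] at hκ₁an
  rw [hK0] at hκ₂an
  have h₁0 : κ₁.symm 0 = 0 := by
    have := κ₁.left_inv hs₁
    rwa [hκ₁, hΘ0] at this
  have h₂0 : κ₂.symm 0 = 0 := by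
    have := κ₂.left_inv hs₂
    rwa [hκ₂, hK0] at this
  have ht₁ : (0 : C2) ∈ κ₁.target := by
    have := κ₁.map_source hs₁
    rwa [hκ₁, hΘ0] at this
  have ht₂ : (0 : C2) ∈ κ₂.target := by
    have := κ₂.map_source hs₂
    rwa [hκ₂, hK0] at this
  have hκ₂t : Tendsto κ₂.symm (𝓝 0) (𝓝 0) := by
    have := hκ₂an.continuousAt.tendsto
    rwa [h₂0] at this
  have hKκ : ∀ ζ ∈ κ₂.target, K (κ₂.symm ζ) = ζ := fun ζ hζ => by
    have := κ₂.right_inv hζ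
    rwa [hκ₂] at this
  set κ := κ₁.symm.trans κ₂ with hκ
  have hκsymm : ∀ ζ, κ.symm ζ = Θ (κ₂.symm ζ) := fun ζ => by
    rw [← hκ₁]
    rfl
  have hκapp : ∀ z, κ z = K (κ₁.symm z) := fun z => by
    rw [← hκ₂]
    rfl
  have hsource : (0 : C2) ∈ κ.source := by
    rw [hκ, OpenPartialHomeomorph.trans_source]
    exact ⟨ht₁, by rw [Set.mem_preimage, h₁0]; exact hs₂⟩
  have hκ0 : κ 0 = 0 := by rw [hκapp, h₁0, hK0]
  have hκan : AnalyticAt ℂ κ 0 := by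
    rw [funext hκapp]
    exact AnalyticAt.fun_comp_of_eq hKan hκ₁an h₁0
  have hκsan : AnalyticAt ℂ κ.symm 0 := by
    rw [funext hκsymm]
    exact AnalyticAt.fun_comp_of_eq hΘan hκ₂an h₂0
  set η : C2 → ℂ := fun ζ => G (Φ (κ₂.symm ζ)) 0 with hη
  have hηan : AnalyticAt ℂ η 0 := (analyticAt_apply 0 _).comp
    (AnalyticAt.fun_comp_of_eq hGan (AnalyticAt.fun_comp_of_eq hΦan hκ₂an h₂0)
      (by rw [h₂0, hΦ0]))
  have hgη : ∀ᶠ ζ in 𝓝 0, L (g (κ.symm ζ)) = ![η ζ, ζ 1] := by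
    filter_upwards [κ₂.open_target.mem_nhds ht₂] with ζ hζ
    rw [hκsymm, hΘ, hLg]
    ext i
    fin_cases i
    · rfl
    · exact congrFun (hKκ ζ hζ) 1
  -- the curve along which the second component of the displacement vanishes
  have hline : AnalyticAt ℂ (fun x : ℂ => (![x, 0] : C2)) 0 :=
    analyticAt_vec analyticAt_id analyticAt_const
  have hlt : Tendsto (fun x : ℂ => (![x, 0] : C2)) (𝓝 0) (𝓝 0) := by
    have := hline.continuousAt.tendsto
    rwa [vec_zero_zero] at this
  set y : ℂ → ℂ := fun x => κ₂.symm ![x, 0] 1 with hy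
  have hyan : AnalyticAt ℂ y 0 := (analyticAt_apply 1 _).comp
    (AnalyticAt.fun_comp_of_eq hκ₂an hline vec_zero_zero)
  have hy0 : y 0 = 0 := by simp [hy, vec_zero_zero, h₂0]
  have hyt : Tendsto y (𝓝 0) (𝓝 0) := by
    have := hyan.continuousAt.tendsto
    rwa [hy0] at this
  have hcurve : ∀ᶠ x in 𝓝 0, κ₂.symm ![x, 0] 0 = x ∧
      Φ (κ₂.symm ![x, 0]) = ![E₀ x, E₁ x + y x] ∧ G (Φ (κ₂.symm ![x, 0])) 1 = 0 := by
    filter_upwards [hlt.eventually (κ₂.open_target.mem_nhds ht₂)] with x hx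
    have h1 := hKκ _ hx
    have h2 : κ₂.symm ![x, 0] 0 = x := congrFun h1 0
    refine ⟨h2, ?_, congrFun h1 1⟩
    simp only [hΦ, straighten, h2, hy]
  -- The curve ζ₁ = 0 is not the invariant curve, but it is so close to it that the first component
  -- of the displacement has the same expansion up to third order. Hence k(0) = -a and k'(0) = -(a²
  -- + a E₀''(0)).
  obtain ⟨hybig, hlittle⟩ := H.isBigO_of_displacement_eq_zero hδ hyt (by
    filter_upwards [hcurve] with x hx
    rw [← hx.2.1]
    exact hx.2.2)
  obtain ⟨k, hk, hηk, hk0, hk1⟩ := exists_eq_sq_mul_of_isLittleO (f := fun x => η ![x, 0])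
    (AnalyticAt.fun_comp_of_eq hηan hline vec_zero_zero) (hlittle.congr' (by
      filter_upwards [hcurve] with x hx
      rw [← hx.2.1]) EventuallyEq.rfl)
  have hy' : HasDerivAt y 0 0 := by
    obtain ⟨q, hq, hyq⟩ := exists_eq_pow_mul_of_isBigO hyan hybig
    have h1 := (hasDerivAt_pow 3 (0 : ℂ)).mul hq.differentiableAt.hasDerivAt
    refine (h1.congr_of_eventuallyEq hyq).congr_deriv ?_
    simp
  have hγ : HasDerivAt (fun x => (![E₀ x, E₁ x + y x] : C2)) ![1, 0] 0 := by
    have := hasDerivAt_vec H.analyticAt_fst.differentiableAt.hasDerivAt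
      (H.analyticAt_snd.differentiableAt.hasDerivAt.add hy')
    rwa [H.deriv_fst, H.deriv_snd, add_zero] at this
  have hγ0 : (![E₀ 0, E₁ 0 + y 0] : C2) = 0 := by
    simp [H.fst_zero, H.snd_zero, hy0, vec_zero_zero]
  have hmγ : HasDerivAt (fun x => m ![E₀ x, E₁ x + y x]) (2 * a * δ) 0 := by
    have h1 := hasDerivAt_comp_of_tangent (H.analyticAt_partial ![0, 1] 1) hγ hγ0
    rw [H.partial_snd] at h1
    refine (h1.const_sub 1).congr_deriv ?_
    ring
  -- The inverse chart is Θ ∘ K⁻¹. The factor Θ contributes det L⁻¹ · E₀', and K⁻¹ contributes 1/m.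
  have hdet : ∀ᶠ x in 𝓝 0, (fderiv ℂ κ.symm ![x, 0]).det / k x =
      ((L : C2 →L[ℂ] C2).det)⁻¹ * (deriv E₀ x / (m ![E₀ x, E₁ x + y x] * k x)) := by
    filter_upwards [hcurve, hlt.eventually (κ₂.open_target.eventually_mem ht₂),
      hlt.eventually hκ₂an.eventually_analyticAt,
      (hκ₂t.comp hlt).eventually hKdet, (hκ₂t.comp hlt).eventually hΘdet,
      (hκ₂t.comp hlt).eventually hΘan.eventually_analyticAt] with x h1 h2 h3 h4 h5 h6
    simp only [Function.comp_apply] at h4 h5 h6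
    have h7 : (fderiv ℂ K (κ₂.symm ![x, 0])).comp (fderiv ℂ κ₂.symm ![x, 0]) =
        ContinuousLinearMap.id ℂ C2 := by
      refine ((h4.1.differentiableAt.hasFDerivAt.comp _
        h3.differentiableAt.hasFDerivAt).congr_of_eventuallyEq ?_).unique (hasFDerivAt_id _)
      filter_upwards [κ₂.open_target.mem_nhds h2] with ξ hξ
      exact (hKκ ξ hξ).symm
    have h8 := congrArg ContinuousLinearMap.det h7
    rw [det_comp_C2, h4.2, h1.2.1] at h8
    have h9 : (ContinuousLinearMap.id ℂ C2).det = 1 := by simp [ContinuousLinearMap.det]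
    rw [h9] at h8
    have h10 : fderiv ℂ κ.symm ![x, 0] =
        (fderiv ℂ Θ (κ₂.symm ![x, 0])).comp (fderiv ℂ κ₂.symm ![x, 0]) := by
      rw [funext hκsymm]
      exact (h6.differentiableAt.hasFDerivAt.comp _ h3.differentiableAt.hasFDerivAt).fderiv
    rw [h10, det_comp_C2, h5, h1.1, eq_inv_of_mul_eq_one_right h8]
    rw [div_eq_mul_inv, div_eq_mul_inv, mul_inv]
    ring
  have hres := hasGrothendieckResidue_of_coordinates hg L hsource hκ0 hκan hκsan hηan hgη hk
    (by rw [hk0]; exact neg_ne_zero.2 ha) hηk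
  have hquot : HasDerivAt (fun x => ((L : C2 →L[ℂ] C2).det)⁻¹ *
      (deriv E₀ x / (m ![E₀ x, E₁ x + y x] * k x))) _ 0 :=
    (H.analyticAt_fst.deriv.differentiableAt.hasDerivAt.div
      (hmγ.mul hk.differentiableAt.hasDerivAt) (by
        simp only [Pi.mul_apply, hγ0, hm0, hk0]
        exact mul_ne_zero hδ' (neg_ne_zero.2 ha))).const_mul _
  have hfinal := (hquot.congr_of_eventuallyEq hdet).deriv
  rw [hfinal] at hres
  convert hres using 1
  -- With b = E₀''(0), the one-jets are E₀' = 1 + bx, m = (1 - δ) + 2aδx and k = -a - (a² + ab)x.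
  -- The logarithmic derivative of E₀'/(mk) at 0 is b - 2aδ/(1 - δ) - (a + b), so b disappears. The
  -- value -1/(a(1 - δ)) of the quotient at 0 then removes a.
  simp only [Pi.mul_apply, hγ0, hm0, hk0, hk1, H.deriv_fst]
  field_simp
  ring

end IsParabolicNormalForm

/-! ### Linear reduction to the parabolic normal form -/

/-- A linear map of `ℂ²` with eigenvector `v` of eigenvalue `1` and determinant `δ ≠ 1` is
diagonalizable. -/
theorem exists_diagonalization {A : C2 →L[ℂ] C2} {v : C2} (hv : v ≠ 0) (hAv : A v = v)
    (hδ : A.det ≠ 1) :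
    ∃ L : C2 ≃L[ℂ] C2, L v = ![1, 0] ∧ ∀ w, L (A (L.symm w)) = ![w 0, A.det * w 1] := by
  set δ := A.det with hδdef
  have hA : ∀ w : C2, A w = w 0 • A ![1, 0] + w 1 • A ![0, 1] := by
    intro w
    rw [← map_smul, ← map_smul, ← map_add]
    congr 1
    ext i
    fin_cases i <;> simp
  obtain ⟨u, hu, hAu⟩ : ∃ u : C2, u ≠ 0 ∧ A u = δ • u := by
    have hdet1 : (A - ContinuousLinearMap.id ℂ C2).det = 0 := by
      by_contra hne
      refine hv (((A - ContinuousLinearMap.id ℂ C2).toContinuousLinearEquivOfDetNeZero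
        hne).injective ?_)
      simp [hAv]
    -- In dimension two with determinant δ, the characteristic polynomial satisfies χ(δ) = δ χ(1).
    have hdetδ : (A - δ • ContinuousLinearMap.id ℂ C2).det = 0 := by
      have h1 := det_eq_of_C2 A
      rw [← hδdef] at h1
      rw [det_eq_of_C2] at hdet1 ⊢
      simp at hdet1 ⊢
      linear_combination δ * hdet1 - (1 - δ) * h1
    have := LinearMap.bot_lt_ker_of_det_eq_zero hdetδ
    obtain ⟨u, hu, hu0⟩ := SetLike.exists_of_lt this
    refine ⟨u, by simpa using hu0, ?_⟩
    have h2 : (A - δ • ContinuousLinearMap.id ℂ C2) u = 0 := hu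
    simpa [sub_eq_zero] using h2
  set B : C2 →L[ℂ] C2 := (ContinuousLinearMap.proj (R := ℂ) (φ := fun _ : Fin 2 => ℂ) 0).smulRight v
    + (ContinuousLinearMap.proj (R := ℂ) (φ := fun _ : Fin 2 => ℂ) 1).smulRight u with hB
  have hBapp : ∀ w, B w = w 0 • v + w 1 • u := fun w => rfl
  have hBinj : ∀ w, B w = 0 → w = 0 := by
    intro w hw
    have h1 := congrArg A hw
    rw [hBapp] at hw h1
    rw [map_add, map_smul, map_smul, hAv, hAu, map_zero] at h1
    have h2 : (w 1 * (δ - 1)) • u = 0 := by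
      have h3 : (w 1 * (δ - 1)) • u = (w 0 • v + w 1 • δ • u) - (w 0 • v + w 1 • u) := by
        module
      rw [h3, h1, hw, sub_zero]
    have h3 : w 1 = 0 := by
      have := (smul_eq_zero.1 h2).resolve_right hu
      exact (mul_eq_zero.1 this).resolve_right (sub_ne_zero.2 hδ)
    rw [h3, zero_smul, add_zero] at hw
    have h4 := (smul_eq_zero.1 hw).resolve_right hv
    ext i
    fin_cases i
    exacts [h4, h3]
  have hBdet : B.det ≠ 0 := by
    intro h0
    obtain ⟨w, hw, hw0⟩ := SetLike.exists_of_lt (LinearMap.bot_lt_ker_of_det_eq_zero h0)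
    exact hw0 (by simpa using hBinj w hw)
  set L := (B.toContinuousLinearEquivOfDetNeZero hBdet).symm with hL
  have hLs : ∀ w, L.symm w = w 0 • v + w 1 • u := fun w => rfl
  refine ⟨L, ?_, fun w => ?_⟩
  · apply L.symm.injective
    rw [L.symm_apply_apply, hLs]
    simp
  · apply L.symm.injective
    rw [L.symm_apply_apply, hLs, hLs, map_add, map_smul, map_smul, hAv, hAu]
    simp [smul_smul, mul_comm]

/-- A parabolic fixed point can be brought into normal form by a linear change of coordinates. -/
theorem exists_isParabolicNormalForm {f : C2 → C2} (hf : AnalyticAt ℂ f 0) (hf0 : f 0 = 0)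
    {e : ℂ → C2} (he : AnalyticAt ℂ e 0) (he0 : e 0 = 0) (he1 : deriv e 0 ≠ 0) {a δ : ℂ}
    (hfe : ∀ᶠ t in 𝓝 0, f (e t) = e (t / (1 - a * t))) {h : C2 → ℂ} (hh : AnalyticAt ℂ h 0)
    (hh0 : h 0 ≠ 0) (hjac : ∀ᶠ z in 𝓝 0, h (f z) * (fderiv ℂ f z).det = δ * h z) (hδ : δ ≠ 1) :
    ∃ L : C2 ≃L[ℂ] C2, IsParabolicNormalForm (fun z => L (f (L.symm z)))
      (fun t => L (e t) 0) (fun t => L (e t) 1) (fun z => h (L.symm z)) a δ := by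
  have hdet : (fderiv ℂ f 0).det = δ := by
    have := hjac.self_of_nhds
    rw [hf0, mul_comm] at this
    exact mul_right_cancel₀ hh0 this
  -- The map t/(1 - at) has derivative 1 at 0, so the semiconjugacy makes the tangent vector of the
  -- curve an eigenvector with eigenvalue 1.
  have hAv : fderiv ℂ f 0 (deriv e 0) = deriv e 0 := by
    have h1 : HasDerivAt (fun t => f (e t)) (fderiv ℂ f 0 (deriv e 0)) 0 :=
      HasFDerivAt.comp_hasDerivAt (l := f) (0 : ℂ) (by
        rw [he0]
        exact hf.differentiableAt.hasFDerivAt) he.differentiableAt.hasDerivAt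
    have h2 : HasDerivAt (fun t => e (t / (1 - a * t))) ((1 / (1 - a * 0) ^ 2 : ℂ) • deriv e 0) 0 :=
      HasDerivAt.scomp (g₁ := e) (0 : ℂ) (by
        simpa using he.differentiableAt.hasDerivAt) (hasDerivAt_parabolic a (by simp))
    simpa using (h1.congr_of_eventuallyEq (hfe.mono fun t ht => ht.symm)).unique h2
  obtain ⟨L, hLv, hLA⟩ := exists_diagonalization he1 hAv (hdet.trans_ne hδ)
  rw [hdet] at hLA
  have hLst : Tendsto L.symm (𝓝 0) (𝓝 0) := by
    have := L.symm.continuous.tendsto 0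
    rwa [map_zero] at this
  have hder : ∀ᶠ z in 𝓝 0, fderiv ℂ (fun z => L (f (L.symm z))) z =
      (L : C2 →L[ℂ] C2).comp ((fderiv ℂ f (L.symm z)).comp (L.symm : C2 →L[ℂ] C2)) := by
    filter_upwards [hLst.eventually hf.eventually_analyticAt] with z hz
    exact ((L : C2 →L[ℂ] C2).hasFDerivAt.comp z (HasFDerivAt.comp (g := f) z
      hz.differentiableAt.hasFDerivAt (L.symm : C2 →L[ℂ] C2).hasFDerivAt)).fderiv
  have hdeta : HasDerivAt (fun t => L (e t)) ![1, 0] 0 := by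
    rw [← hLv]
    exact (L : C2 →L[ℂ] C2).hasFDerivAt.comp_hasDerivAt (0 : ℂ) he.differentiableAt.hasDerivAt
  have hLLs : (L : C2 →L[ℂ] C2).det * (L.symm : C2 →L[ℂ] C2).det = 1 := by
    rw [← det_comp_C2, ContinuousLinearEquiv.coe_comp_coe_symm]
    simp [ContinuousLinearMap.det]
  refine ⟨L, ?_, ?_, ?_, ?_, ?_, ?_, ?_, ?_, ?_, ?_, ?_, ?_, ?_⟩
  · exact ((L : C2 →L[ℂ] C2).analyticAt _).comp (AnalyticAt.fun_comp_of_eq hf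
      ((L.symm : C2 →L[ℂ] C2).analyticAt 0) (map_zero _))
  · simp [hf0]
  · intro v
    rw [hder.self_of_nhds, map_zero]
    exact hLA v
  · exact analyticAt_coord_comp L 0 he
  · exact analyticAt_coord_comp L 1 he
  · simp [he0]
  · simp [he0]
  · exact (hasDerivAt_pi.1 hdeta 0).deriv
  · exact (hasDerivAt_pi.1 hdeta 1).deriv
  · have hvec : ∀ w : C2, (![w 0, w 1] : C2) = w := fun w => by
      ext i
      fin_cases i <;> rfl
    filter_upwards [hfe] with t ht
    rw [hvec, hvec, L.symm_apply_apply, ht]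
  · exact AnalyticAt.fun_comp_of_eq hh ((L.symm : C2 →L[ℂ] C2).analyticAt 0) (map_zero _)
  · simpa using hh0
  · filter_upwards [hder, hLst.eventually hjac] with z h1 h2
    rw [h1, L.symm_apply_apply, det_comp_C2, det_comp_C2, ← h2]
    linear_combination (h (f (L.symm z)) * (fderiv ℂ f (L.symm z)).det) * hLLs

/-- The multiplicity and the residue at a parabolic fixed point on an invariant curve. -/
theorem multiplicity_and_residue_of_parabolic {f : C2 → C2} (hf : AnalyticAt ℂ f 0) (hf0 : f 0 = 0)
    {e : ℂ → C2} (he : AnalyticAt ℂ e 0) (he0 : e 0 = 0) (he1 : deriv e 0 ≠ 0) {a δ : ℂ}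
    (ha : a ≠ 0) (hfe : ∀ᶠ t in 𝓝 0, f (e t) = e (t / (1 - a * t))) {h : C2 → ℂ}
    (hh : AnalyticAt ℂ h 0) (hh0 : h 0 ≠ 0)
    (hjac : ∀ᶠ z in 𝓝 0, h (f z) * (fderiv ℂ f z).det = δ * h z) (hδ : δ ≠ 1) :
    germMultiplicity (fun z => z - f z) = 2 ∧
      HasGrothendieckResidue (fun z => z - f z) ((1 + δ) / (1 - δ) ^ 2) := by
  obtain ⟨L, H⟩ := exists_isParabolicNormalForm hf hf0 he he0 he1 hfe hh hh0 hjac hδ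
  have hg : AnalyticAt ℂ (fun z => z - f z) 0 := analyticAt_id.sub hf
  have hLg : ∀ z, L (L.symm z - f (L.symm z)) = z - L (f (L.symm z)) := fun z => by
    rw [map_sub, L.apply_symm_apply]
  exact ⟨H.multiplicity_eq_two ha hδ hg L hLg, H.hasGrothendieckResidue ha hδ hg L hLg⟩

/-! ### Holomorphic curves on a complex surface -/

section Curves

variable {X : Type*} [TopologicalSpace X] [ChartedSpace C2 X]

theorem analyticAt_chart_comp [IsManifold 𝓘(ℂ, C2) ω X] {γ : ℂ → X}
    (hγ : ContMDiff 𝓘(ℂ, ℂ) 𝓘(ℂ, C2) ω γ) (p : X) {w : ℂ} (hw : γ w ∈ (chartAt C2 p).source) :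
    AnalyticAt ℂ (fun w => chartAt C2 p (γ w)) w := by
  have h1 : ContMDiffAt 𝓘(ℂ, C2) 𝓘(ℂ, C2) ω (chartAt C2 p) (γ w) :=
    contMDiffOn_chart.contMDiffAt ((chartAt C2 p).open_source.mem_nhds hw)
  exact (contMDiffAt_iff_contDiffAt.1 (h1.comp w hγ.contMDiffAt)).analyticAt

theorem deriv_chart_comp [IsManifold 𝓘(ℂ, C2) ω X] {γ : ℂ → X}
    (hγ : ContMDiff 𝓘(ℂ, ℂ) 𝓘(ℂ, C2) ω γ) (p : X) {w : ℂ} (hw : γ w ∈ (chartAt C2 p).source) :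
    deriv (fun w => chartAt C2 p (γ w)) w =
      mfderiv 𝓘(ℂ, C2) 𝓘(ℂ, C2) (chartAt C2 p) (γ w)
        (mfderiv 𝓘(ℂ, ℂ) 𝓘(ℂ, C2) γ w (1 : ℂ)) := by
  have : IsManifold 𝓘(ℂ, C2) 1 X := IsManifold.of_le (n := ω) (by simp)
  have h1 := mfderiv_comp (I := 𝓘(ℂ, ℂ)) (I' := 𝓘(ℂ, C2)) (I'' := 𝓘(ℂ, C2)) w
    ((mdifferentiable_chart p).mdifferentiableAt hw)
    (hγ.contMDiffAt.mdifferentiableAt (x := w) (by simp))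
  rw [mfderiv_eq_fderiv] at h1
  exact congrArg (fun T : ℂ →L[ℂ] C2 => T 1) h1

theorem deriv_chart_comp_ne_zero_iff [IsManifold 𝓘(ℂ, C2) ω X] {γ : ℂ → X}
    (hγ : ContMDiff 𝓘(ℂ, ℂ) 𝓘(ℂ, C2) ω γ) (p : X) {w : ℂ} (hw : γ w ∈ (chartAt C2 p).source) :
    deriv (fun w => chartAt C2 p (γ w)) w ≠ 0 ↔ mfderiv 𝓘(ℂ, ℂ) 𝓘(ℂ, C2) γ w ≠ 0 := by
  have : IsManifold 𝓘(ℂ, C2) 1 X := IsManifold.of_le (n := ω) (by simp)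
  rw [deriv_chart_comp hγ p hw]
  have hinj := (mdifferentiable_chart (I := 𝓘(ℂ, C2)) p).mfderiv_injective hw
  refine not_congr ⟨fun h => ?_, fun h => ?_⟩
  · have h1 := hinj (h.trans (map_zero _).symm)
    exact ContinuousLinearMap.ext_ring (R₁ := ℂ) (M₁ := C2) h1
  · rw [h]
    exact map_zero _

/-- A continuous lift of a holomorphic curve through an immersed holomorphic curve is
holomorphic. -/
theorem analyticAt_lift [IsManifold 𝓘(ℂ, C2) ω X] {γ γ' : ℂ → X}
    (hγ : ContMDiff 𝓘(ℂ, ℂ) 𝓘(ℂ, C2) ω γ) (hγ' : ContMDiff 𝓘(ℂ, ℂ) 𝓘(ℂ, C2) ω γ')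
    {u : ℂ → ℂ} {w : ℂ} (hu : ContinuousAt u w)
    (himm : mfderiv 𝓘(ℂ, ℂ) 𝓘(ℂ, C2) γ (u w) ≠ 0) (h : ∀ᶠ z in 𝓝 w, γ (u z) = γ' z) :
    AnalyticAt ℂ u w := by
  set c := chartAt C2 (γ (u w)) with hc
  have hsrc : γ (u w) ∈ c.source := mem_chart_source _ _
  have hsrc' : γ' w ∈ c.source := h.self_of_nhds ▸ hsrc
  have hd := (deriv_chart_comp_ne_zero_iff hγ (γ (u w)) hsrc).2 himm
  have han := analyticAt_chart_comp hγ (γ (u w)) hsrc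
  have han' := analyticAt_chart_comp hγ' (γ (u w)) hsrc'
  have hpi : ∀ i, HasDerivAt (fun w => c (γ w) i) (deriv (fun w => c (γ w)) (u w) i) (u w) :=
    hasDerivAt_pi.1 han.differentiableAt.hasDerivAt
  -- Some chart coordinate of γ is locally invertible at u(w). Continuity keeps u on that branch, so
  -- u is this local inverse applied to the same coordinate of γ'.
  obtain ⟨i, hi⟩ : ∃ i, deriv (fun w => c (γ w)) (u w) i ≠ 0 := by
    by_contra! h0
    exact hd (funext h0)
  have hai : AnalyticAt ℂ (fun w => c (γ w) i) (u w) := (analyticAt_apply i _).comp han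
  have hai' : AnalyticAt ℂ (fun w => c (γ' w) i) w := (analyticAt_apply i _).comp han'
  have hdi : deriv (fun w => c (γ w) i) (u w) ≠ 0 := by
    rw [(hpi i).deriv]
    exact hi
  have hinv := hai.analyticAt_localInverse hdi
  have hleft := HasStrictFDerivAt.eventually_left_inverse
    (hai.hasStrictDerivAt.hasStrictFDerivAt_equiv hdi)
  have hcomp : AnalyticAt ℂ (fun z => hai.hasStrictDerivAt.localInverse _ _ _ hdi (c (γ' z) i)) w :=
    AnalyticAt.fun_comp_of_eq hinv hai' (by rw [h.self_of_nhds])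
  refine hcomp.congr ?_
  filter_upwards [hu.eventually hleft, h] with z h1 h2
  rw [← h2]
  exact h1

end Curves

/-! ### Automorphisms of the Riemann sphere with a parabolic fixed point -/

/-- The inverse of the affine coordinate of the sphere at infinity. -/
def sphereAtInfty (w : ℂ) : OnePoint ℂ := if w = 0 then OnePoint.infty else ((w⁻¹ : ℂ) : OnePoint ℂ)

theorem sphereAtInfty_of_ne_zero {w : ℂ} (hw : w ≠ 0) :
    sphereAtInfty w = ((w⁻¹ : ℂ) : OnePoint ℂ) := if_neg hw

theorem sphereAtInfty_zero : sphereAtInfty 0 = OnePoint.infty := if_pos rfl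

theorem sphereAtInfty_ne_zero (w : ℂ) : sphereAtInfty w ≠ ((0 : ℂ) : OnePoint ℂ) := by
  by_cases hw : w = 0
  · rw [hw, sphereAtInfty_zero]
    exact OnePoint.infty_ne_coe 0
  · rw [sphereAtInfty_of_ne_zero hw, Ne, OnePoint.coe_eq_coe]
    exact inv_ne_zero hw

/-- The affine coordinate of the sphere. -/
def sphereCoord (q : OnePoint ℂ) : ℂ := q.elim 0 id

/-- The affine coordinate of the sphere at infinity. -/
def sphereCoordInfty (q : OnePoint ℂ) : ℂ := (sphereCoord q)⁻¹

@[simp] theorem sphereCoord_coe (z : ℂ) : sphereCoord (z : OnePoint ℂ) = z := rfl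

@[simp] theorem sphereCoord_infty : sphereCoord OnePoint.infty = 0 := rfl

theorem coe_sphereCoord {q : OnePoint ℂ} (hq : q ≠ OnePoint.infty) :
    ((sphereCoord q : ℂ) : OnePoint ℂ) = q := by
  obtain ⟨z, rfl⟩ := OnePoint.ne_infty_iff_exists.1 hq
  rfl

/-- The default value 0 of `sphereCoord` at infinity and the convention 0⁻¹ = 0 give the coordinate
1/z its correct value 0 at infinity. The origin receives the same value and has to be excluded. -/
theorem sphereAtInfty_sphereCoordInfty {q : OnePoint ℂ} (hq : q ≠ ((0 : ℂ) : OnePoint ℂ)) :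
    sphereAtInfty (sphereCoordInfty q) = q := by
  induction q using OnePoint.rec with
  | infty => simp [sphereCoordInfty, sphereAtInfty_zero]
  | coe z =>
    have hz : z ≠ 0 := fun h => hq (by rw [h])
    rw [sphereCoordInfty, sphereCoord_coe, sphereAtInfty_of_ne_zero (inv_ne_zero hz), inv_inv]

theorem continuousAt_sphereCoord (z : ℂ) : ContinuousAt sphereCoord (z : OnePoint ℂ) := by
  rw [OnePoint.continuousAt_coe]
  exact continuousAt_id

theorem continuousAt_sphereCoordInfty {q : OnePoint ℂ} (hq : q ≠ ((0 : ℂ) : OnePoint ℂ)) :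
    ContinuousAt sphereCoordInfty q := by
  induction q using OnePoint.rec with
  | infty =>
    rw [OnePoint.continuousAt_infty', coclosedCompact_eq_cocompact,
      ← Metric.cobounded_eq_cocompact]
    have h : sphereCoordInfty OnePoint.infty = 0 := inv_zero
    rw [h]
    exact tendsto_inv₀_cobounded (α := ℂ)
  | coe z =>
    have hz : z ≠ 0 := fun h => hq (by rw [h])
    exact (continuousAt_sphereCoord z).inv₀ hz

section Sphere

variable {X : Type*} [TopologicalSpace X] [ChartedSpace C2 X]

theorem IsSphereEmbedding.continuous {φ : OnePoint ℂ → X} (hφ : IsSphereEmbedding φ) :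
    Continuous φ := by
  rw [OnePoint.continuous_iff, coclosedCompact_eq_cocompact, ← Metric.cobounded_eq_cocompact]
  refine ⟨?_, hφ.holomorphic.continuous⟩
  have h1 := (hφ.holomorphic_infty.continuous.tendsto 0).comp (tendsto_inv₀_cobounded (α := ℂ))
  simp only [if_true] at h1
  refine h1.congr' ?_
  filter_upwards [Bornology.eventually_ne_cobounded (0 : ℂ)] with z hz
  simp [hz]

theorem IsSphereEmbedding.contMDiff_atInfty {φ : OnePoint ℂ → X} (hφ : IsSphereEmbedding φ) :
    ContMDiff 𝓘(ℂ, ℂ) 𝓘(ℂ, C2) ω (fun w => φ (sphereAtInfty w)) := hφ.holomorphic_infty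

/-- The definition of an embedding asks for immersivity in this chart only at w = 0. Elsewhere it
follows from the affine chart, since w ↦ w⁻¹ has non-zero derivative. -/
theorem IsSphereEmbedding.mfderiv_atInfty_ne_zero [IsManifold 𝓘(ℂ, C2) ω X] {φ : OnePoint ℂ → X}
    (hφ : IsSphereEmbedding φ) (w : ℂ) :
    mfderiv 𝓘(ℂ, ℂ) 𝓘(ℂ, C2) (fun w => φ (sphereAtInfty w)) w ≠ 0 := by
  by_cases hw : w = 0
  · rw [hw]
    exact hφ.immersion_infty
  · have hsrc := mem_chart_source C2 (φ (sphereAtInfty w))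
    rw [← deriv_chart_comp_ne_zero_iff hφ.contMDiff_atInfty _ hsrc]
    have hsrc' : φ ((w⁻¹ : ℂ) : OnePoint ℂ) ∈ (chartAt C2 (φ (sphereAtInfty w))).source := by
      rw [← sphereAtInfty_of_ne_zero hw]
      exact hsrc
    have h1 := (deriv_chart_comp_ne_zero_iff hφ.holomorphic _ hsrc').2 (hφ.immersion w⁻¹)
    have h2 := (analyticAt_chart_comp hφ.holomorphic _ hsrc').differentiableAt.hasDerivAt
    have h3 := HasDerivAt.scomp (𝕜 := ℂ) w h2 (hasDerivAt_inv hw)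
    have h4 : (fun w' => chartAt C2 (φ (sphereAtInfty w)) (φ (sphereAtInfty w'))) =ᶠ[𝓝 w]
        (fun z : ℂ => chartAt C2 (φ (sphereAtInfty w)) (φ (z : OnePoint ℂ))) ∘ Inv.inv := by
      filter_upwards [isOpen_ne.mem_nhds hw] with z hz
      rw [Function.comp_apply, sphereAtInfty_of_ne_zero (w := z) hz]
    rw [(h3.congr_of_eventuallyEq h4).deriv]
    exact smul_ne_zero (neg_ne_zero.2 (inv_ne_zero (pow_ne_zero 2 hw))) h1

/-- An automorphism that preserves a smooth rational curve, with a fixed point of multiplier one on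
it, acts on the curve as a translation in the affine coordinate centred at the fixed point. -/
theorem exists_translation [IsManifold 𝓘(ℂ, C2) ω X] [T2Space X] {g : X → X}
    (hg : ContMDiff 𝓘(ℂ, C2) 𝓘(ℂ, C2) ω g) (hinj : Function.Injective g)
    {φ : OnePoint ℂ → X} (hφ : IsSphereEmbedding φ) (hgφ : g '' Set.range φ = Set.range φ)
    (h0 : g (φ ((0 : ℂ) : OnePoint ℂ)) = φ ((0 : ℂ) : OnePoint ℂ))
    (hmult : mfderiv 𝓘(ℂ, C2) 𝓘(ℂ, C2) g (φ ((0 : ℂ) : OnePoint ℂ))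
        (mfderiv 𝓘(ℂ, ℂ) 𝓘(ℂ, C2) (fun z : ℂ => φ (z : OnePoint ℂ)) 0 (1 : ℂ)) =
      mfderiv 𝓘(ℂ, ℂ) 𝓘(ℂ, C2) (fun z : ℂ => φ (z : OnePoint ℂ)) 0 (1 : ℂ)) :
    ∃ a : ℂ, ∀ w, g (φ (sphereAtInfty w)) = φ (sphereAtInfty (w - a)) := by
  have hemb := (hφ.continuous.isClosedEmbedding hφ.injective).isEmbedding
  have hex : ∀ q, ∃ q', φ q' = g (φ q) := fun q => by
    have : g (φ q) ∈ Set.range φ := hgφ ▸ Set.mem_image_of_mem g (Set.mem_range_self q)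
    exact this
  choose σ hσ using hex
  have hσc : Continuous σ := by
    rw [hemb.continuous_iff, show φ ∘ σ = g ∘ φ from funext hσ]
    exact hg.continuous.comp hφ.continuous
  have hσ0 : σ ((0 : ℂ) : OnePoint ℂ) = ((0 : ℂ) : OnePoint ℂ) := hφ.injective ((hσ _).trans h0)
  -- By injectivity no other point is sent to the origin. The action therefore has no pole in the
  -- coordinate at infinity, and τ is entire.
  have hσne : ∀ w, σ (sphereAtInfty w) ≠ ((0 : ℂ) : OnePoint ℂ) := fun w h =>
    sphereAtInfty_ne_zero w (hφ.injective (hinj (by rw [← hσ, ← hσ, h, hσ0])))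
  have hιc : Continuous sphereAtInfty :=
    hemb.continuous_iff.2 hφ.contMDiff_atInfty.continuous
  -- the action in the coordinate at infinity
  set τ : ℂ → ℂ := fun w => sphereCoordInfty (σ (sphereAtInfty w)) with hτ
  have hτg : ∀ w, φ (sphereAtInfty (τ w)) = g (φ (sphereAtInfty w)) := fun w => by
    rw [hτ, sphereAtInfty_sphereCoordInfty (hσne w), hσ]
  have hτd : Differentiable ℂ τ := fun w =>
    (analyticAt_lift hφ.contMDiff_atInfty (hg.comp hφ.contMDiff_atInfty)
      (ContinuousAt.comp (f := fun w => σ (sphereAtInfty w))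
        (continuousAt_sphereCoordInfty (hσne w)) (hσc.comp hιc).continuousAt)
      (hφ.mfderiv_atInfty_ne_zero _) (Eventually.of_forall hτg)).differentiableAt
  -- the action in the affine coordinate
  set s : ℂ → ℂ := fun t => sphereCoord (σ (t : OnePoint ℂ)) with hs
  have hs0 : s 0 = 0 := by rw [hs]; simp only [hσ0, sphereCoord_coe]
  have hsc : ContinuousAt s 0 := by
    refine ContinuousAt.comp (g := sphereCoord) (f := fun t : ℂ => σ (t : OnePoint ℂ)) ?_
      (hσc.comp OnePoint.continuous_coe).continuousAt
    rw [hσ0]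
    exact continuousAt_sphereCoord 0
  have hev : ∀ᶠ t : ℂ in 𝓝 0, σ (t : OnePoint ℂ) ≠ OnePoint.infty :=
    (hσc.comp OnePoint.continuous_coe).continuousAt.eventually_ne (by
      simp only [Function.comp_apply, hσ0]
      exact OnePoint.coe_ne_infty 0)
  have hsg : ∀ᶠ t : ℂ in 𝓝 0, φ (s t : OnePoint ℂ) = g (φ (t : OnePoint ℂ)) := by
    filter_upwards [hev] with t ht
    rw [hs, coe_sphereCoord ht, hσ]
  have hγ' := hg.comp hφ.holomorphic
  have hsan : AnalyticAt ℂ s 0 := analyticAt_lift hφ.holomorphic hγ' hsc (hφ.immersion _) hsg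
  have hs1 : deriv s 0 = 1 := by
    set p := φ ((0 : ℂ) : OnePoint ℂ) with hp
    have hsrc : φ ((0 : ℂ) : OnePoint ℂ) ∈ (chartAt C2 p).source := mem_chart_source C2 p
    have hsrc' : (g ∘ fun z : ℂ => φ (z : OnePoint ℂ)) 0 ∈ (chartAt C2 p).source := by
      rw [Function.comp_apply, ← hp, h0]
      exact mem_chart_source C2 p
    have h1 := deriv_chart_comp hγ' p hsrc'
    have h2 := deriv_chart_comp hφ.holomorphic p hsrc
    have h2' := (deriv_chart_comp_ne_zero_iff hφ.holomorphic p hsrc).2 (hφ.immersion 0)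
    have h3 := mfderiv_comp (I := 𝓘(ℂ, ℂ)) (I' := 𝓘(ℂ, C2)) (I'' := 𝓘(ℂ, C2)) (0 : ℂ)
      (hg.contMDiffAt.mdifferentiableAt (x := φ ((0 : ℂ) : OnePoint ℂ)) (by simp))
      (hφ.holomorphic.contMDiffAt.mdifferentiableAt (x := 0) (by simp))
    rw [h3] at h1
    have h4 : deriv (fun w => chartAt C2 p ((g ∘ fun z : ℂ => φ (z : OnePoint ℂ)) w)) 0 =
        deriv (fun w : ℂ => chartAt C2 p (φ (w : OnePoint ℂ))) 0 := by
      rw [h1, h2]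
      have h5 : (g ∘ fun z : ℂ => φ (z : OnePoint ℂ)) 0 = φ ((0 : ℂ) : OnePoint ℂ) := h0
      rw [h5]
      exact congrArg _ hmult
    have h5 := HasDerivAt.scomp (𝕜 := ℂ) (g₁ := fun w : ℂ => chartAt C2 p (φ (w : OnePoint ℂ)))
      (0 : ℂ) (by
        rw [hs0]
        exact (analyticAt_chart_comp hφ.holomorphic p hsrc).differentiableAt.hasDerivAt)
      hsan.differentiableAt.hasDerivAt
    have h6 := (h5.congr_of_eventuallyEq
      (f₁ := fun w => chartAt C2 p ((g ∘ fun z : ℂ => φ (z : OnePoint ℂ)) w)) (by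
        filter_upwards [hsg] with t ht
        simp only [Function.comp_apply, ht])).deriv
    rw [h4] at h6
    have h7 : (deriv s 0 - 1) • deriv (fun w : ℂ => chartAt C2 p (φ (w : OnePoint ℂ))) 0 = 0 := by
      rw [sub_smul, one_smul, ← h6, sub_self]
    exact sub_eq_zero.1 ((smul_eq_zero.1 h7).resolve_right h2')
  -- the difference `τ w - w` is bounded at infinity
  obtain ⟨q, hq, hsq, hq0⟩ := exists_eq_add_mul hsan
  obtain ⟨r, hr, hqr, -⟩ := exists_eq_add_mul hq
  rw [hs0] at hsq
  rw [hq0, hs1] at hqr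
  -- Multiplier one gives s(t) = t(1 + t r(t)). With w = 1/t this yields τ(w) - w = 1/s(t) - 1/t =
  -- -r(t)/(1 + t r(t)), which converges as w → ∞. Liouville's theorem then makes τ(w) - w constant.
  have hlim : Tendsto (fun w => τ w - w) (cocompact ℂ) (𝓝 (-r 0 / (1 + 0 * r 0))) := by
    have h1 : Tendsto (fun t : ℂ => -r t / (1 + t * r t)) (𝓝 0) (𝓝 (-r 0 / (1 + 0 * r 0))) := by
      have hrc := hr.continuousAt
      exact (hrc.neg.div (continuousAt_const.add (continuousAt_id.mul hrc)) (by simp)).tendsto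
    rw [← Metric.cobounded_eq_cocompact]
    refine (h1.comp (tendsto_inv₀_cobounded (α := ℂ))).congr' ?_
    have hne : ∀ᶠ t : ℂ in 𝓝 0, 1 + t * r t ≠ 0 :=
      (continuousAt_const.add (continuousAt_id.mul hr.continuousAt)).eventually_ne (by simp)
    filter_upwards [(tendsto_inv₀_cobounded (α := ℂ)).eventually (hsq.and (hqr.and hne)),
      Bornology.eventually_ne_cobounded (0 : ℂ)] with w hw hw0
    obtain ⟨h2, h3, h4⟩ := hw
    have h5 : τ w = (s w⁻¹)⁻¹ := by
      simp only [hτ, hs, sphereCoordInfty, sphereAtInfty_of_ne_zero hw0]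
    rw [h5, h2, h3, Function.comp_apply]
    generalize r w⁻¹ = R at h4
    have h6 : w + R = w * (1 + w⁻¹ * R) := by
      rw [mul_add, mul_one, mul_inv_cancel_left₀ hw0]
    have h7 : w + R ≠ 0 := h6 ▸ mul_ne_zero hw0 h4
    have h8 : 1 + w⁻¹ * R = (w + R) / w := by rw [h6, mul_div_cancel_left₀ _ hw0]
    obtain ⟨S, rfl⟩ : ∃ S, R = S - w := ⟨w + R, by ring⟩
    rw [add_sub_cancel] at h7 h8
    rw [h8]
    simp only [zero_add, div_eq_mul_inv, mul_inv, inv_inv]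
    linear_combination (-w) * mul_inv_cancel₀ h7
  have hconst := Differentiable.eq_const_of_tendsto_cocompact (hτd.sub differentiable_id) hlim
  refine ⟨r 0, fun w => ?_⟩
  have h1 := congrFun hconst w
  simp only [Pi.sub_apply, id, Function.const_apply, zero_mul, add_zero, div_one] at h1
  have h2 : τ w = w - r 0 := by linear_combination h1
  rw [← hτg, h2]

end Sphere

/-! ### Invariant area forms in local charts -/

/-- Alternating 2-forms on ℂ² are multiples of the determinant. -/
theorem alternating_apply_linear (β : C2 [⋀^Fin 2]→L[ℂ] ℂ) (A : C2 →L[ℂ] C2) :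
    β (fun i => A (Pi.single i (1 : ℂ))) = A.det * β (fun i => Pi.single i (1 : ℂ)) := by
  set b := Pi.basisFun ℂ (Fin 2) with hb
  have h1 : ∀ v, β v = β b * b.det v := fun v =>
    congrArg (fun f : C2 [⋀^Fin 2]→ₗ[ℂ] ℂ => f v) (β.toAlternatingMap.eq_smul_basis_det b)
  have hbe : (fun i => Pi.single i (1 : ℂ) : Fin 2 → C2) = b := by
    ext i
    simp [hb]
  have h2 : (fun i => A (Pi.single i (1 : ℂ))) = (A : C2 →ₗ[ℂ] C2) ∘ b := by
    rw [← hbe]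
    rfl
  rw [hbe, h1, h2, Module.Basis.det_comp, b.det_self, mul_one, mul_comm]

theorem alternating_apply_basis_ne_zero {β : C2 [⋀^Fin 2]→L[ℂ] ℂ} (hβ : β ≠ 0) :
    β (fun i => Pi.single i (1 : ℂ)) ≠ 0 := by
  intro h0
  refine hβ (ContinuousAlternatingMap.toAlternatingMap_injective ?_)
  by_contra h
  refine (AlternatingMap.map_basis_ne_zero_iff (Pi.basisFun ℂ (Fin 2)) _).2 h ?_
  refine Eq.trans ?_ h0
  refine congrArg β ?_
  ext i
  simp

section LocalForm

variable {X : Type*} [TopologicalSpace X] [ChartedSpace C2 X]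

/-- The coefficient of a 2-form in the chart at `p`. -/
def HolomorphicTwoForm.coeff (η : HolomorphicTwoForm X) (p : X) (y : C2) : ℂ :=
  η.toFun ((chartAt C2 p).symm y)
    (fun i => mfderiv 𝓘(ℂ, C2) 𝓘(ℂ, C2) (chartAt C2 p).symm y (Pi.single i (1 : ℂ) : C2))

theorem HolomorphicTwoForm.coeff_ne_zero [IsManifold 𝓘(ℂ, C2) ω X] {η : HolomorphicTwoForm X}
    (hη : η.NowhereVanishing) (p : X) {y : C2} (hy : y ∈ (chartAt C2 p).target) :
    η.coeff p y ≠ 0 := by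
  have : IsManifold 𝓘(ℂ, C2) 1 X := IsManifold.of_le (n := ω) (by simp)
  set S : C2 →L[ℂ] C2 := mfderiv 𝓘(ℂ, C2) 𝓘(ℂ, C2) (chartAt C2 p).symm y with hS
  have hinj : Function.Injective S :=
    (mdifferentiable_chart (I := 𝓘(ℂ, C2)) p).symm.mfderiv_injective hy
  have h1 : η.coeff p y = S.det * (η.toFun ((chartAt C2 p).symm y) : C2 [⋀^Fin 2]→L[ℂ] ℂ)
      (fun i => Pi.single i (1 : ℂ)) := alternating_apply_linear _ S
  rw [h1]
  refine mul_ne_zero (fun h0 => ?_) (alternating_apply_basis_ne_zero (hη _))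
  have h2 := LinearMap.bot_lt_ker_of_det_eq_zero (f := (S : C2 →ₗ[ℂ] C2)) h0
  rw [LinearMap.ker_eq_bot.2 hinj] at h2
  exact lt_irrefl _ h2

theorem analyticAt_chartRep [IsManifold 𝓘(ℂ, C2) ω X] {g : X → X}
    (hg : ContMDiff 𝓘(ℂ, C2) 𝓘(ℂ, C2) ω g) (p : X) {y : C2} (hy : y ∈ (chartAt C2 p).target)
    (hgy : g ((chartAt C2 p).symm y) ∈ (chartAt C2 p).source) :
    AnalyticAt ℂ (fun y => chartAt C2 p (g ((chartAt C2 p).symm y))) y := by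
  have h1 : ContMDiffAt 𝓘(ℂ, C2) 𝓘(ℂ, C2) ω (chartAt C2 p) (g ((chartAt C2 p).symm y)) :=
    contMDiffOn_chart.contMDiffAt ((chartAt C2 p).open_source.mem_nhds hgy)
  have h2 : ContMDiffAt 𝓘(ℂ, C2) 𝓘(ℂ, C2) ω (chartAt C2 p).symm y :=
    contMDiffOn_chart_symm.contMDiffAt ((chartAt C2 p).open_target.mem_nhds hy)
  exact (contMDiffAt_iff_contDiffAt.1 (h1.comp y (hg.contMDiffAt.comp y h2))).analyticAt

/-- This supplies the Jacobian condition of the normal form. Differentiating c⁻¹ ∘ G = g ∘ c⁻¹,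
where c is the chart and G the local expression of g, gives two expressions for the pulled-back form
on the coordinate vectors. -/
theorem HolomorphicTwoForm.coeff_mul_det [IsManifold 𝓘(ℂ, C2) ω X] {η : HolomorphicTwoForm X}
    {g : X → X} {δ : ℂ} (hη : η.PullbackEqSMul g δ) (hg : ContMDiff 𝓘(ℂ, C2) 𝓘(ℂ, C2) ω g) (p : X)
    {y : C2} (hy : y ∈ (chartAt C2 p).target)
    (hgy : g ((chartAt C2 p).symm y) ∈ (chartAt C2 p).source) :
    η.coeff p (chartAt C2 p (g ((chartAt C2 p).symm y))) *
        (fderiv ℂ (fun y => chartAt C2 p (g ((chartAt C2 p).symm y))) y).det =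
      δ * η.coeff p y := by
  have : IsManifold 𝓘(ℂ, C2) 1 X := IsManifold.of_le (n := ω) (by simp)
  set c := chartAt C2 p with hc
  set G : C2 → C2 := fun y => c (g (c.symm y)) with hG
  have hcd := mdifferentiable_chart (I := 𝓘(ℂ, C2)) p
  have hGan : AnalyticAt ℂ G y := analyticAt_chartRep hg p hy hgy
  have hGy : G y ∈ c.target := c.map_source hgy
  have hback : c.symm (G y) = g (c.symm y) := c.left_inv hgy
  have hev : c.symm ∘ G =ᶠ[𝓝 y] g ∘ c.symm := by
    have hcont : ContinuousAt (fun y => g (c.symm y)) y :=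
      hg.continuous.continuousAt.comp (c.continuousAt_symm hy)
    filter_upwards [hcont.eventually (c.open_source.mem_nhds hgy)] with z hz
    exact c.left_inv hz
  have h1 := mfderiv_comp (I := 𝓘(ℂ, C2)) (I' := 𝓘(ℂ, C2)) (I'' := 𝓘(ℂ, C2)) y
    (hcd.mdifferentiableAt_symm hGy) hGan.differentiableAt.mdifferentiableAt
  have h2 := mfderiv_comp (I := 𝓘(ℂ, C2)) (I' := 𝓘(ℂ, C2)) (I'' := 𝓘(ℂ, C2)) y
    (hg.contMDiffAt.mdifferentiableAt (x := c.symm y) (by simp)) (hcd.mdifferentiableAt_symm hy)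
  set S : C2 → C2 →L[ℂ] C2 := fun y => mfderiv 𝓘(ℂ, C2) 𝓘(ℂ, C2) c.symm y with hS
  set M : C2 →L[ℂ] C2 := mfderiv 𝓘(ℂ, C2) 𝓘(ℂ, C2) g (c.symm y) with hM
  have h3 : (S (G y)).comp (fderiv ℂ G y) = M.comp (S y) := by
    rw [mfderiv_eq_fderiv] at h1
    refine Eq.trans (Eq.trans h1.symm ?_) h2
    exact hev.mfderiv_eq
  set β : X → C2 [⋀^Fin 2]→L[ℂ] ℂ := η.toFun with hβ
  have h4 : η.coeff p y = β (c.symm y) (fun i => S y (Pi.single i 1)) := rfl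
  have h5 : η.coeff p (G y) = (S (G y)).det * β (g (c.symm y)) (fun i => Pi.single i 1) := by
    rw [← hback]
    exact alternating_apply_linear _ _
  have h6 : β (g (c.symm y)) (fun i => M.comp (S y) (Pi.single i 1)) = δ * η.coeff p y :=
    hη (c.symm y) (fun i => S y (Pi.single i (1 : ℂ)))
  rw [← h6, ← h3, alternating_apply_linear, det_comp_C2, h5]
  ring

theorem HolomorphicTwoForm.PullbackEqSMul.iterate [IsManifold 𝓘(ℂ, C2) ω X]
    {η : HolomorphicTwoForm X} {g : X → X} {δ : ℂ} (hη : η.PullbackEqSMul g δ)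
    (hg : ContMDiff 𝓘(ℂ, C2) 𝓘(ℂ, C2) ω g) (n : ℕ) : η.PullbackEqSMul g^[n] (δ ^ n) := by
  set β : X → C2 [⋀^Fin 2]→L[ℂ] ℂ := η.toFun with hβ
  induction n with
  | zero =>
    intro x v
    rw [Function.iterate_zero, mfderiv_id, pow_zero, one_mul]
    rfl
  | succ n ih =>
    intro x v
    have h1 := mfderiv_comp (I := 𝓘(ℂ, C2)) (I' := 𝓘(ℂ, C2)) (I'' := 𝓘(ℂ, C2)) x
      (hg.contMDiffAt.mdifferentiableAt (x := g^[n] x) (by simp))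
      ((hg.iterate n).contMDiffAt.mdifferentiableAt (x := x) (by simp))
    have h2 := hη (g^[n] x) (fun i => mfderiv 𝓘(ℂ, C2) 𝓘(ℂ, C2) g^[n] x (v i))
    rw [Function.iterate_succ', h1, pow_succ', mul_assoc, ← ih x v]
    exact h2

end LocalForm

/-! ### From translations of an invariant sphere to multiplicity and index -/

section Translation

variable {X : Type*}

theorem iterate_translation {g : X → X} {φ : OnePoint ℂ → X} {a : ℂ}
    (h : ∀ w, g (φ (sphereAtInfty w)) = φ (sphereAtInfty (w - a))) (n : ℕ) (w : ℂ) :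
    g^[n] (φ (sphereAtInfty w)) = φ (sphereAtInfty (w - n * a)) := by
  induction n with
  | zero => simp
  | succ n ih =>
    rw [Function.iterate_succ_apply', ih, h]
    congr 2
    push_cast
    ring

/-- In the coordinate t = 1/w the translation w ↦ w - a reads t ↦ t/(1 - at). The point t = 0 lies
outside the chart at infinity and is covered by the fixed-point hypothesis. -/
theorem eventually_apply_eq_parabolic {g : X → X} {φ : OnePoint ℂ → X} {a : ℂ}
    (h0 : g (φ ((0 : ℂ) : OnePoint ℂ)) = φ ((0 : ℂ) : OnePoint ℂ))
    (h : ∀ w, g (φ (sphereAtInfty w)) = φ (sphereAtInfty (w - a))) :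
    ∀ᶠ t : ℂ in 𝓝 0, g (φ (t : OnePoint ℂ)) = φ ((t / (1 - a * t) : ℂ) : OnePoint ℂ) := by
  filter_upwards [eventually_one_sub_mul_ne_zero a] with t ht
  by_cases ht0 : t = 0
  · rw [ht0, zero_div, h0]
  · have h1 : t⁻¹ - a = (t / (1 - a * t))⁻¹ := by
      rw [inv_div, sub_div, one_div, mul_div_cancel_right₀ _ ht0]
    have h2 := h t⁻¹
    rwa [h1, sphereAtInfty_of_ne_zero (inv_ne_zero ht0),
      sphereAtInfty_of_ne_zero (inv_ne_zero (div_ne_zero ht0 ht)), inv_inv, inv_inv] at h2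

variable [TopologicalSpace X] [ChartedSpace C2 X]

theorem localRep_apply {g : X → X} (p : X) {x : X} (hx : x ∈ (chartAt C2 p).source) :
    localRep g p (chartAt C2 p x - chartAt C2 p p) = chartAt C2 p (g x) - chartAt C2 p p := by
  rw [localRep, sub_add_cancel, (chartAt C2 p).left_inv hx]

theorem mfderiv_iterate_apply_of_fixed {g : X → X} (hg : ContMDiff 𝓘(ℂ, C2) 𝓘(ℂ, C2) ω g) {p : X}
    (h0 : g p = p) {v : C2} (hv : (mfderiv 𝓘(ℂ, C2) 𝓘(ℂ, C2) g p : C2 →L[ℂ] C2) v = v) (n : ℕ) :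
    (mfderiv 𝓘(ℂ, C2) 𝓘(ℂ, C2) g^[n] p : C2 →L[ℂ] C2) v = v := by
  induction n with
  | zero =>
    rw [Function.iterate_zero, mfderiv_id]
    rfl
  | succ n ih =>
    have h1 := mfderiv_comp (I := 𝓘(ℂ, C2)) (I' := 𝓘(ℂ, C2)) (I'' := 𝓘(ℂ, C2)) p
      ((hg.iterate n).contMDiffAt.mdifferentiableAt (x := g p) (by simp))
      (hg.contMDiffAt.mdifferentiableAt (x := p) (by simp))
    rw [Function.iterate_succ, h1, h0]
    exact (congrArg (mfderiv 𝓘(ℂ, C2) 𝓘(ℂ, C2) g^[n] p : C2 →L[ℂ] C2) hv).trans ih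

theorem eventually_localRep_curve {g : X → X} {φ : OnePoint ℂ → X} (hφ : IsSphereEmbedding φ)
    {a : ℂ} {p : X} (hp : φ ((0 : ℂ) : OnePoint ℂ) = p) (h0 : g p = p)
    (h : ∀ w, g (φ (sphereAtInfty w)) = φ (sphereAtInfty (w - a))) :
    ∀ᶠ t : ℂ in 𝓝 0, localRep g p (chartAt C2 p (φ (t : OnePoint ℂ)) - chartAt C2 p p) =
      chartAt C2 p (φ ((t / (1 - a * t) : ℂ) : OnePoint ℂ)) - chartAt C2 p p := by
  have hcont : ContinuousAt (fun t : ℂ => φ (t : OnePoint ℂ)) 0 :=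
    hφ.holomorphic.continuous.continuousAt
  filter_upwards [eventually_apply_eq_parabolic (by rw [hp, h0]) h,
    hcont.eventually ((chartAt C2 p).open_source.mem_nhds (hp ▸ mem_chart_source C2 p))]
    with t h1 h2
  rw [localRep_apply p h2, h1]

variable [IsManifold 𝓘(ℂ, C2) ω X]

/-- An automorphism that is the identity on a smooth rational curve has no isolated fixed point on
it. -/
theorem fixedPointMultiplicity_eq_top {g : X → X} {φ : OnePoint ℂ → X} (hφ : IsSphereEmbedding φ)
    {p : X} (hp : φ ((0 : ℂ) : OnePoint ℂ) = p) (h0 : g p = p)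
    (h : ∀ w, g (φ (sphereAtInfty w)) = φ (sphereAtInfty w)) :
    fixedPointMultiplicity g p = ⊤ := by
  have hsrc : φ ((0 : ℂ) : OnePoint ℂ) ∈ (chartAt C2 p).source := hp ▸ mem_chart_source C2 p
  have han := analyticAt_chart_comp hφ.holomorphic p hsrc
  have hd := (deriv_chart_comp_ne_zero_iff hφ.holomorphic p hsrc).2 (hφ.immersion 0)
  obtain ⟨i, hi⟩ : ∃ i, deriv (fun w : ℂ => chartAt C2 p (φ (w : OnePoint ℂ))) 0 i ≠ 0 := by
    by_contra! h0
    exact hd (funext h0)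
  have hder := (hasDerivAt_pi.1 han.differentiableAt.hasDerivAt i).sub_const (chartAt C2 p p i)
  refine germMultiplicity_eq_top
    (e := fun t => chartAt C2 p (φ (t : OnePoint ℂ)) - chartAt C2 p p) (i := i) ?_ ?_ ?_
  · have h1 : Tendsto (fun t : ℂ => chartAt C2 p (φ (t : OnePoint ℂ)) - chartAt C2 p p) (𝓝 0) _ :=
      (han.continuousAt.sub continuousAt_const).tendsto
    simpa [hp] using h1
  · filter_upwards [eventually_localRep_curve hφ (a := 0) hp h0 (by simpa using h)] with t ht
    rw [ht]
    simp
  · exact fun c => hder.eventually_ne hi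

/-- Multiplicity and holomorphic index at the fixed point of an automorphism that acts on a smooth
rational curve as a nontrivial translation. -/
theorem multiplicity_and_index_of_translation {g : X → X} (hg : ContMDiff 𝓘(ℂ, C2) 𝓘(ℂ, C2) ω g)
    {φ : OnePoint ℂ → X} (hφ : IsSphereEmbedding φ) {p : X} (hp : φ ((0 : ℂ) : OnePoint ℂ) = p)
    (h0 : g p = p) {a : ℂ} (ha : a ≠ 0)
    (h : ∀ w, g (φ (sphereAtInfty w)) = φ (sphereAtInfty (w - a)))
    {η : HolomorphicTwoForm X} (hη : η.NowhereVanishing) {δ : ℂ} (hηg : η.PullbackEqSMul g δ)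
    (hδ : δ ≠ 1) :
    fixedPointMultiplicity g p = 2 ∧ HasHolomorphicIndex g p ((1 + δ) / (1 - δ) ^ 2) := by
  set c := chartAt C2 p with hc
  have hps : p ∈ c.source := mem_chart_source C2 p
  have hpt : c p ∈ c.target := c.map_source hps
  have hcp : c.symm (c p) = p := c.left_inv hps
  have hsrc : φ ((0 : ℂ) : OnePoint ℂ) ∈ c.source := hp ▸ hps
  have hgs : g (c.symm (c p)) ∈ c.source := by rwa [hcp, h0]
  have hadd : AnalyticAt ℂ (fun z : C2 => z + c p) 0 := analyticAt_id.add analyticAt_const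
  have hF : AnalyticAt ℂ (localRep g p) 0 :=
    (AnalyticAt.fun_comp_of_eq (analyticAt_chartRep hg p hpt hgs) hadd (zero_add _)).sub
      analyticAt_const
  have hF0 : localRep g p 0 = 0 := by
    rw [localRep, zero_add, ← hc, hcp, h0, sub_self]
  have hcoeff : AnalyticAt ℂ (η.coeff p) (c p) := η.holomorphic c (chart_mem_atlas C2 p) _ hpt
  have hder : deriv (fun t : ℂ => c (φ (t : OnePoint ℂ)) - c p) 0 ≠ 0 := by
    rw [deriv_sub_const]
    exact (deriv_chart_comp_ne_zero_iff hφ.holomorphic p hsrc).2 (hφ.immersion 0)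
  refine multiplicity_and_residue_of_parabolic hF hF0
    (e := fun t => c (φ (t : OnePoint ℂ)) - c p)
    ((analyticAt_chart_comp hφ.holomorphic p hsrc).sub analyticAt_const) (by simp [hp])
    hder ha (eventually_localRep_curve hφ hp h0 h) (h := fun z => η.coeff p (z + c p))
    (AnalyticAt.fun_comp_of_eq hcoeff hadd (zero_add _)) ?_ ?_ hδ
  · rw [zero_add]
    exact η.coeff_ne_zero hη p hpt
  · have hcont : ContinuousAt (fun z : C2 => z + c p) 0 := hadd.continuousAt
    have hcont' : ContinuousAt (fun z : C2 => g (c.symm (z + c p))) 0 := by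
      refine ContinuousAt.comp (g := fun y => g (c.symm y)) ?_ hcont
      rw [zero_add]
      exact hg.continuous.continuousAt.comp (c.continuousAt_symm hpt)
    filter_upwards [hcont.eventually (c.open_target.mem_nhds (by simpa only [zero_add])),
      hcont'.eventually (c.open_source.mem_nhds (by simpa only [zero_add]))] with z h1 h2
    have h3 := η.coeff_mul_det hηg hg p h1 h2
    have h4 : fderiv ℂ (localRep g p) z =
        fderiv ℂ (fun y => c (g (c.symm y))) (z + c p) := by
      refine Eq.trans (fderiv_sub_const (c p)) ?_
      exact fderiv_comp_add_right (𝕜 := ℂ) (f := fun y => c (g (c.symm y))) (x := z) (c p)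
    rw [h4, localRep, sub_add_cancel]
    exact h3

end Translation

/-- The minimal polynomial of a root of unity divides some Xⁿ - 1, so its conjugates satisfy the
same equation. A real number s > 1 does not. -/
theorem IsConjToSalem.pow_ne_one {δ : ℂ} (h : IsConjToSalem δ) {n : ℕ} (hn : n ≠ 0) :
    δ ^ n ≠ 1 := by
  obtain ⟨s, ⟨hs, -⟩, hconj⟩ := h
  intro h1
  have h2 : minpoly ℚ δ ∣ (Polynomial.X ^ n - 1 : Polynomial ℚ) :=
    minpoly.dvd ℚ δ (by simp [h1])
  rw [← hconj] at h2
  have h3 := minpoly.aeval ℚ (s : ℂ)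
  have h4 : Polynomial.aeval (s : ℂ) (Polynomial.X ^ n - 1 : Polynomial ℚ) = 0 :=
    Polynomial.aeval_eq_zero_of_dvd_aeval_eq_zero h2 h3
  have h5 : (s : ℂ) ^ n = 1 := by simpa [sub_eq_zero] using h4
  exact (one_lt_pow₀ hs hn).ne' (by exact_mod_cast h5)

end K3Surface
end

/-! ### The theorem for all iterates -/

theorem theorem6p3 {X : Type*} [TopologicalSpace X] [ChartedSpace K3Surface.C2 X]
    (hX : K3Surface.IsK3 X)
    (f : X ≃ₘ^ω⟮𝓘(ℂ, K3Surface.C2), 𝓘(ℂ, K3Surface.C2)⟯ X)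
    (δ : ℂ) (hδ : K3Surface.IsSpecialEigenvalue f δ) (hSalem : K3Surface.IsConjToSalem δ)
    (p : X) (hp : K3Surface.IsExceptionalTypeI f p)
    (n : ℕ) (hn : 1 ≤ n) :
    K3Surface.IsExceptionalTypeI f^[n] p ∧
      K3Surface.fixedPointMultiplicity f^[n] p = 2 ∧
      K3Surface.HasHolomorphicIndex f^[n] p ((1 + δ ^ n) / (1 - δ ^ n) ^ 2) := by
  have := hX.isManifold
  have := hX.t2
  obtain ⟨⟨h0, -, hfin, -⟩, E, ⟨hE, hfE, hpE⟩, φ, hφ, rfl, hφp, hmult⟩ := hp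
  obtain ⟨η, hη, hηf⟩ := hδ
  have hn0 : n ≠ 0 := Nat.one_le_iff_ne_zero.1 hn
  have hf : ContMDiff 𝓘(ℂ, K3Surface.C2) 𝓘(ℂ, K3Surface.C2) ω f := f.contMDiff
  rw [one_smul] at hmult
  obtain ⟨a, ha⟩ := K3Surface.exists_translation hf f.injective hφ hfE (by rw [hφp, h0]) hmult
  -- This is where finiteness of the multiplicity enters: a zero translation would fix the whole
  -- curve.
  have ha0 : a ≠ 0 := by
    rintro rfl
    refine hfin.ne (K3Surface.fixedPointMultiplicity_eq_top hφ hφp h0 ?_)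
    simpa using ha
  have h0n : f^[n] p = p := Function.iterate_fixed h0 n
  -- The iterate is treated directly, as a map with translation na and eigenvalue δⁿ. No relation
  -- between the indices of f and fⁿ is needed.
  obtain ⟨hμ, hν⟩ := K3Surface.multiplicity_and_index_of_translation (hf.iterate n) hφ hφp h0n
    (mul_ne_zero (Nat.cast_ne_zero.2 hn0) ha0) (K3Surface.iterate_translation ha n) hη
    (hηf.iterate hf n) (hSalem.pow_ne_one hn0)
  have hinv : K3Surface.IsInvariantCurveThrough f^[n] p (Set.range φ) := by
    refine ⟨hE, ?_, hpE⟩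
    rw [Set.image_iterate_eq]
    exact Function.iterate_fixed hfE n
  refine ⟨⟨⟨h0n, hμ.ge, hμ ▸ ENat.natCast_lt_top 2, _, hinv⟩, _, hinv, φ, hφ, rfl, hφp, ?_⟩, hμ, hν⟩
  rw [one_smul]
  exact K3Surface.mfderiv_iterate_apply_of_fixed hf (by rw [hφp, h0]) hmult n
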